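/- **Notation.** For $p\in\mathbb R\setminus\{1\}$ put $p^*=\frac p{p-1}$. A probability density is a measurable $f:\mathbb R\to[0,\infty)$ with $\int f=1$; integrals are over its support. Put $\sigma_q[f]=(\int|x|^qf)^{1/q}$ ($q\ne0$), $\sigma_0[f]=\exp\int f\log|x|$; $N_\lambda[f]=(\int f^\lambda)^{\frac1{1-\lambda}}$ ($\lambda\neq1$), $N_1[f]=\exp(-\int f\log f)$; $\phi_{p,\lambda}[f]=\big(\int|f^{\lambda-2}f'|^pf\big)^{\frac1{p\lambda}}$. Let $\exp_\lambda(x)=(1+(1-\lambda)x)_+^{\frac1{1-\lambda}}$ ($\lambda\neq1$), $\exp_1=\exp$. The generalized Gaussian $g_{p,\lambda}$ is the probability density on the half-line $x>0$ given by $g_{p,\lambda}(x)=a_{p,\lambda}\exp_{2-\lambda}(-x^{p^*})$ if $p\ne0$ and $g_{0,\lambda}(x)=a_{0,\lambda}(-\log x)_+^{\frac1{\lambda-1}}$, with $a_{p,\lambda}$ the normalizing constant. Define $$K^{(0)}_{p,\lambda}=\frac{\sigma_{p^*}[g_{p,\lambda}]}{N_\lambda[g_{p,\lambda}]},\qquad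 \kappa^{(1)}_{p,\lambda}=\phi_{p,\lambda}[g_{p,\lambda}]\,N_\lambda[g_{p,\lambda}],\qquad \kappa^{(0)}_{p,\lambda}=|p^*-1|^{p^*-1}\,\kappa^{(1)}_{1-\lambda,1-p}.$$ Let $\alpha,\beta\in\mathbb R$, $\beta\ne0$, $\alpha\ne2\beta$. For a density $f$ and $c\in\mathbb R$ let $y(x)=c+\int_0^xf(t)^{\frac{\beta-1}\beta}dt$ (assumed to converge for almost every $x$ with $f(x)>0$; the variable $y$ is defined up to translation and $c=0$ is the standard choice; for $\beta=1$, $y(x)=c+x$). For $r\in\mathbb R$ let $\mu_{r,1/\beta}[f]=\int|y(x)|^rf(x)\,dx$, $\sigma_{r,1/\beta}[f]=\mu_{r,1/\beta}[f]^{\beta/r}$ ($r\ne0$), $\sigma_{0,1/\beta}[f]=\exp(\beta\int f\log|y|)$, and, with $x_f\le\infty$ the right end of the support of $f$, $$U(x)=\Big|\tfrac{\alpha-2\beta}\beta\Big|^{\frac{\beta}{\alpha-2\beta}}\int_x^{x_f}|y(r)|^{\frac\beta{\alpha-2\beta}}f(r)\,dr,\qquad M_{q,\alpha,\beta}[f]=\int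 U(x)^qf(x)\,dx .$$ For $q=0$, $M_{0,\alpha,\beta}[f]^{1/0}$ means $\exp\int f\log U$. If $\lambda=1$, respectively $p^*=0$, it is assumed that $f\log|y|$ is integrable, respectively that $U<\infty$ a.e. on $\{f>0\}$ and $f\log U$ is integrable. For a density $g$, differentiable with $g>0$ and $g'\neq0$ on the open interval which is its support, $\mathfrak D_{\alpha,\beta}[g]$ is the density, defined up to translation, with $$\mathfrak D_{\alpha,\beta}[g](s(x))=\frac{g(x)^\alpha}{|g'(x)|^\beta},\qquad s'(x)=-g(x)^{1-\alpha}|g'(x)|^\beta,$$ vanishing off the range of $s$. Put $\overline g_{p,\lambda}=\mathfrak D_{1+p,1}[g_{1-\lambda,1-p}]$ and $\Psi=2\beta-\alpha+\lambda(1-\beta)$. **Theorem.** (a) Let $p\ne1$, $p^*\in[0,\infty)$ and $\lambda>\frac1{1+p^*}$. Then $K^{(0)}_{p,\lambda}>0$, and for every probability density $f$ and every $c$ as above, such that the left-hand side is not of the form $0\cdot\infty$ (in particular if the functionals are finite), $$M_{p^*,\alpha,\beta}^{\frac1{p^*}}[f]\;\sigma_{\frac{\beta(\lambda-1)}{2\beta-\alpha},\frac1\beta}^{\frac1{2\beta-\alpha}}[f]\;\ge\;\Big|\frac{2\beta-\alpha}\beta\Big|^{\frac\beta{\alpha-2\beta}}K^{(0)}_{p,\lambda}.$$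 The bound is sharp: equality holds for $f=\mathfrak D_{\alpha,\beta}[g_{p,\lambda}]$, suitably translated, and some $c$; one may take $c=0$ if $\beta=1$, or if $\lambda>1$, $\frac{2\beta-\alpha}\beta>0$ and $\Psi>0$. Moreover, if $p\neq0$, $\lambda\ne1$, $\beta\ne1$, $\Psi\ne0$, put $P=\frac p{1-\beta}$, $Q=\frac{\lambda-1}\Psi$, $J=(0,1)$ if $\Psi>0$, $J=(1,\infty)$ if $\Psi<0$. Let $w_0\in J$, or $w_0=0$ if $\lambda>1$ and $\Psi>0$; let $\arcsin_{P,Q}(z)=\int_{w_0}^z|1-t^Q|^{-1/P}dt$ on $J$, $\sin_{P,Q}$ its inverse and $\cos_{P,Q}=\sin_{P,Q}'$ (for $w_0=0$ these are the usual generalized trigonometric functions; another $w_0$ shifts the argument by a constant). Then every version of $\mathfrak D_{\alpha,\beta}[g_{p,\lambda}]$ is, up to a translation of the variable $t$, $$C_{p,\lambda}^{\beta}\,a_{p,\lambda}^{\alpha+(\lambda-2)\beta+\frac{(1-\lambda)\beta}p}\;\sin_{P,Q}\Big(\frac t{\mathcal K}\Big)^{\frac{\alpha+(\lambda-2)\beta}\Psi}\cos_{P,Q}\Big(\frac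 t{\mathcal K}\Big)^{\frac\beta{\beta-1}}$$ for $t/\mathcal K\in\arcsin_{P,Q}(J)$, and $0$ otherwise, where $$C_{p,\lambda}=\frac{|1-\lambda|^{1/p}}{p^*a_{p,\lambda}^{(\lambda-1)/p^*}},\qquad \mathcal K=\frac{C_{p,\lambda}^{1-\beta}\,a_{p,\lambda}^{\frac{(\lambda-1)(\beta-1)}p+\Psi}}{\Psi}.$$ (b) Let $p\ne1$, $\lambda<0$ and $\operatorname{sign}\big(\frac{\lambda-1}\lambda+p^*\big)=\operatorname{sign}(1-p^*)$. Then $\kappa^{(0)}_{p,\lambda}>0$, and for every probability density $f$ and every $c$ as above, such that the left-hand side is not of the form $0\cdot\infty$, $$M_{p^*,\alpha,\beta}^{\frac1p}[f]\;\sigma_{\frac{\beta(\lambda-1)}{2\beta-\alpha},\frac1\beta}^{\frac{p^*-1}{2\beta-\alpha}}[f]\;\ge\;\Big|\frac{2\beta-\alpha}\beta\Big|^{\frac{\beta(p^*-1)}{\alpha-2\beta}}\kappa^{(0)}_{p,\lambda},$$ where $M_{p^*}^{1/p}=(M_{p^*}^{1/p^*})^{p^*-1}$, which is also its meaning for $p=0$.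 The bound is sharp: equality holds for $f=\mathfrak D_{\alpha,\beta}[\overline g_{p,\lambda}]$, suitably translated, and some $c$; one may take $c=0$ if $\beta=1$, or if $\frac{2\beta-\alpha}\beta<0$ and $\Psi<0$. -/

import Mathlib

open MeasureTheory Set
open scoped ENNReal

noncomputable section

namespace CumUpper

/-! Probability densities and the classical informational functionals. -/

/-- `f` is a probability density on the real line (extended by zero outside its domain). -/
def IsDensity (f : ℝ → ℝ) : Prop :=
  Measurable f ∧ (∀ x, 0 ≤ f x) ∧ ∫⁻ x, ENNReal.ofReal (f x) = 1

/-- The conjugate exponent `p* = p / (p - 1)`, for `p ≠ 1`. -/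
def conjExp (p : ℝ) : ℝ := p / (p - 1)

/-- The deviation `σ_q[f] = (∫ |x|^q f)^(1/q)`, with `σ_0[f] = exp (∫ f log |x|)`. -/
def deviation (q : ℝ) (f : ℝ → ℝ) : ℝ :=
  if q = 0 then Real.exp (∫ x, Real.log |x| * f x) else (∫ x, |x| ^ q * f x) ^ (1 / q)

/-- The Rényi entropy power `N_lam[f]`, with the Shannon entropy power for `lam = 1`; integrals
are over the support of `f`. -/
def renyiPower (lam : ℝ) (f : ℝ → ℝ) : ℝ :=
  if lam = 1 then Real.exp (-∫ x in Function.support f, f x * Real.log (f x))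
  else (∫ x in Function.support f, f x ^ lam) ^ (1 / (1 - lam))

/-- The `(p, lam)`-Fisher information `F_{p,lam}[f]`. -/
def fisherInfo (p lam : ℝ) (f : ℝ → ℝ) : ℝ :=
  ∫ x in Function.support f, |f x ^ (lam - 2) * deriv f x| ^ p * f x

/-- `φ_{p,lam}[f] = F_{p,lam}[f]^(1 / (p lam))`. -/
def fisherPhi (p lam : ℝ) (f : ℝ → ℝ) : ℝ := fisherInfo p lam f ^ (1 / (p * lam))

/-! Generalized Gaussians and the optimal constants. -/

/-- The Tsallis exponential. -/
def tsallisExp (lam x : ℝ) : ℝ :=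
  if lam = 1 then Real.exp x else (max (1 + (1 - lam) * x) 0) ^ (1 / (1 - lam))

/-- The unnormalized generalized Gaussian on the positive half-line. -/
def gaussShape (p lam x : ℝ) : ℝ :=
  if x ≤ 0 then 0
  else if p = 0 then (max (-Real.log x) 0) ^ (1 / (lam - 1))
  else tsallisExp (2 - lam) (-(x ^ conjExp p))

/-- The normalizing constant `a_{p,lam}`. -/
def gaussNorm (p lam : ℝ) : ℝ := (∫ x, gaussShape p lam x)⁻¹

/-- The generalized Gaussian density `g_{p,lam}` on its decreasing branch `x > 0`. -/
def genGauss (p lam x : ℝ) : ℝ := gaussNorm p lam * gaussShape p lam x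

/-- The optimal constant of the moment-entropy inequality. -/
def constK0 (p lam : ℝ) : ℝ :=
  deviation (conjExp p) (genGauss p lam) / renyiPower lam (genGauss p lam)

/-- The optimal constant of the Stam inequality. -/
def constKappa1 (p lam : ℝ) : ℝ :=
  fisherPhi p lam (genGauss p lam) * renyiPower lam (genGauss p lam)

/-- The optimal constant of the mirrored moment-entropy inequality. -/
def constKappa0 (p lam : ℝ) : ℝ :=
  |conjExp p - 1| ^ (conjExp p - 1) * constKappa1 (1 - lam) (1 - p)

/-- The classical domain of parameters. -/
def ClassicalDomain (p lam : ℝ) : Prop :=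
  p ≠ 1 ∧ 0 ≤ conjExp p ∧ 1 / (1 + conjExp p) < lam

/-- The mirrored domain of parameters. -/
def MirroredDomain (p lam : ℝ) : Prop :=
  p ≠ 1 ∧ lam < 0 ∧ Real.sign ((lam - 1) / lam + conjExp p) = Real.sign (1 - conjExp p)

/-! Cumulative moments and cumulative upper-moments. The differential-escort variable is defined
up to a translation; `c` is the translation constant, and `c = 0` is the standard choice. The
values of all integrands where `f` vanishes are irrelevant. -/

/-- The differential-escort variable `c + ∫_0^x f(t)^(1-γ) dt`. -/
def escortVar (γ c : ℝ) (f : ℝ → ℝ) (x : ℝ) : ℝ := c + ∫ t in (0 : ℝ)..x, f t ^ (1 - γ)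

/-- The integral in the differential-escort variable converges at almost every point where `f`
is positive. -/
def EscortDefined (γ : ℝ) (f : ℝ → ℝ) : Prop :=
  ∀ᵐ x, f x ≠ 0 → IntervalIntegrable (fun t => f t ^ (1 - γ)) volume 0 x

/-- The cumulative moment `μ_{r,γ}[f]`. -/
def cumMoment (r γ c : ℝ) (f : ℝ → ℝ) : ℝ≥0∞ :=
  ∫⁻ x, ENNReal.ofReal (|escortVar γ c f x| ^ r * f x)

/-- `σ_{r,γ}[f] = μ_{r,γ}[f]^(1/(rγ))`, and for `r = 0` the limit
`exp (γ⁻¹ ∫ f log |y|)`, where `y` is the differential-escort variable. -/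
def cumDeviation (r γ c : ℝ) (f : ℝ → ℝ) : ℝ≥0∞ :=
  if r = 0 then ENNReal.ofReal (Real.exp (γ⁻¹ * ∫ x, Real.log |escortVar γ c f x| * f x))
  else cumMoment r γ c f ^ (1 / (r * γ))

/-- The inner integral
`∫_x^{x_f} |∫_0^r f^((β-1)/β)|^(β/(α-2β)) f(r) dr` of the cumulative upper-moment. -/
def upperTail (α β c : ℝ) (f : ℝ → ℝ) (x : ℝ) : ℝ≥0∞ :=
  ∫⁻ r in Ioi x, ENNReal.ofReal (|escortVar (1 / β) c f r| ^ (β / (α - 2 * β)) * f r)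

/-- The cumulative upper-moment `M_{q,α,β}[f]`. -/
def upperMoment (q α β c : ℝ) (f : ℝ → ℝ) : ℝ≥0∞ :=
  ENNReal.ofReal (|(α - 2 * β) / β| ^ (q * β / (α - 2 * β))) *
    ∫⁻ x, upperTail α β c f x ^ q * ENNReal.ofReal (f x)

/-- The logarithm of the variable whose `q`-th moment is `M_{q,α,β}[f]`. -/
def logUpper (α β c : ℝ) (f : ℝ → ℝ) (x : ℝ) : ℝ :=
  Real.log (|(α - 2 * β) / β| ^ (β / (α - 2 * β)) * (upperTail α β c f x).toReal)

/-- `M_{q,α,β}[f]^(1/q)`, with its logarithmic limit for `q = 0`. -/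
def upperDeviation (q α β c : ℝ) (f : ℝ → ℝ) : ℝ≥0∞ :=
  if q = 0 then ENNReal.ofReal (Real.exp (∫ x, logUpper α β c f x * f x))
  else upperMoment q α β c f ^ (1 / q)

/-- The order `β(lam-1)/(2β-α)` of the cumulative moment in the inequalities. -/
def cumOrder (α β lam : ℝ) : ℝ := β * (lam - 1) / (2 * β - α)

/-- `f` is a density for which the functionals in the inequalities are meaningful: the
differential-escort variable exists and the logarithmic integrals, in the two cases in which they
replace moments of order zero, converge. -/
def Admissible (p lam α β c : ℝ) (f : ℝ → ℝ) : Prop :=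
  IsDensity f ∧ EscortDefined (1 / β) f ∧
  (lam = 1 → Integrable (fun x => Real.log |escortVar (1 / β) c f x| * f x)) ∧
  (p = 0 → (∀ᵐ x, f x ≠ 0 → upperTail α β c f x ≠ ⊤) ∧
    Integrable (fun x => logUpper α β c f x * f x))

/-- The product `a * b` is not of the indeterminate form `0 * ∞`. -/
def Determinate (a b : ℝ≥0∞) : Prop := (a = 0 → b ≠ ⊤) ∧ (a = ⊤ → b ≠ 0)

/-! The biparametric down transformation. -/

/-- `f` is a biparametric down transform of the density `g`, strictly monotone on an open
interval: `f(s(x)) = g(x)^α / |g'(x)|^β` with `|s'(x)| = g(x)^(1-α) |g'(x)|^β`. The change of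
variable is taken decreasing, so that the biparametric up transformation, whose change of variable
is decreasing, sends `f` back to `g`. It is defined up to a translation. -/
def IsDownTransform (α β : ℝ) (g f : ℝ → ℝ) : Prop :=
  IsOpen (Function.support g) ∧ (Function.support g).OrdConnected ∧
  (∀ x ∈ Function.support g, 0 < g x ∧ DifferentiableAt ℝ g x ∧ deriv g x ≠ 0) ∧
  ∃ s : ℝ → ℝ,
    (∀ x ∈ Function.support g, HasDerivAt s (-(g x ^ (1 - α) * |deriv g x| ^ β)) x) ∧
    (∀ x ∈ Function.support g, f (s x) = g x ^ α / |deriv g x| ^ β) ∧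
    (∀ y, y ∉ s '' Function.support g → f y = 0)

/-! Generalized trigonometric functions. -/

/-- The generalized arcsine `∫_{w₀}^z |1 - t^Q|^(-1/P) dt` with base point `w₀`; for `w₀ = 0` and
`0 < z < 1` this is the usual one. -/
def genArcsin (P Q w₀ z : ℝ) : ℝ := ∫ t in w₀..z, |1 - t ^ Q| ^ (-1 / P)

/-- The generalized sine: the inverse of the generalized arcsine on the branch `J`. -/
def genSin (P Q w₀ : ℝ) (J : Set ℝ) (y : ℝ) : ℝ := Function.invFunOn (genArcsin P Q w₀) J y

/-- The generalized cosine: the derivative of the generalized sine. -/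
def genCos (P Q w₀ : ℝ) (J : Set ℝ) (y : ℝ) : ℝ := deriv (genSin P Q w₀ J) y

/-- `Ψ(α,β,lam) = 2β - α + lam (1 - β)`. -/
def psi (α β lam : ℝ) : ℝ := 2 * β - α + lam * (1 - β)

/-- The branch of the sine: values in `(0,1)` if `Ψ > 0`, in `(1,∞)` if `Ψ < 0`. -/
def branch (α β lam : ℝ) : Set ℝ := if 0 < psi α β lam then Ioo 0 1 else Ioi 1

/-- Admissible base points of the arcsine: any point of the branch, and also the usual base
point `0` when the arcsine is the usual one. -/
def BasePoint (α β lam w₀ : ℝ) : Prop :=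
  w₀ ∈ branch α β lam ∨ (1 < lam ∧ 0 < psi α β lam ∧ w₀ = 0)

/-- `C_{p,lam} = |1-lam|^(1/p) / (p* a^((lam-1)/p*))`. -/
def constC (p lam : ℝ) : ℝ :=
  |1 - lam| ^ (1 / p) / (conjExp p * gaussNorm p lam ^ ((lam - 1) / conjExp p))

/-- The scale of the argument of the generalized trigonometric functions. -/
def constScale (p lam α β : ℝ) : ℝ :=
  constC p lam ^ (1 - β) *
    gaussNorm p lam ^ ((lam - 1) * (β - 1) / p + psi α β lam) / psi α β lam

/-- The prefactor of the explicit minimizer. -/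
def constAmp (p lam α β : ℝ) : ℝ :=
  constC p lam ^ β * gaussNorm p lam ^ (α + (lam - 2) * β + (1 - lam) * β / p)

/-- The explicit minimizer, in terms of the generalized sine and cosine with parameters
`P = p/(1-β)` and `Q = (lam-1)/Ψ`. -/
def explicitMin (p lam α β w₀ t : ℝ) : ℝ :=
  constAmp p lam α β *
    genSin (p / (1 - β)) ((lam - 1) / psi α β lam) w₀ (branch α β lam)
        (t / constScale p lam α β) ^ ((α + (lam - 2) * β) / psi α β lam) *
    genCos (p / (1 - β)) ((lam - 1) / psi α β lam) w₀ (branch α β lam)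
        (t / constScale p lam α β) ^ (β / (β - 1))

/-- The interval on which the explicit minimizer lives. -/
def explicitSupp (p lam α β w₀ : ℝ) : Set ℝ :=
  {t | t / constScale p lam α β ∈
    genArcsin (p / (1 - β)) ((lam - 1) / psi α β lam) w₀ '' branch α β lam}

end CumUpper

end

noncomputable section

namespace CumUpper

open Filter Topology

/-! Tail functions of measures without atoms. -/

/-- The set on which the upper tail of an atomless measure is at most `l` has measure at most
`l`. -/
theorem measure_tail_le (ν : Measure ℝ) [NullSingletonClass ν] (l : ℝ≥0∞) :
    ν {x | ν (Ioi x) ≤ l} ≤ l := by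
  set E := {x | ν (Ioi x) ≤ l} with hE
  have hup : ∀ x y, x ∈ E → x ≤ y → y ∈ E := fun x y hx hxy =>
    (measure_mono (Ioi_subset_Ioi hxy)).trans hx
  let V : Set ℝ := ⋃ r : {r : ℚ // (r : ℝ) ∈ E}, Ioi ((r : ℚ) : ℝ)
  have hV : ν V ≤ l := by
    have hd : Directed (· ⊆ ·) fun r : {r : ℚ // (r : ℝ) ∈ E} => Ioi ((r : ℚ) : ℝ) := by
      intro a b
      rcases le_total (a : ℚ) (b : ℚ) with h | h
      · exact ⟨a, subset_rfl, Ioi_subset_Ioi (by exact_mod_cast h)⟩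
      · exact ⟨b, Ioi_subset_Ioi (by exact_mod_cast h), subset_rfl⟩
    rw [hd.measure_iUnion]
    exact iSup_le fun r => r.2
  have hS : (E \ V).Subsingleton := by
    have key : ∀ x y, x ∈ E \ V → y ∈ E \ V → ¬ x < y := by
      intro x y hx hy hxy
      obtain ⟨r, h1, h2⟩ := exists_rat_btwn hxy
      exact hy.2 (mem_iUnion.2 ⟨⟨r, hup x r hx.1 h1.le⟩, h2⟩)
    intro x hx y hy
    exact le_antisymm (not_lt.1 (key y x hy hx)) (not_lt.1 (key x y hx hy))
  calc ν E ≤ ν (V ∪ E \ V) := measure_mono (by simp)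
    _ ≤ ν V + ν (E \ V) := measure_union_le _ _
    _ = ν V := by rw [hS.measure_zero, add_zero]
    _ ≤ l := hV

theorem measure_lower_tail_le (ν : Measure ℝ) [NullSingletonClass ν] (l : ℝ≥0∞) :
    ν {x | ν (Iio x) ≤ l} ≤ l := by
  have hn : ∀ s : Set ℝ, (ν.map Neg.neg) s = ν (Neg.neg ⁻¹' s) := fun s =>
    (MeasurableEquiv.neg ℝ).map_apply s
  have : NullSingletonClass (ν.map Neg.neg) := ⟨fun x => by
    rw [hn]; simp⟩
  have h := measure_tail_le (ν.map Neg.neg) l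
  rw [hn] at h
  convert h using 3
  rename_i x
  simp [hn]

theorem antitone_tail (ν : Measure ℝ) : Antitone fun x => ν (Ioi x) := fun _ _ h =>
  measure_mono (Ioi_subset_Ioi h)

theorem measurable_tail (ν : Measure ℝ) : Measurable fun x => ν (Ioi x) :=
  (antitone_tail ν).measurable

/-- The upper tail of an atomless probability measure is uniformly distributed. -/
theorem measure_tail_eq (μ : Measure ℝ) [NullSingletonClass μ] [IsProbabilityMeasure μ] {a : ℝ≥0∞}
    (ha : a ≤ 1) : μ {x | μ (Ioi x) ≤ a} = a := by
  refine le_antisymm (measure_tail_le μ a) ?_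
  have hm : MeasurableSet {x | μ (Ioi x) ≤ a} := measurableSet_le (measurable_tail μ)
    measurable_const
  have h1 : μ {x | μ (Ioi x) ≤ a}ᶜ ≤ 1 - a := by
    refine (measure_mono ?_).trans (measure_lower_tail_le μ (1 - a))
    intro x hx
    simp only [mem_compl_iff, mem_ofPred_eq, not_le] at hx ⊢
    have : μ (Iio x) = 1 - μ (Ioi x) := by
      rw [← prob_compl_eq_one_sub measurableSet_Ioi, compl_Ioi]
      exact measure_congr Iio_ae_eq_Iic
    rw [this]
    exact tsub_le_tsub_left hx.le 1
  rw [prob_compl_eq_one_sub hm] at h1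
  have h2 : μ {x | μ (Ioi x) ≤ a} ≤ 1 := prob_le_one
  have := (ENNReal.sub_le_sub_iff_left ha (by simp)).1 h1
  exact this

/-- Under an atomless measure, the upper tail is dominated by Lebesgue measure on the half-line
when tested against nonincreasing functions. -/
theorem lintegral_antitone_tail_le (ν : Measure ℝ) [NullSingletonClass ν] {F : ℝ → ℝ}
    (hFm : Measurable F)
    (hF0 : ∀ x, 0 ≤ F x) (hF : AntitoneOn F (Ioi 0)) (hfin : ∀ᵐ x ∂ν, ν (Ioi x) ≠ ⊤) :
    ∫⁻ x, ENNReal.ofReal (F (ν (Ioi x)).toReal) ∂ν ≤ ∫⁻ u in Ioi 0, ENNReal.ofReal (F u) := by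
  have hpos : ∀ᵐ x ∂ν, ν (Ioi x) ≠ 0 := by
    rw [ae_iff]
    have := measure_tail_le ν 0
    simpa using this
  rw [lintegral_eq_lintegral_meas_le ν (ae_of_all _ fun x => hF0 _)
      (hFm.comp (measurable_tail ν).ennreal_toReal).aemeasurable,
    lintegral_eq_lintegral_meas_le _ (ae_of_all _ fun x => hF0 _) hFm.aemeasurable]
  refine lintegral_mono fun t => ?_
  rw [Measure.restrict_apply (measurableSet_le measurable_const hFm)]
  set l := volume ({a | t ≤ F a} ∩ Ioi 0) with hl
  refine le_trans (measure_mono_ae ?_) (measure_tail_le ν l)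
  filter_upwards [hpos, hfin] with x h0 h1 hx
  have hx' : t ≤ F (ν (Ioi x)).toReal := hx
  have hp : 0 < (ν (Ioi x)).toReal := ENNReal.toReal_pos h0 h1
  have hsub : Ioc 0 (ν (Ioi x)).toReal ⊆ {a | t ≤ F a} ∩ Ioi 0 := fun u hu =>
    ⟨hx'.trans (hF hu.1 hp hu.2), hu.1⟩
  have := measure_mono (μ := volume) hsub
  rw [Real.volume_Ioc, sub_zero, ENNReal.ofReal_toReal h1] at this
  exact this

/-! Profiles: the common shape of the generalized Gaussians. -/

/-- The primitive `x ^ q / q` of `x ^ (q - 1)`, with `log x` for `q = 0`. -/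
def boxCox (q x : ℝ) : ℝ := if q = 0 then Real.log x else x ^ q / q

theorem hasDerivAt_boxCox (q : ℝ) {x : ℝ} (hx : 0 < x) :
    HasDerivAt (boxCox q) (x ^ (q - 1)) x := by
  rcases eq_or_ne q 0 with rfl | hq
  · have : boxCox 0 = Real.log := by ext; simp [boxCox]
    rw [this, zero_sub, Real.rpow_neg_one]
    exact Real.hasDerivAt_log hx.ne'
  · have : boxCox q = fun x => x ^ q / q := by ext; simp [boxCox, hq]
    rw [this]
    exact ((Real.hasDerivAt_rpow_const (p := q) (Or.inl hx.ne')).div_const q).congr_deriv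
      (mul_div_cancel_left₀ _ hq)

theorem measurable_boxCox (q : ℝ) : Measurable (boxCox q) := by
  unfold boxCox
  split_ifs
  · exact Real.measurable_log
  · fun_prop

theorem strictMonoOn_boxCox (q : ℝ) : StrictMonoOn (boxCox q) (Ioi 0) := by
  refine strictMonoOn_of_deriv_pos (convex_Ioi 0)
    (fun x hx => (hasDerivAt_boxCox q hx).continuousAt.continuousWithinAt) fun x hx => ?_
  rw [interior_Ioi] at hx
  rw [(hasDerivAt_boxCox q hx).deriv]
  exact Real.rpow_pos_of_pos hx _

theorem boxCox_pos {q x : ℝ} (hq : 0 < q) (hx : 0 < x) : 0 < boxCox q x := by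
  simp only [boxCox, hq.ne', if_false]
  positivity

/-- A probability density on the half-line whose power `lam - 1` is an affine function of
`boxCox q`. -/
structure IsProfile (q lam κ A : ℝ) (G : ℝ → ℝ) : Prop where
  q_nonneg : 0 ≤ q
  lam_pos : 0 < lam
  kappa_pos : 0 < κ
  q_pos : lam ≤ 1 → 0 < q
  A_pos : 0 < q → lam ≠ 1 → 0 < A
  A_zero : q = 0 → A = 0
  measurable : Measurable G
  eq_zero : ∀ x ≤ 0, G x = 0
  eq : ∀ x, 0 < x → G x = if lam = 1 then Real.exp (A - κ * boxCox q x)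
    else (max (A - (lam - 1) * κ * boxCox q x) 0) ^ (1 / (lam - 1))
  integrable : Integrable G
  integral : ∫ x, G x = 1
  integrable_boxCox : Integrable fun x => boxCox q x * G x

namespace IsProfile

variable {q lam κ A : ℝ} {G : ℝ → ℝ}

theorem base_pos (h : IsProfile q lam κ A G) (hl : lam < 1) {x : ℝ} (hx : 0 < x) :
    0 < A - (lam - 1) * κ * boxCox q x := by
  have hq := h.q_pos hl.le
  have h1 := h.A_pos hq hl.ne
  have h2 := boxCox_pos hq hx
  have h3 := h.kappa_pos
  have : 0 < (1 - lam) * κ * boxCox q x := by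
    have : 0 < 1 - lam := by linarith
    positivity
  nlinarith

theorem mem_support (h : IsProfile q lam κ A G) {x : ℝ} :
    x ∈ Function.support G ↔ 0 < x ∧ (1 < lam → 0 < A - (lam - 1) * κ * boxCox q x) := by
  rw [Function.mem_support]
  rcases le_or_gt x 0 with hx | hx
  · simp [h.eq_zero x hx, hx]
  rw [h.eq x hx]
  rcases lt_trichotomy lam 1 with hl | hl | hl
  · have := h.base_pos hl hx
    simp only [hl.ne, if_false, hx, true_and, not_lt.2 hl.le, false_imp_iff, iff_true]
    rw [max_eq_left this.le]
    exact (Real.rpow_pos_of_pos this _).ne'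
  · simp [hl, hx, Real.exp_ne_zero]
  · simp only [hl.ne', if_false, hx, true_and, hl, forall_const]
    constructor
    · intro h0
      by_contra! hc
      rw [max_eq_right hc, Real.zero_rpow] at h0
      · exact h0 rfl
      · simp; linarith
    · intro h0
      rw [max_eq_left h0.le]
      exact (Real.rpow_pos_of_pos h0 _).ne'

theorem pos_of_mem (h : IsProfile q lam κ A G) {x : ℝ} (hx : x ∈ Function.support G) : 0 < x :=
  (h.mem_support.1 hx).1

theorem nonneg (h : IsProfile q lam κ A G) (x : ℝ) : 0 ≤ G x := by
  rcases le_or_gt x 0 with hx | hx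
  · simp [h.eq_zero x hx]
  rw [h.eq x hx]
  split_ifs
  · exact (Real.exp_pos _).le
  · exact Real.rpow_nonneg (le_max_right _ _) _

theorem pos (h : IsProfile q lam κ A G) {x : ℝ} (hx : x ∈ Function.support G) : 0 < G x :=
  lt_of_le_of_ne (h.nonneg x) (Ne.symm hx)

theorem base_pos_of_mem (h : IsProfile q lam κ A G) (hl : lam ≠ 1) {x : ℝ}
    (hx : x ∈ Function.support G) : 0 < A - (lam - 1) * κ * boxCox q x := by
  rcases lt_or_gt_of_ne hl with hl | hl
  · exact h.base_pos hl (h.pos_of_mem hx)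
  · exact (h.mem_support.1 hx).2 hl

theorem eq_of_mem (h : IsProfile q lam κ A G) (hl : lam ≠ 1) {x : ℝ}
    (hx : x ∈ Function.support G) :
    G x = (A - (lam - 1) * κ * boxCox q x) ^ (1 / (lam - 1)) := by
  rw [h.eq x (h.pos_of_mem hx), if_neg hl, max_eq_left (h.base_pos_of_mem hl hx).le]

theorem rpow_eq (h : IsProfile q lam κ A G) (hl : lam ≠ 1) {x : ℝ}
    (hx : x ∈ Function.support G) :
    G x ^ (lam - 1) = A - (lam - 1) * κ * boxCox q x := by
  rw [h.eq_of_mem hl hx, ← Real.rpow_mul (h.base_pos_of_mem hl hx).le,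
    one_div_mul_cancel (sub_ne_zero.2 hl), Real.rpow_one]

theorem log_eq (h : IsProfile q 1 κ A G) {x : ℝ} (hx : 0 < x) :
    Real.log (G x) = A - κ * boxCox q x := by
  rw [h.eq x hx, if_pos rfl, Real.log_exp]

theorem support_eq_Ioi (h : IsProfile q lam κ A G) (hl : lam ≤ 1) :
    Function.support G = Ioi 0 := by
  ext x
  simp [h.mem_support, not_lt.2 hl]

theorem isOpen_support (h : IsProfile q lam κ A G) : IsOpen (Function.support G) := by
  rcases le_or_gt lam 1 with hl | hl
  · rw [h.support_eq_Ioi hl]; exact isOpen_Ioi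
  · have : Function.support G
        = Ioi 0 ∩ (fun x => A - (lam - 1) * κ * boxCox q x) ⁻¹' Ioi 0 := by
      ext x; simp [h.mem_support, hl]
    rw [this]
    refine ContinuousOn.isOpen_inter_preimage (fun x hx => ?_) isOpen_Ioi isOpen_Ioi
    exact (continuousAt_const.sub (continuousAt_const.mul
      (hasDerivAt_boxCox q hx).continuousAt)).continuousWithinAt

theorem mem_of_le (h : IsProfile q lam κ A G) {x y : ℝ} (hx : x ∈ Function.support G)
    (hy : 0 < y) (hyx : y ≤ x) : y ∈ Function.support G := by
  rw [h.mem_support] at hx ⊢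
  refine ⟨hy, fun hl => (hx.2 hl).trans_le ?_⟩
  have h1 := (strictMonoOn_boxCox q).monotoneOn hy hx.1 hyx
  have h2 : 0 < (lam - 1) * κ := mul_pos (by linarith) h.kappa_pos
  have := mul_le_mul_of_nonneg_left h1 h2.le
  linarith

theorem ordConnected_support (h : IsProfile q lam κ A G) :
    (Function.support G).OrdConnected :=
  ⟨fun _ hx _ hy _ hz => h.mem_of_le hy ((h.pos_of_mem hx).trans_le hz.1) hz.2⟩

theorem hasDerivAt (h : IsProfile q lam κ A G) {x : ℝ} (hx : x ∈ Function.support G) :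
    HasDerivAt G (-(κ * x ^ (q - 1) * G x ^ (2 - lam))) x := by
  have hev : ∀ᶠ y in 𝓝 x, y ∈ Function.support G := h.isOpen_support.mem_nhds hx
  have hB := hasDerivAt_boxCox q (h.pos_of_mem hx)
  by_cases hl : lam = 1
  · subst hl
    have h1 : HasDerivAt (fun y => Real.exp (A - κ * boxCox q y))
        (Real.exp (A - κ * boxCox q x) * (-(κ * x ^ (q - 1)))) x :=
      ((hB.const_mul κ).const_sub A).exp
    refine (h1.congr_of_eventuallyEq ?_).congr_deriv ?_
    · filter_upwards [hev] with y hy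
      simpa using h.eq y (h.pos_of_mem hy)
    · have := h.eq x (h.pos_of_mem hx)
      rw [if_pos rfl] at this
      rw [← this]
      norm_num
      ring
  · have hb := h.base_pos_of_mem hl hx
    have h1 := ((hB.const_mul ((lam - 1) * κ)).const_sub A).rpow_const (p := 1 / (lam - 1))
      (Or.inl hb.ne')
    refine (h1.congr_of_eventuallyEq ?_).congr_deriv ?_
    · filter_upwards [hev] with y hy
      exact h.eq_of_mem hl hy
    · rw [h.eq_of_mem hl hx, ← Real.rpow_mul hb.le]
      have hl' := sub_ne_zero.2 hl
      have : 1 / (lam - 1) * (2 - lam) = 1 / (lam - 1) - 1 := by field_simp; ring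
      rw [this]
      field_simp

theorem nonempty_support (h : IsProfile q lam κ A G) : (Function.support G).Nonempty := by
  by_contra hc
  rw [not_nonempty_iff_eq_empty, Function.support_eq_empty_iff] at hc
  have := h.integral
  simp [hc] at this

theorem antitoneOn (h : IsProfile q lam κ A G) : AntitoneOn G (Ioi 0) := by
  intro x hx y hy hxy
  by_cases hyG : y ∈ Function.support G
  · have hxG := h.mem_of_le hyG hx hxy
    have hB := (strictMonoOn_boxCox q).monotoneOn hx hy hxy
    have hκ := h.kappa_pos
    rw [h.eq x hx, h.eq y hy]
    split_ifs with hl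
    · have := mul_le_mul_of_nonneg_left hB hκ.le
      exact Real.exp_le_exp.2 (by linarith)
    · have b1 := h.base_pos_of_mem hl hxG
      have b2 := h.base_pos_of_mem hl hyG
      rw [max_eq_left b1.le, max_eq_left b2.le]
      have hk := mul_le_mul_of_nonneg_left hB hκ.le
      rcases lt_or_gt_of_ne hl with hl | hl
      · refine Real.rpow_le_rpow_of_nonpos b1 (by nlinarith) ?_
        rw [one_div]; exact inv_nonpos.2 (by linarith)
      · refine Real.rpow_le_rpow b2.le (by nlinarith) ?_
        rw [one_div]; exact inv_nonneg.2 (by linarith)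
  · rw [Function.notMem_support.1 hyG]
    exact h.nonneg x

theorem deriv_neg (h : IsProfile q lam κ A G) {x : ℝ} (hx : x ∈ Function.support G) :
    deriv G x < 0 := by
  rw [(h.hasDerivAt hx).deriv]
  have h1 := Real.rpow_pos_of_pos (h.pos_of_mem hx) (q - 1)
  have h2 := Real.rpow_pos_of_pos (h.pos hx) (2 - lam)
  have h3 := h.kappa_pos
  have : 0 < κ * x ^ (q - 1) * G x ^ (2 - lam) := by positivity
  linarith

theorem base_nonpos (h : IsProfile q lam κ A G) {x : ℝ} (hx : 0 < x)
    (hxG : x ∉ Function.support G) : 1 < lam ∧ A - (lam - 1) * κ * boxCox q x ≤ 0 := by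
  rw [h.mem_support] at hxG
  push Not at hxG
  exact hxG hx

theorem continuousOn (h : IsProfile q lam κ A G) : ContinuousOn G (Ioi 0) := by
  intro x hx
  by_cases hxG : x ∈ Function.support G
  · exact (h.hasDerivAt hxG).continuousAt.continuousWithinAt
  · have hl := (h.base_nonpos hx hxG).1
    have hc : ContinuousAt (fun y => (max (A - (lam - 1) * κ * boxCox q y) 0) ^ (1 / (lam - 1)))
        x := by
      refine ContinuousAt.rpow_const ?_ (Or.inr (by rw [one_div]; exact inv_nonneg.2 (by linarith)))
      exact (continuousAt_const.sub (continuousAt_const.mul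
        (hasDerivAt_boxCox q hx).continuousAt)).max continuousAt_const
    refine (hc.congr_of_eventuallyEq ?_).continuousWithinAt
    filter_upwards [isOpen_Ioi.mem_nhds hx] with y hy
    rw [h.eq y hy, if_neg hl.ne']

theorem support_eq_Ioo (h : IsProfile q lam κ A G) (hl : 1 < lam) :
    ∃ L, 0 < L ∧ Function.support G = Ioo 0 L := by
  have hk : 0 < (lam - 1) * κ := mul_pos (by linarith) h.kappa_pos
  rcases h.q_nonneg.eq_or_lt with hq | hq
  · refine ⟨1, one_pos, ?_⟩
    ext x
    rw [h.mem_support, h.A_zero hq.symm, mem_Ioo]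
    refine and_congr_right fun hx => ?_
    simp only [hl, forall_const, boxCox, ← hq, if_true, zero_sub]
    rw [← Real.log_neg_iff hx, neg_pos]
    constructor
    · intro h1; by_contra! h2; exact absurd h1 (not_lt.2 (by positivity))
    · intro h1; exact mul_neg_of_pos_of_neg hk h1
  · have hA := h.A_pos hq hl.ne'
    refine ⟨(q * A / ((lam - 1) * κ)) ^ q⁻¹, by positivity, ?_⟩
    ext x
    rw [h.mem_support, mem_Ioo]
    refine and_congr_right fun hx => ?_
    simp only [hl, forall_const, boxCox, hq.ne', if_false, sub_pos]
    rw [Real.lt_rpow_inv_iff_of_pos hx.le (by positivity) hq, lt_div_iff₀ hk]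
    rw [← mul_div_assoc, div_lt_iff₀ hq]
    constructor <;> intro h1 <;> linarith

theorem apply_right_end {L : ℝ}
    (hG : Function.support G = Ioo 0 L) {x : ℝ} (hx : L ≤ x) : G x = 0 := by
  rw [← Function.notMem_support, hG]
  exact fun hc => absurd hc.2 (not_lt.2 hx)

theorem integrable_rpow (h : IsProfile q lam κ A G) (hl : lam ≠ 1) :
    Integrable (fun x => G x ^ lam) ∧
      ∫ x, G x ^ lam = A - (lam - 1) * κ * ∫ x, boxCox q x * G x := by
  have he : (fun x => G x ^ lam) = fun x => A * G x - (lam - 1) * κ * (boxCox q x * G x) := by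
    ext x
    by_cases hx : x ∈ Function.support G
    · have : G x ^ lam = G x ^ (lam - 1) * G x := by
        rw [← Real.rpow_add_one (h.pos hx).ne']; ring_nf
      rw [this, h.rpow_eq hl hx]; ring
    · rw [Function.notMem_support.1 hx, Real.zero_rpow h.lam_pos.ne']; ring
  rw [he]
  have i1 := h.integrable.const_mul A
  have i2 := h.integrable_boxCox.const_mul ((lam - 1) * κ)
  refine ⟨i1.sub i2, ?_⟩
  rw [integral_sub i1 i2, integral_const_mul, integral_const_mul, h.integral, mul_one]

theorem integrable_log (h : IsProfile q 1 κ A G) :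
    Integrable (fun x => G x * Real.log (G x)) ∧
      ∫ x, G x * Real.log (G x) = A - κ * ∫ x, boxCox q x * G x := by
  have he : (fun x => G x * Real.log (G x)) = fun x => A * G x - κ * (boxCox q x * G x) := by
    ext x
    rcases le_or_gt x 0 with hx | hx
    · simp [h.eq_zero x hx]
    · rw [h.log_eq hx]; ring
  rw [he]
  have i1 := h.integrable.const_mul A
  have i2 := h.integrable_boxCox.const_mul κ
  refine ⟨i1.sub i2, ?_⟩
  rw [integral_sub i1 i2, integral_const_mul, integral_const_mul, h.integral, mul_one]

theorem setIntegral_support_rpow (h : IsProfile q lam κ A G) :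
    ∫ x in Function.support G, G x ^ lam = ∫ x, G x ^ lam := by
  refine setIntegral_eq_integral_of_forall_compl_eq_zero fun x hx => ?_
  rw [Function.notMem_support.1 hx, Real.zero_rpow h.lam_pos.ne']

theorem integral_rpow_pos (h : IsProfile q lam κ A G) (hl : lam ≠ 1) :
    0 < ∫ x, G x ^ lam := by
  refine (integral_pos_iff_support_of_nonneg (fun x => Real.rpow_nonneg (h.nonneg x) _)
    (h.integrable_rpow hl).1).2 ?_
  have : Function.support (fun x => G x ^ lam) = Function.support G := by
    ext x
    simp [Function.mem_support, Real.rpow_eq_zero (h.nonneg x) h.lam_pos.ne']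
  rw [this]
  exact h.isOpen_support.measure_pos _ h.nonempty_support

end IsProfile

/-! The generalized Gaussians are profiles. -/

theorem gaussShape_of_pos {p lam x : ℝ} (hp : p ≠ 0) (hx : 0 < x) :
    gaussShape p lam x = if lam = 1 then Real.exp (-(x ^ conjExp p))
      else (max (1 - (lam - 1) * x ^ conjExp p) 0) ^ (1 / (lam - 1)) := by
  have h1 : (2 - lam = 1) = (lam = 1) := propext ⟨fun h => by linarith, fun h => by linarith⟩
  simp only [gaussShape, not_le.2 hx, hp, if_false, tsallisExp, h1]
  split_ifs
  · rfl
  · ring_nf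

theorem gaussShape_zero_of_pos {lam x : ℝ} (hx : 0 < x) :
    gaussShape 0 lam x = (max (-Real.log x) 0) ^ (1 / (lam - 1)) := by
  simp [gaussShape, not_le.2 hx]

theorem gaussShape_of_nonpos {p lam x : ℝ} (hx : x ≤ 0) : gaussShape p lam x = 0 := by
  simp [gaussShape, hx]

theorem measurable_gaussShape (p lam : ℝ) : Measurable (gaussShape p lam) := by
  unfold gaussShape
  refine Measurable.ite measurableSet_Iic measurable_const ?_
  by_cases hp : p = 0
  · simp only [hp, if_true]
    fun_prop
  · simp only [hp, if_false, tsallisExp]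
    by_cases hl : 2 - lam = 1
    · simp only [hl, if_true]; fun_prop
    · simp only [hl, if_false]; fun_prop

theorem gaussShape_nonneg (p lam x : ℝ) : 0 ≤ gaussShape p lam x := by
  unfold gaussShape tsallisExp
  split_ifs
  · exact le_rfl
  · exact Real.rpow_nonneg (le_max_right _ _) _
  · exact (Real.exp_pos _).le
  · exact Real.rpow_nonneg (le_max_right _ _) _

theorem integrable_of_dominated {q : ℝ} {S D : ℝ → ℝ} (hS : Measurable S) (hS0 : ∀ x, 0 ≤ S x)
    (hD : Integrable D) (hSD : ∀ x, (1 + |boxCox q x|) * S x ≤ D x) :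
    Integrable S ∧ Integrable fun x => boxCox q x * S x := by
  constructor
  · refine hD.mono' hS.aestronglyMeasurable (ae_of_all _ fun x => ?_)
    rw [Real.norm_of_nonneg (hS0 x)]
    refine le_trans ?_ (hSD x)
    have := mul_nonneg (abs_nonneg (boxCox q x)) (hS0 x)
    linarith
  · refine hD.mono' ((measurable_boxCox q).mul hS).aestronglyMeasurable
      (ae_of_all _ fun x => ?_)
    rw [norm_mul, Real.norm_eq_abs, Real.norm_of_nonneg (hS0 x)]
    refine le_trans ?_ (hSD x)
    have := hS0 x
    linarith

theorem integrable_gaussShape_one {p : ℝ} (hp : p ≠ 0) (hq : 0 < conjExp p) :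
    Integrable (gaussShape p 1) ∧ Integrable fun x => boxCox (conjExp p) x * gaussShape p 1 x := by
  set q := conjExp p
  have key : ∀ r : ℝ, -1 < r → IntegrableOn (fun x => x ^ r * Real.exp (-x ^ q)) (Ioi 0) := by
    intro r hr
    by_contra hc
    have h1 := integral_rpow_mul_exp_neg_rpow hq hr
    rw [integral_undef hc] at h1
    have : 0 < 1 / q * Real.Gamma ((r + 1) / q) :=
      mul_pos (by positivity) (Real.Gamma_pos_of_pos (div_pos (by linarith) hq))
    linarith
  have h0 := key 0 (by norm_num)
  have h1 := (key q (by linarith)).div_const q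
  refine integrable_of_dominated (D := (Ioi (0 : ℝ)).indicator
    fun x => x ^ (0 : ℝ) * Real.exp (-x ^ q) + x ^ q * Real.exp (-x ^ q) / q)
    (measurable_gaussShape _ _) (gaussShape_nonneg _ _)
    ((h0.add h1).integrable_indicator measurableSet_Ioi) fun x => ?_
  rcases le_or_gt x 0 with hx | hx
  · simp [gaussShape_of_nonpos hx, hx]
  · rw [indicator_of_mem (by exact hx), gaussShape_of_pos hp hx, if_pos rfl,
      abs_of_pos (boxCox_pos hq hx)]
    simp only [boxCox, hq.ne', if_false, Real.rpow_zero]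
    apply le_of_eq
    ring

theorem integrable_gaussShape_of_lt_one {p lam : ℝ} (hp : p ≠ 0) (hq : 0 < conjExp p)
    (hl : lam < 1) (hlam : 1 / (1 + conjExp p) < lam) :
    Integrable (gaussShape p lam) ∧
      Integrable fun x => boxCox (conjExp p) x * gaussShape p lam x := by
  set q := conjExp p
  have hl' : 0 < 1 - lam := by linarith
  have hlq : 1 < lam * (1 + q) := by rwa [div_lt_iff₀ (by linarith)] at hlam
  set e := 1 / (lam - 1) with he
  have he0 : e < 0 := one_div_neg.2 (by linarith)
  have heq : q * e + q < -1 := by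
    have h2 : e * (1 - lam) = -1 := by
      rw [he]; field_simp [(by linarith : lam - 1 ≠ 0)]; ring
    nlinarith
  set D2 : ℝ → ℝ := (Ioi (1 : ℝ)).indicator fun x => (1 + 1 / q) * (1 - lam) ^ e * x ^ (q * e + q)
  set D1 : ℝ → ℝ := (Ioc (0 : ℝ) 1).indicator fun _ => 1 + 1 / q
  have i1 : Integrable D1 :=
    (integrableOn_const (by simp) (by simp)).integrable_indicator measurableSet_Ioc
  have i2 : Integrable D2 :=
    IntegrableOn.integrable_indicator
      (Integrable.const_mul (integrableOn_Ioi_rpow_of_lt heq one_pos) _) measurableSet_Ioi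
  refine integrable_of_dominated (D := fun x => D1 x + D2 x)
    (measurable_gaussShape _ _) (gaussShape_nonneg _ _) (i1.add i2) fun x => ?_
  rcases le_or_gt x 0 with hx | hx
  · simp [gaussShape_of_nonpos hx, D1, D2, not_lt.2 hx, not_lt.2 (hx.trans zero_le_one)]
  have hxq : 0 < x ^ q := Real.rpow_pos_of_pos hx q
  have hb : 0 < (1 - lam) * x ^ q := by positivity
  have hbase : 0 < 1 - (lam - 1) * x ^ q := by linarith
  rw [gaussShape_of_pos hp hx, if_neg hl.ne, abs_of_pos (boxCox_pos hq hx), max_eq_left hbase.le]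
  simp only [boxCox, hq.ne', if_false]
  change (1 + x ^ q / q) * (1 - (lam - 1) * x ^ q) ^ e ≤ _
  rcases le_or_gt x 1 with hx1 | hx1
  · have hs : (1 - (lam - 1) * x ^ q) ^ e ≤ 1 :=
      Real.rpow_le_one_of_one_le_of_nonpos (by linarith) he0.le
    have hxq1 : x ^ q ≤ 1 := Real.rpow_le_one hx.le hx1 hq.le
    simp only [D1, D2, mem_Ioc, hx, hx1, and_self, indicator_of_mem, mem_Ioi, not_lt.2 hx1,
      not_false_eq_true, indicator_of_notMem, add_zero]
    calc (1 + x ^ q / q) * (1 - (lam - 1) * x ^ q) ^ e ≤ (1 + 1 / q) * 1 := by gcongr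
      _ = _ := mul_one _
  · have hs : (1 - (lam - 1) * x ^ q) ^ e ≤ ((1 - lam) * x ^ q) ^ e :=
      Real.rpow_le_rpow_of_nonpos hb (by linarith) he0.le
    have hxq1 : 1 ≤ x ^ q := Real.one_le_rpow hx1.le hq.le
    simp only [D1, D2, mem_Ioc, hx, not_le.2 hx1, and_false, not_false_eq_true,
      indicator_of_notMem, mem_Ioi, hx1, indicator_of_mem, zero_add]
    calc (1 + x ^ q / q) * (1 - (lam - 1) * x ^ q) ^ e
        ≤ (x ^ q + x ^ q / q) * ((1 - lam) * x ^ q) ^ e := by gcongr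
      _ = _ := by
        rw [Real.mul_rpow hl'.le hxq.le, ← Real.rpow_mul hx.le, Real.rpow_add hx]
        ring

theorem integrable_gaussShape_of_one_lt {p lam : ℝ} (hp : p ≠ 0) (hq : 0 < conjExp p)
    (hl : 1 < lam) :
    Integrable (gaussShape p lam) ∧
      Integrable fun x => boxCox (conjExp p) x * gaussShape p lam x := by
  set q := conjExp p
  have hl' : 0 < lam - 1 := by linarith
  have he0 : 0 < 1 / (lam - 1) := one_div_pos.2 hl'
  set L := (1 / (lam - 1)) ^ q⁻¹ with hL
  set D : ℝ → ℝ := (Ioc (0 : ℝ) L).indicator fun _ => 1 + 1 / (lam - 1) / q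
  have i1 : Integrable D :=
    (integrableOn_const (by simp) (by simp)).integrable_indicator measurableSet_Ioc
  refine integrable_of_dominated (D := D)
    (measurable_gaussShape _ _) (gaussShape_nonneg _ _) i1 fun x => ?_
  rcases le_or_gt x 0 with hx | hx
  · simp [gaussShape_of_nonpos hx, D, not_lt.2 hx]
  have hxq : 0 < x ^ q := Real.rpow_pos_of_pos hx q
  rw [gaussShape_of_pos hp hx, if_neg hl.ne', abs_of_pos (boxCox_pos hq hx)]
  simp only [boxCox, hq.ne', if_false]
  change (1 + x ^ q / q) * (max (1 - (lam - 1) * x ^ q) 0) ^ (1 / (lam - 1)) ≤ _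
  rcases le_or_gt x L with hxL | hxL
  · have hs : (max (1 - (lam - 1) * x ^ q) 0) ^ (1 / (lam - 1)) ≤ 1 :=
      Real.rpow_le_one (le_max_right _ _) (max_le (by nlinarith) zero_le_one) he0.le
    have hxq1 : x ^ q ≤ 1 / (lam - 1) := (Real.le_rpow_inv_iff_of_pos hx.le he0.le hq).1 hxL
    simp only [D, mem_Ioc, hx, hxL, and_self, indicator_of_mem]
    calc _ ≤ (1 + 1 / (lam - 1) / q) * 1 := by gcongr
      _ = _ := mul_one _
  · have hxq1 : 1 / (lam - 1) < x ^ q := (Real.rpow_inv_lt_iff_of_pos he0.le hx.le hq).1 hxL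
    rw [div_lt_iff₀ hl'] at hxq1
    rw [max_eq_right (by linarith), Real.zero_rpow he0.ne', mul_zero]
    simp [D, not_le.2 hxL]

theorem integrable_gaussShape_zero {lam : ℝ} (hl : 1 < lam) :
    Integrable (gaussShape 0 lam) ∧ Integrable fun x => boxCox 0 x * gaussShape 0 lam x := by
  have he0 : 0 < 1 / (lam - 1) := one_div_pos.2 (by linarith)
  set e := 1 / (lam - 1)
  set η := 1 / (2 * (e + 1)) with hη
  have hη0 : 0 < η := by positivity
  have hη1 : η ≤ 1 := by rw [hη, div_le_one (by positivity)]; linarith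
  set D : ℝ → ℝ := (Ioc (0 : ℝ) 1).indicator fun x => (1 / η) ^ (e + 1) * x ^ (-(1 / 2) : ℝ)
  have i1 : Integrable D := by
    refine IntegrableOn.integrable_indicator (Integrable.const_mul ?_ _) measurableSet_Ioc
    have := intervalIntegral.intervalIntegrable_rpow' (a := 0) (b := 1) (r := -(1 / 2))
      (by norm_num)
    rwa [intervalIntegrable_iff_integrableOn_Ioc_of_le zero_le_one] at this
  refine integrable_of_dominated (D := D)
    (measurable_gaussShape _ _) (gaussShape_nonneg _ _) i1 fun x => ?_
  rcases le_or_gt x 0 with hx | hx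
  · simp [gaussShape_of_nonpos hx, D, not_lt.2 hx]
  rw [gaussShape_zero_of_pos hx]
  rcases le_or_gt x 1 with hx1 | hx1
  · have ht : 0 ≤ -Real.log x := neg_nonneg.2 (Real.log_nonpos hx.le hx1)
    rw [max_eq_left ht]
    simp only [D, mem_Ioc, hx, hx1, and_self, indicator_of_mem, boxCox, if_true]
    rw [← abs_neg, abs_of_nonneg ht]
    have hxt : x ^ (-(1 / 2) : ℝ) = Real.exp (-Real.log x / 2) := by
      rw [Real.rpow_def_of_pos hx]; ring_nf
    rw [hxt]
    set t := -Real.log x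
    have h1 : 1 + t ≤ 1 / η * Real.exp (η * t) := by
      rw [one_div, inv_mul_eq_div, le_div_iff₀ hη0]
      have := Real.add_one_le_exp (η * t)
      nlinarith
    calc (1 + t) * t ^ e ≤ (1 + t) * (1 + t) ^ e := by gcongr; linarith
      _ = (1 + t) ^ (e + 1) := by rw [Real.rpow_add_one (by linarith), mul_comm]
      _ ≤ (1 / η * Real.exp (η * t)) ^ (e + 1) := by gcongr
      _ = _ := by
        rw [Real.mul_rpow (by positivity) (Real.exp_pos _).le, ← Real.exp_mul]
        congr 2
        rw [hη]; field_simp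
  · have : 0 ≤ Real.log x := Real.log_nonneg hx1.le
    rw [max_eq_right (by linarith), Real.zero_rpow he0.ne', mul_zero]
    simp [D, not_le.2 hx1]

theorem conjExp_eq_zero {p : ℝ} (hp : p ≠ 1) : conjExp p = 0 ↔ p = 0 := by
  rw [conjExp, div_eq_zero_iff]
  exact or_iff_left (sub_ne_zero.2 hp)

theorem ClassicalDomain.one_lt {p lam : ℝ} (h : ClassicalDomain p lam) (hp : p = 0) :
    1 < lam := by
  have := h.2.2
  simpa [(conjExp_eq_zero h.1).2 hp] using this

theorem ClassicalDomain.conjExp_pos {p lam : ℝ} (h : ClassicalDomain p lam) (hp : p ≠ 0) :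
    0 < conjExp p :=
  lt_of_le_of_ne h.2.1 (Ne.symm (mt (conjExp_eq_zero h.1).1 hp))

theorem integrable_gaussShape {p lam : ℝ} (h : ClassicalDomain p lam) :
    Integrable (gaussShape p lam) ∧
      Integrable fun x => boxCox (conjExp p) x * gaussShape p lam x := by
  by_cases hp : p = 0
  · subst hp
    have : conjExp 0 = 0 := by simp [conjExp]
    rw [this]
    exact integrable_gaussShape_zero (h.one_lt rfl)
  · have hq := h.conjExp_pos hp
    rcases lt_trichotomy lam 1 with hl | rfl | hl
    · exact integrable_gaussShape_of_lt_one hp hq hl h.2.2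
    · exact integrable_gaussShape_one hp hq
    · exact integrable_gaussShape_of_one_lt hp hq hl

theorem gaussShape_pos_near_zero {p lam : ℝ} (h : ClassicalDomain p lam) :
    ∃ ε > 0, ∀ x ∈ Ioo 0 ε, 0 < gaussShape p lam x := by
  by_cases hp : p = 0
  · subst hp
    refine ⟨1, one_pos, fun x hx => ?_⟩
    rw [gaussShape_zero_of_pos hx.1]
    exact Real.rpow_pos_of_pos (lt_max_of_lt_left (neg_pos.2 (Real.log_neg hx.1 hx.2))) _
  · have hq := h.conjExp_pos hp
    rcases le_or_gt lam 1 with hl | hl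
    · refine ⟨1, one_pos, fun x hx => ?_⟩
      rw [gaussShape_of_pos hp hx.1]
      split_ifs
      · exact Real.exp_pos _
      · refine Real.rpow_pos_of_pos (lt_max_of_lt_left ?_) _
        have := Real.rpow_pos_of_pos hx.1 (conjExp p)
        nlinarith
    · have hl' : 0 < lam - 1 := by linarith
      refine ⟨(1 / (lam - 1)) ^ (conjExp p)⁻¹, by positivity, fun x hx => ?_⟩
      rw [gaussShape_of_pos hp hx.1, if_neg hl.ne']
      refine Real.rpow_pos_of_pos (lt_max_of_lt_left ?_) _
      have := (Real.lt_rpow_inv_iff_of_pos hx.1.le (by positivity) hq).1 hx.2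
      rw [lt_div_iff₀ hl'] at this
      linarith

theorem gaussNorm_pos {p lam : ℝ} (h : ClassicalDomain p lam) : 0 < gaussNorm p lam := by
  rw [gaussNorm, inv_pos, integral_pos_iff_support_of_nonneg (gaussShape_nonneg p lam)
    (integrable_gaussShape h).1]
  obtain ⟨ε, hε, h1⟩ := gaussShape_pos_near_zero h
  refine lt_of_lt_of_le ?_ (measure_mono (s := Ioo 0 ε) fun x hx => (h1 x hx).ne')
  simpa using hε

theorem isProfile_genGauss {p lam : ℝ} (h : ClassicalDomain p lam) :
    ∃ κ A, IsProfile (conjExp p) lam κ A (genGauss p lam) ∧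
      (p ≠ 0 → lam ≠ 1 → A = gaussNorm p lam ^ (lam - 1) ∧
        κ = conjExp p * gaussNorm p lam ^ (lam - 1)) := by
  have ha := gaussNorm_pos h
  obtain ⟨hS, hBS⟩ := integrable_gaussShape h
  set a := gaussNorm p lam with ha'
  have hlam : 0 < lam := lt_trans (one_div_pos.2 (by linarith [h.2.1])) h.2.2
  have hint : ∫ x, genGauss p lam x = 1 := by
    simp only [genGauss]
    rw [integral_const_mul, ← ha', ha', gaussNorm, inv_mul_cancel₀]
    intro h0
    rw [ha', gaussNorm, h0, inv_zero] at ha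
    exact lt_irrefl _ ha
  have hBG : Integrable fun x => boxCox (conjExp p) x * genGauss p lam x := by
    refine (hBS.const_mul a).congr (ae_of_all _ fun x => ?_)
    simp only [genGauss]; ring
  have hz : ∀ x ≤ 0, genGauss p lam x = 0 := fun x hx => by
    simp [genGauss, gaussShape_of_nonpos hx]
  have mk : ∀ κ A, 0 < κ → (0 < conjExp p → lam ≠ 1 → 0 < A) → (conjExp p = 0 → A = 0) →
      (∀ x, 0 < x → genGauss p lam x = if lam = 1 then Real.exp (A - κ * boxCox (conjExp p) x)
        else (max (A - (lam - 1) * κ * boxCox (conjExp p) x) 0) ^ (1 / (lam - 1))) →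
      IsProfile (conjExp p) lam κ A (genGauss p lam) := fun κ A h1 h2 h3 h4 =>
    { q_nonneg := h.2.1
      lam_pos := hlam
      kappa_pos := h1
      q_pos := fun hl => h.conjExp_pos fun hp => absurd (h.one_lt hp) (not_lt.2 hl)
      A_pos := h2
      A_zero := h3
      measurable := (measurable_gaussShape p lam).const_mul _
      eq_zero := hz
      eq := h4
      integrable := hS.const_mul a
      integral := hint
      integrable_boxCox := hBG }
  have hpow : lam ≠ 1 → ∀ y, a * (max y 0) ^ (1 / (lam - 1))
      = (max (a ^ (lam - 1) * y) 0) ^ (1 / (lam - 1)) := by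
    intro hl y
    have hp := Real.rpow_pos_of_pos ha (lam - 1)
    have : max (a ^ (lam - 1) * y) 0 = a ^ (lam - 1) * max y 0 := by
      rw [mul_max_of_nonneg _ _ hp.le, mul_zero]
    rw [this, Real.mul_rpow hp.le (le_max_right _ _), ← Real.rpow_mul ha.le,
      mul_one_div_cancel (sub_ne_zero.2 hl), Real.rpow_one]
  by_cases hp : p = 0
  · subst hp
    have hc : conjExp 0 = 0 := by simp [conjExp]
    have hl := h.one_lt rfl
    refine ⟨a ^ (lam - 1) / (lam - 1), 0, mk _ _ ?_ ?_ ?_ ?_, fun h0 => absurd rfl h0⟩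
    · exact div_pos (Real.rpow_pos_of_pos ha _) (by linarith)
    · simp [hc]
    · simp
    · intro x hx
      rw [if_neg hl.ne', genGauss, gaussShape_zero_of_pos hx, hpow hl.ne', hc]
      simp only [boxCox, if_true]
      congr 2
      field_simp [sub_ne_zero.2 hl.ne']
      ring
  · have hq := h.conjExp_pos hp
    by_cases hl : lam = 1
    · subst hl
      refine ⟨conjExp p, Real.log a, mk _ _ hq ?_ ?_ ?_, fun _ h0 => absurd rfl h0⟩
      · simp
      · intro h0; exact absurd h0 hq.ne'
      · intro x hx
        rw [if_pos rfl, genGauss, gaussShape_of_pos hp hx, if_pos rfl, Real.exp_sub,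
          Real.exp_log ha, Real.exp_neg]
        simp only [boxCox, hq.ne', if_false]
        rw [mul_div_cancel₀ _ hq.ne', div_eq_mul_inv]
    · refine ⟨conjExp p * a ^ (lam - 1), a ^ (lam - 1), mk _ _ ?_ ?_ ?_ ?_,
        fun _ _ => ⟨rfl, rfl⟩⟩
      · positivity
      · intros; positivity
      · intro h0; exact absurd h0 hq.ne'
      · intro x hx
        rw [if_neg hl, genGauss, gaussShape_of_pos hp hx, if_neg hl, hpow hl]
        simp only [boxCox, hq.ne', if_false]
        congr 2
        field_simp

/-! The moment-entropy inequality, for a random variable `U` given as the upper tail of a weight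
`v` under a probability measure; the density of `U` is then `1 / v`. -/

/-- The upper tail of the measure with density `v` with respect to `μ`. -/
def weightedTail (μ : Measure ℝ) (v : ℝ → ℝ) (x : ℝ) : ℝ≥0∞ :=
  ∫⁻ r in Ioi x, ENNReal.ofReal (v r) ∂μ

theorem withDensity_Ioi (μ : Measure ℝ) (v : ℝ → ℝ) (x : ℝ) :
    (μ.withDensity fun r => ENNReal.ofReal (v r)) (Ioi x) = weightedTail μ v x :=
  withDensity_apply _ measurableSet_Ioi

theorem measurable_weightedTail (μ : Measure ℝ) (v : ℝ → ℝ) : Measurable (weightedTail μ v) := by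
  have := measurable_tail (μ.withDensity fun r => ENNReal.ofReal (v r))
  simpa only [withDensity_Ioi] using this

theorem nullSingletonClass_of_ac {μ ν : Measure ℝ} [NullSingletonClass μ] (h : ν ≪ μ) :
    NullSingletonClass ν :=
  ⟨fun x => h (measure_singleton x)⟩

theorem weightedTail_ne_zero {μ : Measure ℝ} [NullSingletonClass μ] {v : ℝ → ℝ}
    (hv : AEMeasurable v μ) (hv0 : ∀ᵐ x ∂μ, 0 < v x) :
    ∀ᵐ x ∂μ, weightedTail μ v x ≠ 0 := by
  have hac := withDensity_absolutelyContinuous μ fun r => ENNReal.ofReal (v r)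
  have := nullSingletonClass_of_ac hac
  have hac' : μ ≪ μ.withDensity fun r => ENNReal.ofReal (v r) :=
    withDensity_absolutelyContinuous' hv.ennreal_ofReal
      (hv0.mono fun x hx => (ENNReal.ofReal_pos.2 hx).ne')
  have key : ∀ᵐ x ∂(μ.withDensity fun r => ENNReal.ofReal (v r)), weightedTail μ v x ≠ 0 := by
    rw [ae_iff]
    have := measure_tail_le (μ.withDensity fun r => ENNReal.ofReal (v r)) 0
    simpa only [withDensity_Ioi, nonpos_iff_eq_zero, ne_eq, not_not] using this
  exact hac'.ae_le key

theorem ofReal_integral_le_lintegral {α : Type*} [MeasurableSpace α] {μ : Measure α} {f : α → ℝ}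
    (hf : Integrable f μ) : ENNReal.ofReal (∫ x, f x ∂μ) ≤ ∫⁻ x, ENNReal.ofReal (f x) ∂μ := by
  rw [integral_eq_lintegral_pos_part_sub_lintegral_neg_part hf]
  refine (ENNReal.ofReal_le_ofReal (sub_le_self _ ENNReal.toReal_nonneg)).trans ?_
  exact ENNReal.ofReal_toReal_le

theorem young_of_lt_one {lam b w : ℝ} (h0 : 0 < lam) (h1 : lam < 1) (hb : 0 < b) (hw : 0 < w) :
    w ^ (1 - lam) ≤ lam * b ^ (lam - 1) + (1 - lam) * (b ^ lam * w) := by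
  have h := Real.geom_mean_le_arith_mean2_weighted (w₁ := lam) (w₂ := 1 - lam)
    (p₁ := b ^ (lam - 1)) (p₂ := b ^ lam * w) h0.le (by linarith) (by positivity) (by positivity)
    (by ring)
  refine le_trans (le_of_eq ?_) h
  rw [Real.mul_rpow (by positivity) hw.le, ← Real.rpow_mul hb.le, ← Real.rpow_mul hb.le,
    ← mul_assoc, ← Real.rpow_add hb]
  ring_nf
  simp

theorem young_of_one_lt {lam b w : ℝ} (h1 : 1 < lam) (hb : 0 ≤ b) (hw : 0 < w) :
    lam * b ^ (lam - 1) ≤ w ^ (1 - lam) + (lam - 1) * (b ^ lam * w) := by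
  have h0 : 0 < lam := by linarith
  have h := Real.geom_mean_le_arith_mean2_weighted (w₁ := 1 / lam) (w₂ := (lam - 1) / lam)
    (p₁ := w ^ (1 - lam)) (p₂ := b ^ lam * w) (by positivity)
    (div_nonneg (by linarith) h0.le) (by positivity) (by positivity)
    (by field_simp; ring)
  have he : (w ^ (1 - lam)) ^ (1 / lam) * (b ^ lam * w) ^ ((lam - 1) / lam) = b ^ (lam - 1) := by
    rw [Real.mul_rpow (by positivity) hw.le, ← Real.rpow_mul hw.le, ← Real.rpow_mul hb,
      mul_left_comm, ← Real.rpow_add hw]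
    have e1 : (1 - lam) * (1 / lam) + (lam - 1) / lam = 0 := by field_simp; ring
    have e2 : lam * ((lam - 1) / lam) = lam - 1 := by field_simp
    rw [e1, e2, Real.rpow_zero, mul_one]
  rw [he] at h
  calc lam * b ^ (lam - 1)
      ≤ lam * (1 / lam * w ^ (1 - lam) + (lam - 1) / lam * (b ^ lam * w)) := by gcongr
    _ = _ := by field_simp

theorem integral_base_eq {q lam κ A : ℝ} {G : ℝ → ℝ} {μ : Measure ℝ}
    [IsProbabilityMeasure μ] {v : ℝ → ℝ} (h : IsProfile q lam κ A G) (hl : lam ≠ 1)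
    (hLi : Integrable (fun x => boxCox q (weightedTail μ v x).toReal) μ)
    (hL : ∫ x, boxCox q (weightedTail μ v x).toReal ∂μ = ∫ x, boxCox q x * G x) :
    ∫ x, (A - (lam - 1) * κ * boxCox q (weightedTail μ v x).toReal) ∂μ = ∫ x, G x ^ lam := by
  rw [(h.integrable_rpow hl).2, integral_sub (integrable_const _) (hLi.const_mul _),
    integral_const_mul, hL]
  simp

theorem lintegral_profile_tail_le {q lam κ A : ℝ} {G : ℝ → ℝ} {μ : Measure ℝ}
    [NullSingletonClass μ] {v : ℝ → ℝ} (h : IsProfile q lam κ A G)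
    (hv : AEMeasurable v μ) (hfin : ∀ᵐ x ∂μ, weightedTail μ v x ≠ ⊤) :
    ∫⁻ x, ENNReal.ofReal (v x) * ENNReal.ofReal (G (weightedTail μ v x).toReal ^ lam) ∂μ
      ≤ ∫⁻ x, ENNReal.ofReal (G x ^ lam) := by
  set ν := μ.withDensity fun r => ENNReal.ofReal (v r) with hν
  have hac : ν ≪ μ := withDensity_absolutelyContinuous μ fun r => ENNReal.ofReal (v r)
  have := nullSingletonClass_of_ac hac
  have hm : Measurable fun x => G x ^ lam := h.measurable.pow_const lam
  have h1 := lintegral_antitone_tail_le ν (F := fun x => G x ^ lam) hm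
    (fun x => Real.rpow_nonneg (h.nonneg x) _)
    (fun x hx y hy hxy => Real.rpow_le_rpow (h.nonneg y) (h.antitoneOn hx hy hxy) h.lam_pos.le)
    (by
      have h2 : ∀ᵐ x ∂ν, weightedTail μ v x ≠ ⊤ := hac.ae_le hfin
      simpa only [hν, withDensity_Ioi] using h2)
  refine le_trans (le_of_eq ?_) (h1.trans (setLIntegral_le_lintegral _ _))
  simp only [hν, withDensity_Ioi]
  rw [lintegral_withDensity_eq_lintegral_mul₀ hv.ennreal_ofReal
    (g := fun x => ENNReal.ofReal (G (weightedTail μ v x).toReal ^ lam))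
    (hm.comp (measurable_weightedTail μ v).ennreal_toReal).ennreal_ofReal.aemeasurable]
  rfl

theorem ofReal_integral_rpow {q lam κ A : ℝ} {G : ℝ → ℝ} (h : IsProfile q lam κ A G)
    (hl : lam ≠ 1) :
    ∫⁻ x, ENNReal.ofReal (G x ^ lam) = ENNReal.ofReal (∫ x, G x ^ lam) :=
  (ofReal_integral_eq_lintegral_ofReal (h.integrable_rpow hl).1
    (ae_of_all _ fun x => Real.rpow_nonneg (h.nonneg x) _)).symm

section Core

variable {q lam κ A : ℝ} {G : ℝ → ℝ} {μ : Measure ℝ} [IsProbabilityMeasure μ]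
  [NullSingletonClass μ] {v : ℝ → ℝ}

theorem lintegral_rpow_le_of_lt_one (h : IsProfile q lam κ A G) (hl : lam < 1)
    (hv : AEMeasurable v μ) (hv0 : ∀ᵐ x ∂μ, 0 < v x)
    (hfin : ∀ᵐ x ∂μ, weightedTail μ v x ≠ ⊤)
    (hLi : Integrable (fun x => boxCox q (weightedTail μ v x).toReal) μ)
    (hL : ∫ x, boxCox q (weightedTail μ v x).toReal ∂μ = ∫ x, boxCox q x * G x) :
    ∫⁻ x, ENNReal.ofReal (v x ^ (1 - lam)) ∂μ ≤ ENNReal.ofReal (∫ x, G x ^ lam) := by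
  have hl1 : 0 < 1 - lam := by linarith
  set N := ∫ x, G x ^ lam with hN
  have hN0 : 0 ≤ N := integral_nonneg fun x => Real.rpow_nonneg (h.nonneg x) _
  have hne := weightedTail_ne_zero hv hv0
  set W : ℝ → ℝ := fun x => (weightedTail μ v x).toReal
  have hWm : Measurable W := (measurable_weightedTail μ v).ennreal_toReal
  have hW : ∀ᵐ x ∂μ, 0 < W x := by
    filter_upwards [hne, hfin] with x h1 h2 using ENNReal.toReal_pos h1 h2
  have hGW : ∀ᵐ x ∂μ, G (W x) ^ (lam - 1) = A - (lam - 1) * κ * boxCox q (W x) := by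
    filter_upwards [hW] with x hx
    exact h.rpow_eq hl.ne (by rw [h.support_eq_Ioi hl.le]; exact hx)
  have hbI : Integrable (fun x => A - (lam - 1) * κ * boxCox q (W x)) μ :=
    (integrable_const _).sub (hLi.const_mul _)
  calc ∫⁻ x, ENNReal.ofReal (v x ^ (1 - lam)) ∂μ
      ≤ ∫⁻ x, (ENNReal.ofReal lam * ENNReal.ofReal (G (W x) ^ (lam - 1))
        + ENNReal.ofReal (1 - lam)
          * (ENNReal.ofReal (v x) * ENNReal.ofReal (G (W x) ^ lam))) ∂μ := by
        refine lintegral_mono_ae ?_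
        filter_upwards [hv0, hW] with x hx hwx
        have hG : 0 < G (W x) := h.pos (by rw [h.support_eq_Ioi hl.le]; exact hwx)
        rw [← ENNReal.ofReal_mul h.lam_pos.le, ← ENNReal.ofReal_mul hx.le,
          ← ENNReal.ofReal_mul hl1.le, ← ENNReal.ofReal_add
            (mul_nonneg h.lam_pos.le (by positivity)) (mul_nonneg hl1.le (by positivity))]
        refine ENNReal.ofReal_le_ofReal ?_
        rw [mul_comm (v x)]
        exact young_of_lt_one h.lam_pos hl hG hx
    _ = ENNReal.ofReal lam * ∫⁻ x, ENNReal.ofReal (G (W x) ^ (lam - 1)) ∂μ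
        + ENNReal.ofReal (1 - lam)
          * ∫⁻ x, (ENNReal.ofReal (v x) * ENNReal.ofReal (G (W x) ^ lam)) ∂μ := by
        have hm : Measurable fun x => ENNReal.ofReal (G (W x) ^ (lam - 1)) :=
          ((h.measurable.comp hWm).pow_const _).ennreal_ofReal
        rw [lintegral_add_left (hm.const_mul _), lintegral_const_mul _ hm,
          lintegral_const_mul' _ _ ENNReal.ofReal_ne_top]
    _ ≤ ENNReal.ofReal lam * ENNReal.ofReal N + ENNReal.ofReal (1 - lam) * ENNReal.ofReal N := by
        refine add_le_add (mul_le_mul_right ?_ _) (mul_le_mul_right ?_ _)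
        · rw [lintegral_congr_ae (hGW.mono fun x hx => by rw [hx]),
            ← ofReal_integral_eq_lintegral_ofReal hbI]
          · rw [hN, ← integral_base_eq h hl.ne hLi hL]
          · filter_upwards [hW] with x hx
            exact (h.base_pos hl hx).le
        · rw [hN, ← ofReal_integral_rpow h hl.ne]
          exact lintegral_profile_tail_le h hv hfin
    _ = ENNReal.ofReal N := by
        rw [← add_mul, ← ENNReal.ofReal_add h.lam_pos.le hl1.le]
        simp

theorem le_lintegral_rpow_of_one_lt (h : IsProfile q lam κ A G) (hl : 1 < lam)
    (hv : AEMeasurable v μ) (hv0 : ∀ᵐ x ∂μ, 0 < v x)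
    (hfin : ∀ᵐ x ∂μ, weightedTail μ v x ≠ ⊤)
    (hLi : Integrable (fun x => boxCox q (weightedTail μ v x).toReal) μ)
    (hL : ∫ x, boxCox q (weightedTail μ v x).toReal ∂μ = ∫ x, boxCox q x * G x) :
    ENNReal.ofReal (∫ x, G x ^ lam) ≤ ∫⁻ x, ENNReal.ofReal (v x ^ (1 - lam)) ∂μ := by
  have hl1 : 0 < lam - 1 := by linarith
  set N := ∫ x, G x ^ lam with hN
  have hN0 : 0 ≤ N := integral_nonneg fun x => Real.rpow_nonneg (h.nonneg x) _
  have hne := weightedTail_ne_zero hv hv0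
  set W : ℝ → ℝ := fun x => (weightedTail μ v x).toReal
  have hW : ∀ᵐ x ∂μ, 0 < W x := by
    filter_upwards [hne, hfin] with x h1 h2 using ENNReal.toReal_pos h1 h2
  have hlow : ENNReal.ofReal N ≤ ∫⁻ x, ENNReal.ofReal (G (W x) ^ (lam - 1)) ∂μ := by
    rw [hN, ← integral_base_eq h hl.ne' hLi hL]
    refine (ofReal_integral_le_lintegral ((integrable_const _).sub (hLi.const_mul _))).trans ?_
    refine lintegral_mono_ae ?_
    filter_upwards [hW] with x hx
    refine ENNReal.ofReal_le_ofReal ?_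
    by_cases hs : W x ∈ Function.support G
    · exact (h.rpow_eq hl.ne' hs).ge
    · exact (h.base_nonpos hx hs).2.trans (Real.rpow_nonneg (h.nonneg _) _)
  have hup : ∫⁻ x, (ENNReal.ofReal (v x) * ENNReal.ofReal (G (W x) ^ lam)) ∂μ
      ≤ ENNReal.ofReal N := by
    rw [hN, ← ofReal_integral_rpow h hl.ne']
    exact lintegral_profile_tail_le h hv hfin
  have key : ENNReal.ofReal lam * ENNReal.ofReal N
      ≤ ∫⁻ x, ENNReal.ofReal (v x ^ (1 - lam)) ∂μ
        + ENNReal.ofReal (lam - 1) * ENNReal.ofReal N := by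
    calc ENNReal.ofReal lam * ENNReal.ofReal N
        ≤ ENNReal.ofReal lam * ∫⁻ x, ENNReal.ofReal (G (W x) ^ (lam - 1)) ∂μ :=
          mul_le_mul_right hlow _
      _ = ∫⁻ x, ENNReal.ofReal lam * ENNReal.ofReal (G (W x) ^ (lam - 1)) ∂μ :=
          (lintegral_const_mul' _ _ ENNReal.ofReal_ne_top).symm
      _ ≤ ∫⁻ x, (ENNReal.ofReal (v x ^ (1 - lam)) + ENNReal.ofReal (lam - 1)
          * (ENNReal.ofReal (v x) * ENNReal.ofReal (G (W x) ^ lam))) ∂μ := by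
          refine lintegral_mono_ae ?_
          filter_upwards [hv0] with x hx
          have hG := h.nonneg (W x)
          rw [← ENNReal.ofReal_mul h.lam_pos.le, ← ENNReal.ofReal_mul hx.le,
            ← ENNReal.ofReal_mul hl1.le, ← ENNReal.ofReal_add (by positivity)
              (mul_nonneg hl1.le (by positivity))]
          refine ENNReal.ofReal_le_ofReal ?_
          rw [mul_comm (v x)]
          exact young_of_one_lt hl hG hx
      _ = ∫⁻ x, ENNReal.ofReal (v x ^ (1 - lam)) ∂μ + ENNReal.ofReal (lam - 1)
          * ∫⁻ x, (ENNReal.ofReal (v x) * ENNReal.ofReal (G (W x) ^ lam)) ∂μ := by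
          rw [lintegral_add_left' (hv.pow_const _).ennreal_ofReal,
            lintegral_const_mul' _ _ ENNReal.ofReal_ne_top]
      _ ≤ _ := by gcongr
  have hsplit : ENNReal.ofReal lam * ENNReal.ofReal N
      = ENNReal.ofReal N + ENNReal.ofReal (lam - 1) * ENNReal.ofReal N := by
    rw [← one_add_mul, ← ENNReal.ofReal_one, ← ENNReal.ofReal_add zero_le_one hl1.le]
    ring_nf
  rw [hsplit] at key
  exact (ENNReal.add_le_add_iff_right
    (ENNReal.mul_ne_top ENNReal.ofReal_ne_top ENNReal.ofReal_ne_top)).1 key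

theorem integral_log_le (h : IsProfile q 1 κ A G)
    (hv : AEMeasurable v μ) (hv0 : ∀ᵐ x ∂μ, 0 < v x)
    (hfin : ∀ᵐ x ∂μ, weightedTail μ v x ≠ ⊤)
    (hLi : Integrable (fun x => boxCox q (weightedTail μ v x).toReal) μ)
    (hL : ∫ x, boxCox q (weightedTail μ v x).toReal ∂μ = ∫ x, boxCox q x * G x)
    (hlog : Integrable (fun x => Real.log (v x)) μ) :
    ∫ x, Real.log (v x) ∂μ ≤ -∫ x, G x * Real.log (G x) := by
  have hne := weightedTail_ne_zero hv hv0
  set W : ℝ → ℝ := fun x => (weightedTail μ v x).toReal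
  have hWm : Measurable W := (measurable_weightedTail μ v).ennreal_toReal
  have hW : ∀ᵐ x ∂μ, 0 < W x := by
    filter_upwards [hne, hfin] with x h1 h2 using ENNReal.toReal_pos h1 h2
  have hGv0 : 0 ≤ᵐ[μ] fun x => v x * G (W x) := by
    filter_upwards [hv0] with x hx
    exact mul_nonneg hx.le (h.nonneg _)
  have hm : AEStronglyMeasurable (fun x => v x * G (W x)) μ :=
    (hv.mul (h.measurable.comp hWm).aemeasurable).aestronglyMeasurable
  have hup : ∫⁻ x, ENNReal.ofReal (v x * G (W x)) ∂μ ≤ 1 := by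
    have h1 := lintegral_profile_tail_le h hv hfin
    simp only [Real.rpow_one] at h1
    rw [← ofReal_integral_eq_lintegral_ofReal h.integrable (ae_of_all _ h.nonneg), h.integral,
      ENNReal.ofReal_one] at h1
    refine le_trans (le_of_eq (lintegral_congr_ae ?_)) h1
    filter_upwards [hv0] with x hx
    rw [ENNReal.ofReal_mul hx.le]
  have hint : Integrable (fun x => v x * G (W x)) μ := by
    refine ⟨hm, ?_⟩
    rw [hasFiniteIntegral_iff_ofReal hGv0]
    exact hup.trans_lt ENNReal.one_lt_top
  have hle1 : ∫ x, v x * G (W x) ∂μ ≤ 1 := by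
    rw [integral_eq_lintegral_of_nonneg_ae hGv0 hm]
    exact ENNReal.toReal_le_of_le_ofReal zero_le_one (by simpa using hup)
  have hlogG : Integrable (fun x => A - κ * boxCox q (W x)) μ :=
    (integrable_const _).sub (hLi.const_mul _)
  have hI : ∫ x, (A - κ * boxCox q (W x)) ∂μ = ∫ x, G x * Real.log (G x) := by
    rw [h.integrable_log.2, integral_sub (integrable_const _) (hLi.const_mul _),
      integral_const_mul, hL]
    simp
  have hmono : ∫ x, (Real.log (v x) + (A - κ * boxCox q (W x))) ∂μ
      ≤ ∫ x, (v x * G (W x) - 1) ∂μ := by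
    refine integral_mono_ae (hlog.add hlogG) (hint.sub (integrable_const _)) ?_
    filter_upwards [hv0, hW] with x hx hwx
    have hG : 0 < G (W x) := h.pos (by rw [h.support_eq_Ioi le_rfl]; exact hwx)
    change Real.log (v x) + (A - κ * boxCox q (W x)) ≤ v x * G (W x) - 1
    rw [← h.log_eq hwx, ← Real.log_mul hx.ne' hG.ne']
    exact Real.log_le_sub_one_of_pos (mul_pos hx hG)
  rw [integral_add hlog hlogG, hI, integral_sub hint (integrable_const _)] at hmono
  simp only [integral_const, probReal_univ, smul_eq_mul, mul_one] at hmono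
  linarith

end Core

/-- The deviation of order `q` of a nonnegative random variable. -/
def momentDev (q : ℝ) (μ : Measure ℝ) (U : ℝ → ℝ≥0∞) : ℝ≥0∞ :=
  if q = 0 then ENNReal.ofReal (Real.exp (∫ x, Real.log (U x).toReal ∂μ))
  else (∫⁻ x, U x ^ q ∂μ) ^ (1 / q)

/-- The inverse of the Rényi entropy power of a random variable whose density, in terms of the
underlying parameter, is `1 / v`. -/
def invEntropy (lam : ℝ) (μ : Measure ℝ) (v : ℝ → ℝ) : ℝ≥0∞ :=
  if lam = 1 then ENNReal.ofReal (Real.exp (-∫ x, Real.log (v x) ∂μ))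
  else (∫⁻ x, ENNReal.ofReal (v x ^ (1 - lam)) ∂μ) ^ (1 / (lam - 1))

theorem ofReal_mul_rpow {c : ℝ} (hc : 0 < c) (u : ℝ≥0∞) (q : ℝ) :
    (ENNReal.ofReal c * u) ^ q = ENNReal.ofReal c ^ q * u ^ q := by
  rw [ENNReal.mul_rpow_eq_ite]
  simp [hc.not_ge]

theorem ofReal_rpow_ne_zero {c : ℝ} (hc : 0 < c) (q : ℝ) : ENNReal.ofReal c ^ q ≠ 0 := by
  rw [ENNReal.ofReal_rpow_of_pos hc]
  exact (ENNReal.ofReal_pos.2 (Real.rpow_pos_of_pos hc q)).ne'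

theorem ofReal_rpow_ne_top {c : ℝ} (hc : 0 < c) (q : ℝ) : ENNReal.ofReal c ^ q ≠ ⊤ := by
  rw [ENNReal.ofReal_rpow_of_pos hc]
  exact ENNReal.ofReal_ne_top

section

variable {μ : Measure ℝ} [IsProbabilityMeasure μ] {v : ℝ → ℝ} {U : ℝ → ℝ≥0∞} {c q lam : ℝ}

theorem weightedTail_smul (μ : Measure ℝ) (v : ℝ → ℝ) {c : ℝ} (hc : 0 < c) (x : ℝ) :
    weightedTail μ (fun r => c * v r) x = ENNReal.ofReal c * weightedTail μ v x := by
  rw [weightedTail, weightedTail, ← lintegral_const_mul' _ _ ENNReal.ofReal_ne_top]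
  simp_rw [ENNReal.ofReal_mul hc.le]

theorem integrable_log_smul (hc : 0 < c) (h0 : ∀ᵐ x ∂μ, U x ≠ 0) (h1 : ∀ᵐ x ∂μ, U x ≠ ⊤)
    (hi : Integrable (fun x => Real.log (U x).toReal) μ) :
    Integrable (fun x => Real.log (ENNReal.ofReal c * U x).toReal) μ ∧
      ∫ x, Real.log (ENNReal.ofReal c * U x).toReal ∂μ
        = Real.log c + ∫ x, Real.log (U x).toReal ∂μ := by
  have he : (fun x => Real.log (ENNReal.ofReal c * U x).toReal)
      =ᵐ[μ] fun x => Real.log c + Real.log (U x).toReal := by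
    filter_upwards [h0, h1] with x a b
    rw [ENNReal.toReal_mul, ENNReal.toReal_ofReal hc.le,
      Real.log_mul hc.ne' (ENNReal.toReal_pos a b).ne']
  constructor
  · exact ((integrable_const _).add hi).congr he.symm
  · rw [integral_congr_ae he, integral_add (integrable_const _) hi]
    simp

theorem momentDev_smul (hc : 0 < c) (h0 : ∀ᵐ x ∂μ, U x ≠ 0)
    (h1 : q = 0 → (∀ᵐ x ∂μ, U x ≠ ⊤) ∧ Integrable (fun x => Real.log (U x).toReal) μ) :
    momentDev q μ (fun x => ENNReal.ofReal c * U x) = ENNReal.ofReal c * momentDev q μ U := by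
  unfold momentDev
  split_ifs with hq
  · rw [(integrable_log_smul hc h0 (h1 hq).1 (h1 hq).2).2, Real.exp_add, Real.exp_log hc,
      ENNReal.ofReal_mul hc.le]
  · simp_rw [ofReal_mul_rpow hc]
    rw [lintegral_const_mul' _ _ (ofReal_rpow_ne_top hc q), ENNReal.ofReal_rpow_of_pos hc,
      ofReal_mul_rpow (Real.rpow_pos_of_pos hc _),
      ENNReal.ofReal_rpow_of_pos (Real.rpow_pos_of_pos hc _), ← Real.rpow_mul hc.le,
      mul_one_div_cancel hq, Real.rpow_one]

theorem invEntropy_smul (hc : 0 < c) (hv0 : ∀ᵐ x ∂μ, 0 < v x)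
    (h1 : lam = 1 → Integrable (fun x => Real.log (v x)) μ) :
    invEntropy lam μ (fun x => c * v x) = ENNReal.ofReal c⁻¹ * invEntropy lam μ v := by
  unfold invEntropy
  split_ifs with hl
  · have he : ∫ x, Real.log (c * v x) ∂μ = Real.log c + ∫ x, Real.log (v x) ∂μ := by
      rw [integral_congr_ae (g := fun x => Real.log c + Real.log (v x)),
        integral_add (integrable_const _) (h1 hl)]
      · simp
      · filter_upwards [hv0] with x hx
        rw [Real.log_mul hc.ne' hx.ne']
    rw [he, neg_add, Real.exp_add, Real.exp_neg, Real.exp_log hc,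
      ENNReal.ofReal_mul (inv_nonneg.2 hc.le)]
  · have he : ∫⁻ x, ENNReal.ofReal ((c * v x) ^ (1 - lam)) ∂μ
        = ENNReal.ofReal (c ^ (1 - lam)) * ∫⁻ x, ENNReal.ofReal (v x ^ (1 - lam)) ∂μ := by
      rw [← lintegral_const_mul' _ _ ENNReal.ofReal_ne_top]
      refine lintegral_congr_ae ?_
      filter_upwards [hv0] with x hx
      rw [Real.mul_rpow hc.le hx.le, ENNReal.ofReal_mul (by positivity)]
    rw [he, ofReal_mul_rpow (Real.rpow_pos_of_pos hc _),
      ENNReal.ofReal_rpow_of_pos (Real.rpow_pos_of_pos hc _), ← Real.rpow_mul hc.le]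
    congr 2
    rw [← Real.rpow_neg_one]
    congr 1
    have := sub_ne_zero.2 hl
    field_simp
    ring

theorem momentDev_ne_zero (hq0 : 0 ≤ q) (hU : Measurable U) (h0 : ∀ᵐ x ∂μ, U x ≠ 0) :
    momentDev q μ U ≠ 0 := by
  unfold momentDev
  split_ifs with hq
  · exact (ENNReal.ofReal_pos.2 (Real.exp_pos _)).ne'
  · have hq' : 0 < q := lt_of_le_of_ne hq0 (Ne.symm hq)
    rw [ne_eq, ENNReal.rpow_eq_zero_iff_of_pos (by positivity),
      lintegral_eq_zero_iff (hU.pow_const q)]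
    intro h
    have : ∀ᵐ x ∂μ, False := by
      filter_upwards [h, h0] with x h1 h2
      exact h2 ((ENNReal.rpow_eq_zero_iff_of_pos hq').1 h1)
    exact IsProbabilityMeasure.ne_zero μ (by simpa using this)

end

namespace IsProfile

variable {q lam κ A : ℝ} {G : ℝ → ℝ}

theorem rpow_mul_eq (h : IsProfile q lam κ A G) (hq : q ≠ 0) (x : ℝ) :
    |x| ^ q * G x = q * (boxCox q x * G x) := by
  rcases le_or_gt x 0 with hx | hx
  · simp [h.eq_zero x hx]
  · simp only [boxCox, hq, if_false, abs_of_pos hx]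
    field_simp

theorem log_mul_eq (x : ℝ) : Real.log |x| * G x = boxCox 0 x * G x := by
  simp [boxCox]

theorem integral_boxCox_pos (h : IsProfile q lam κ A G) (hq : 0 < q) :
    0 < ∫ x, boxCox q x * G x := by
  have h0 : ∀ x, 0 ≤ boxCox q x * G x := by
    intro x
    rcases le_or_gt x 0 with hx | hx
    · simp [h.eq_zero x hx]
    · exact mul_nonneg (boxCox_pos hq hx).le (h.nonneg x)
  rw [integral_pos_iff_support_of_nonneg h0 h.integrable_boxCox]
  refine lt_of_lt_of_le (h.isOpen_support.measure_pos volume h.nonempty_support)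
    (measure_mono fun x hx => ?_)
  exact mul_ne_zero (boxCox_pos hq (h.pos_of_mem hx)).ne' hx

theorem deviation_rpow (h : IsProfile q lam κ A G) (hq : q ≠ 0) :
    0 < q * ∫ x, boxCox q x * G x ∧ deviation q G = (q * ∫ x, boxCox q x * G x) ^ (1 / q) := by
  have hq' : 0 < q := lt_of_le_of_ne h.q_nonneg (Ne.symm hq)
  refine ⟨mul_pos hq' (h.integral_boxCox_pos hq'), ?_⟩
  simp only [deviation, hq, if_false, h.rpow_mul_eq hq, integral_const_mul]

theorem deviation_log :
    deviation 0 G = Real.exp (∫ x, boxCox 0 x * G x) := by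
  simp only [deviation, if_true, log_mul_eq]

theorem deviation_pos (h : IsProfile q lam κ A G) : 0 < deviation q G := by
  by_cases hq : q = 0
  · subst hq; rw [deviation_log]; exact Real.exp_pos _
  · rw [(h.deviation_rpow hq).2]
    exact Real.rpow_pos_of_pos (h.deviation_rpow hq).1 _

theorem renyiPower_one :
    renyiPower 1 G = Real.exp (-∫ x, G x * Real.log (G x)) := by
  simp only [renyiPower, if_true]
  congr 2
  refine setIntegral_eq_integral_of_forall_compl_eq_zero fun x hx => ?_
  rw [Function.notMem_support.1 hx, zero_mul]

theorem renyiPower_eq (h : IsProfile q lam κ A G) (hl : lam ≠ 1) :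
    renyiPower lam G = (∫ x, G x ^ lam) ^ (1 / (1 - lam)) := by
  simp only [renyiPower, hl, if_false, h.setIntegral_support_rpow]

theorem renyiPower_pos (h : IsProfile q lam κ A G) : 0 < renyiPower lam G := by
  by_cases hl : lam = 1
  · subst hl; rw [renyiPower_one]; exact Real.exp_pos _
  · rw [h.renyiPower_eq hl]; exact Real.rpow_pos_of_pos (h.integral_rpow_pos hl) _

theorem boxCox_of_momentDev {μ : Measure ℝ} [IsProbabilityMeasure μ] {U : ℝ → ℝ≥0∞}
    (h : IsProfile q lam κ A G) (hU : Measurable U)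
    (hi : q = 0 → Integrable (fun x => Real.log (U x).toReal) μ)
    (hD : momentDev q μ U = ENNReal.ofReal (deviation q G)) :
    Integrable (fun x => boxCox q (U x).toReal) μ ∧
      ∫ x, boxCox q (U x).toReal ∂μ = ∫ x, boxCox q x * G x := by
  by_cases hq : q = 0
  · subst hq
    rw [deviation_log] at hD
    simp only [momentDev, if_true] at hD
    rw [ENNReal.ofReal_eq_ofReal_iff (Real.exp_pos _).le (Real.exp_pos _).le,
      Real.exp_eq_exp] at hD
    simp only [boxCox, if_true] at hD ⊢
    exact ⟨hi rfl, hD⟩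
  · obtain ⟨hm, he⟩ := h.deviation_rpow hq
    set m := ∫ x, boxCox q x * G x
    rw [he] at hD
    simp only [momentDev, hq, if_false] at hD
    have hD' : ∫⁻ x, U x ^ q ∂μ = ENNReal.ofReal (q * m) := by
      have := congrArg (fun z => z ^ q) hD
      beta_reduce at this
      rw [← ENNReal.rpow_mul, one_div_mul_cancel hq, ENNReal.rpow_one,
        ENNReal.ofReal_rpow_of_pos (Real.rpow_pos_of_pos hm _), ← Real.rpow_mul hm.le,
        one_div_mul_cancel hq, Real.rpow_one] at this
      exact this
    have hfin : ∫⁻ x, U x ^ q ∂μ ≠ ⊤ := by rw [hD']; exact ENNReal.ofReal_ne_top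
    have hmeas : AEMeasurable (fun x => U x ^ q) μ := (hU.pow_const q).aemeasurable
    have i1 := integrable_toReal_of_lintegral_ne_top hmeas hfin
    have i2 := integral_toReal hmeas (ae_lt_top' hmeas hfin)
    rw [hD', ENNReal.toReal_ofReal hm.le] at i2
    have e : (fun x => boxCox q (U x).toReal) = fun x => (U x ^ q).toReal / q := by
      ext x; simp [boxCox, hq, ENNReal.toReal_rpow]
    rw [e]
    refine ⟨i1.div_const q, ?_⟩
    rw [integral_div, i2]
    field_simp

theorem inv_renyiPower_le {μ : Measure ℝ} [IsProbabilityMeasure μ] [NullSingletonClass μ]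
    {v : ℝ → ℝ} (h : IsProfile q lam κ A G)
    (hv : AEMeasurable v μ) (hv0 : ∀ᵐ x ∂μ, 0 < v x)
    (hfin : ∀ᵐ x ∂μ, weightedTail μ v x ≠ ⊤)
    (hlog : lam = 1 → Integrable (fun x => Real.log (v x)) μ)
    (hLi : Integrable (fun x => boxCox q (weightedTail μ v x).toReal) μ)
    (hL : ∫ x, boxCox q (weightedTail μ v x).toReal ∂μ = ∫ x, boxCox q x * G x) :
    ENNReal.ofReal (renyiPower lam G)⁻¹ ≤ invEntropy lam μ v := by
  unfold invEntropy
  split_ifs with hl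
  · subst hl
    rw [renyiPower_one, ← Real.exp_neg]
    refine ENNReal.ofReal_le_ofReal (Real.exp_le_exp.2 ?_)
    have := integral_log_le h hv hv0 hfin hLi hL (hlog rfl)
    linarith
  · have hN := h.integral_rpow_pos hl
    have he : ENNReal.ofReal (renyiPower lam G)⁻¹
        = ENNReal.ofReal (∫ x, G x ^ lam) ^ (1 / (lam - 1)) := by
      rw [h.renyiPower_eq hl, ENNReal.ofReal_rpow_of_pos hN, ← Real.rpow_neg hN.le]
      congr 2
      rw [← neg_sub lam 1, one_div, one_div, inv_neg, neg_neg]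
    rw [he]
    rcases lt_or_gt_of_ne hl with hl | hl
    · rw [← neg_neg (1 / (lam - 1)), ENNReal.rpow_neg, ENNReal.rpow_neg _ (-(1 / (lam - 1))),
        ENNReal.inv_le_inv]
      refine ENNReal.rpow_le_rpow (lintegral_rpow_le_of_lt_one h hl hv hv0 hfin hLi hL) ?_
      have := one_div_neg.2 (sub_neg.2 hl)
      linarith
    · refine ENNReal.rpow_le_rpow (le_lintegral_rpow_of_one_lt h hl hv hv0 hfin hLi hL) ?_
      exact (one_div_pos.2 (sub_pos.2 hl)).le

end IsProfile

/-- The moment-entropy inequality for the upper tail of a weight. -/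
theorem constK0_le {p lam : ℝ} (hdom : ClassicalDomain p lam) {μ : Measure ℝ}
    [IsProbabilityMeasure μ] [NullSingletonClass μ] {v : ℝ → ℝ}
    (hv : AEMeasurable v μ) (hv0 : ∀ᵐ x ∂μ, 0 < v x)
    (hlog : lam = 1 → Integrable (fun x => Real.log (v x)) μ)
    (hU : p = 0 → (∀ᵐ x ∂μ, weightedTail μ v x ≠ ⊤) ∧
      Integrable (fun x => Real.log (weightedTail μ v x).toReal) μ)
    (hdet : momentDev (conjExp p) μ (weightedTail μ v) = ⊤ → invEntropy lam μ v ≠ 0) :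
    ENNReal.ofReal (constK0 p lam)
      ≤ momentDev (conjExp p) μ (weightedTail μ v) * invEntropy lam μ v := by
  obtain ⟨κ, A, h, -⟩ := isProfile_genGauss hdom
  set q := conjExp p with hq
  set G := genGauss p lam
  have hq0 : q = 0 → p = 0 := (conjExp_eq_zero hdom.1).1
  have hne := weightedTail_ne_zero hv hv0
  have hUm := measurable_weightedTail μ v
  have hD0 := momentDev_ne_zero (q := q) h.q_nonneg hUm hne
  by_cases htop : momentDev q μ (weightedTail μ v) = ⊤
  · rw [htop, ENNReal.top_mul (hdet htop)]
    exact le_top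
  have hdev := h.deviation_pos
  have hDt : 0 < (momentDev q μ (weightedTail μ v)).toReal := ENNReal.toReal_pos hD0 htop
  set D := (momentDev q μ (weightedTail μ v)).toReal with hD
  set c := deviation q G / D with hc
  have hc0 : 0 < c := div_pos hdev hDt
  have hfin : ∀ᵐ x ∂μ, weightedTail μ v x ≠ ⊤ := by
    by_cases hq' : q = 0
    · exact (hU (hq0 hq')).1
    · have hqp : 0 < q := lt_of_le_of_ne h.q_nonneg (Ne.symm hq')
      simp only [momentDev, hq', if_false] at htop
      have h1 : ∫⁻ x, weightedTail μ v x ^ q ∂μ ≠ ⊤ := fun h2 => htop (by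
        rw [h2, ENNReal.top_rpow_of_pos (by positivity)])
      filter_upwards [ae_lt_top (hUm.pow_const q) h1] with x hx hx'
      rw [hx', ENNReal.top_rpow_of_pos hqp] at hx
      exact lt_irrefl _ hx
  have hU' : weightedTail μ (fun r => c * v r)
      = fun x => ENNReal.ofReal c * weightedTail μ v x := funext (weightedTail_smul μ v hc0)
  have hDc : momentDev q μ (weightedTail μ fun r => c * v r)
      = ENNReal.ofReal (deviation q G) := by
    rw [hU', momentDev_smul hc0 hne fun h0 => hU (hq0 h0), ← ENNReal.ofReal_toReal htop, ← hD,
      ← ENNReal.ofReal_mul hc0.le, hc, div_mul_cancel₀ _ hDt.ne']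
  obtain ⟨i1, i2⟩ := h.boxCox_of_momentDev (measurable_weightedTail μ fun r => c * v r)
    (fun h0 => by
      rw [hU']
      exact (integrable_log_smul hc0 hne hfin (hU (hq0 h0)).2).1) hDc
  have hvc0 : ∀ᵐ x ∂μ, 0 < c * v x := hv0.mono fun x hx => mul_pos hc0 hx
  have hlogc : lam = 1 → Integrable (fun x => Real.log (c * v x)) μ := fun hl => by
    refine ((integrable_const (Real.log c)).add (hlog hl)).congr ?_
    filter_upwards [hv0] with x hx
    rw [Real.log_mul hc0.ne' hx.ne']
    rfl
  have key := h.inv_renyiPower_le (hv.const_mul c) hvc0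
    (by
      rw [hU']
      filter_upwards [hfin] with x hx using ENNReal.mul_ne_top ENNReal.ofReal_ne_top hx)
    hlogc i1 i2
  rw [invEntropy_smul hc0 hv0 hlog] at key
  calc ENNReal.ofReal (constK0 p lam)
      = ENNReal.ofReal (deviation q G) * ENNReal.ofReal (renyiPower lam G)⁻¹ := by
        rw [← ENNReal.ofReal_mul hdev.le, constK0, div_eq_mul_inv]
    _ ≤ ENNReal.ofReal (deviation q G) * (ENNReal.ofReal c⁻¹ * invEntropy lam μ v) := by gcongr
    _ = _ := by
        rw [← mul_assoc, ← ENNReal.ofReal_mul hdev.le, hc, inv_div,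
          mul_div_cancel₀ _ hdev.ne', hD, ENNReal.ofReal_toReal htop]

/-! Monotone transport onto a profile. -/

/-- The measure with density `G`. -/
def densityMeasure (G : ℝ → ℝ) : Measure ℝ := volume.withDensity fun x => ENNReal.ofReal (G x)

theorem densityMeasure_ac (G : ℝ → ℝ) : densityMeasure G ≪ volume :=
  withDensity_absolutelyContinuous _ _

instance (G : ℝ → ℝ) : NullSingletonClass (densityMeasure G) :=
  nullSingletonClass_of_ac (densityMeasure_ac G)

theorem lintegral_densityMeasure {G : ℝ → ℝ} (hG : Measurable G) (Φ : ℝ → ℝ≥0∞) :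
    ∫⁻ x, Φ x ∂densityMeasure G = ∫⁻ x, ENNReal.ofReal (G x) * Φ x := by
  rw [densityMeasure, lintegral_withDensity_eq_lintegral_mul_non_measurable _ hG.ennreal_ofReal
    (ae_of_all _ fun x => ENNReal.ofReal_lt_top)]
  rfl

namespace IsProfile

variable {q lam κ A : ℝ} {G : ℝ → ℝ}

theorem isProbabilityMeasure (h : IsProfile q lam κ A G) :
    IsProbabilityMeasure (densityMeasure G) := by
  refine ⟨?_⟩
  rw [densityMeasure, withDensity_apply _ MeasurableSet.univ, Measure.restrict_univ,
    ← ofReal_integral_eq_lintegral_ofReal h.integrable (ae_of_all _ h.nonneg), h.integral,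
    ENNReal.ofReal_one]

theorem tail_lt_tail (h : IsProfile q lam κ A G) {x y : ℝ} (hx : x ∈ Function.support G)
    (hxy : x < y) : densityMeasure G (Ioi y) < densityMeasure G (Ioi x) := by
  have := h.isProbabilityMeasure
  have hpos : 0 < densityMeasure G (Ioc x y) := by
    rw [pos_iff_ne_zero, densityMeasure, ne_eq,
      withDensity_apply_eq_zero h.measurable.ennreal_ofReal]
    intro h0
    have hO : IsOpen (Function.support G ∩ Ioo x y) := h.isOpen_support.inter isOpen_Ioo
    have hne : (Function.support G ∩ Ioo x y).Nonempty := by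
      have h1 : ∀ᶠ z in 𝓝[>] x, z ∈ Function.support G ∩ Ioo x y :=
        inter_mem (mem_nhdsWithin_of_mem_nhds (h.isOpen_support.mem_nhds hx))
          (Ioo_mem_nhdsGT hxy)
      exact h1.exists
    refine (hO.measure_pos volume hne).ne' (measure_mono_null ?_ h0)
    rintro z ⟨hz1, hz2⟩
    exact ⟨(ENNReal.ofReal_pos.2 (h.pos hz1)).ne', hz2.1, hz2.2.le⟩
  rw [← Ioc_union_Ioi_eq_Ioi hxy.le, measure_union (by
    rw [Set.disjoint_left]; intro z hz hz'; exact absurd hz.2 (not_le.2 hz')) measurableSet_Ioi]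
  rw [add_comm]
  exact ENNReal.lt_add_right (measure_ne_top _ _) hpos.ne'

theorem exists_tail_eq (h : IsProfile q lam κ A G) {τ : ℝ≥0∞} (h0 : 0 < τ) (h1 : τ < 1) :
    ∃ z ∈ Function.support G, densityMeasure G (Ioi z) = τ := by
  have hτ : τ ≠ ⊤ := h1.ne_top
  have hτ1 : τ.toReal < 1 := by
    rw [← ENNReal.toReal_one]; exact (ENNReal.toReal_lt_toReal hτ ENNReal.one_ne_top).2 h1
  have hτ0 : 0 < τ.toReal := ENNReal.toReal_pos h0.ne' hτ
  have hI : ∫ x in Ioi 0, G x = 1 := by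
    rw [← h.integral]
    exact setIntegral_eq_integral_of_forall_compl_eq_zero fun x hx =>
      h.eq_zero x (not_lt.1 hx)
  have hcont : Continuous fun b => ∫ x in (0 : ℝ)..b, G x :=
    intervalIntegral.continuous_primitive (fun a b => h.integrable.intervalIntegrable) 0
  have hlim := intervalIntegral_tendsto_integral_Ioi 0 h.integrable.integrableOn tendsto_id
  rw [hI] at hlim
  obtain ⟨b, hb, hb0⟩ := ((hlim.eventually (lt_mem_nhds (by linarith : 1 - τ.toReal < 1))).and
    (eventually_ge_atTop 0)).exists
  have hmem : 1 - τ.toReal ∈ Icc (∫ x in (0 : ℝ)..0, G x) (∫ x in (0 : ℝ)..b, G x) :=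
    ⟨by simp; linarith, hb.le⟩
  obtain ⟨z, hz, hzv⟩ := intermediate_value_Icc hb0 hcont.continuousOn hmem
  simp only at hzv
  have htail : densityMeasure G (Ioi z) = τ := by
    have h2 := intervalIntegral.integral_interval_add_Ioi (a := 0) (b := z)
      h.integrable.integrableOn h.integrable.integrableOn
    rw [hI, hzv] at h2
    rw [densityMeasure, withDensity_apply _ measurableSet_Ioi,
      ← ofReal_integral_eq_lintegral_ofReal h.integrable.integrableOn (ae_of_all _ h.nonneg),
      show ∫ x in Ioi z, G x = τ.toReal by linarith, ENNReal.ofReal_toReal hτ]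
  refine ⟨z, ?_, htail⟩
  by_contra hc
  have hz0 : 0 < z := by
    rcases hz.1.eq_or_lt with he | he
    · rw [← he] at hzv
      simp at hzv
      linarith
    · exact he
  have : densityMeasure G (Ioi z) = 0 := by
    rw [densityMeasure, withDensity_apply_eq_zero h.measurable.ennreal_ofReal]
    convert measure_empty (μ := (volume : Measure ℝ))
    ext x
    simp only [mem_inter_iff, mem_Ioi, mem_empty_iff_false, iff_false, not_and, not_lt]
    intro hx
    by_contra! hzx
    refine hc (h.mem_of_le (x := x) ?_ hz0 hzx.le)
    intro hx0
    exact hx (by simp [hx0])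
  rw [this] at htail
  exact h0.ne htail

/-- Monotone transport of an atomless probability measure onto a profile. -/
theorem exists_transport (h : IsProfile q lam κ A G) (μ : Measure ℝ) [IsProbabilityMeasure μ]
    [NullSingletonClass μ] :
    ∃ Ξ : ℝ → ℝ, AEMeasurable Ξ μ ∧ μ.map Ξ = densityMeasure G ∧
      (∀ᵐ x ∂μ, Ξ x ∈ Function.support G) ∧
      ∀ᵐ r ∂μ, ∀ᵐ x ∂μ, (x < r ↔ Ξ x < Ξ r) := by
  have := h.isProbabilityMeasure
  set γ := densityMeasure G with hγ
  let T : ℝ → ℝ≥0∞ := fun x => μ (Ioi x)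
  have hTm : Measurable T := measurable_tail μ
  let S : Set ℝ := {x | 0 < T x ∧ T x < 1}
  have hSm : MeasurableSet S :=
    (measurableSet_lt measurable_const hTm).inter (measurableSet_lt hTm measurable_const)
  have hS : ∀ᵐ x ∂μ, x ∈ S := by
    have h1 : ∀ᵐ x ∂μ, 0 < T x := by
      rw [ae_iff]
      have := measure_tail_le μ 0
      simpa only [not_lt, nonpos_iff_eq_zero] using this
    have h2 : ∀ᵐ x ∂μ, T x < 1 := by
      rw [ae_iff]
      refine measure_mono_null ?_ (nonpos_iff_eq_zero.1 (measure_lower_tail_le μ 0))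
      intro x hx
      have hx' : 1 ≤ T x := not_lt.1 hx
      have h3 : μ (Iic x) = 0 := by
        rw [← compl_Ioi, prob_compl_eq_zero_iff measurableSet_Ioi]
        exact le_antisymm prob_le_one hx'
      exact (measure_mono_null Iio_subset_Iic_self h3).le
    filter_upwards [h1, h2] with x a b using ⟨a, b⟩
  have hex : ∀ x, ∃ z, x ∈ S → z ∈ Function.support G ∧ γ (Ioi z) = T x := by
    intro x
    by_cases hx : x ∈ S
    · obtain ⟨z, h1, h2⟩ := h.exists_tail_eq hx.1 hx.2
      exact ⟨z, fun _ => ⟨h1, h2⟩⟩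
    · exact ⟨0, fun hc => absurd hc hx⟩
  choose Ξ hΞ using hex
  have hlt : ∀ x ∈ S, ∀ r ∈ S, (T r < T x ↔ Ξ x < Ξ r) := by
    intro x hx r hr
    obtain ⟨x1, x2⟩ := hΞ x hx
    obtain ⟨r1, r2⟩ := hΞ r hr
    rw [← x2, ← r2]
    refine ⟨fun h1 => ?_, fun h1 => h.tail_lt_tail x1 h1⟩
    by_contra! h2
    exact absurd h1 (not_lt.2 (antitone_tail γ h2))
  have hmono : MonotoneOn Ξ S := by
    intro x hx r hr hxr
    by_contra! hc
    exact absurd ((hlt r hr x hx).2 hc) (not_lt.2 (antitone_tail μ hxr))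
  have hΞm : AEMeasurable Ξ μ := by
    have := aemeasurable_restrict_of_monotoneOn (μ := μ) hSm hmono
    rwa [Measure.restrict_eq_self_of_ae_mem hS] at this
  have : IsProbabilityMeasure (μ.map Ξ) := Measure.isProbabilityMeasure_map hΞm
  refine ⟨Ξ, hΞm, ?_, hS.mono fun x hx => (hΞ x hx).1, ?_⟩
  · refine Measure.ext_of_Ici _ _ fun a => ?_
    rw [Measure.map_apply_of_aemeasurable hΞm measurableSet_Ici,
      ← measure_congr (Ioi_ae_eq_Ici (μ := γ) (a := a)),
      ← measure_tail_eq μ (prob_le_one (μ := γ) (s := Ioi a))]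
    refine measure_congr ?_
    filter_upwards [hS] with x hx
    obtain ⟨x1, x2⟩ := hΞ x hx
    refine propext ⟨fun h1 => ?_, fun h1 => ?_⟩
    · change μ (Ioi x) ≤ γ (Ioi a)
      change _ = μ (Ioi x) at x2
      rw [← x2]
      exact antitone_tail γ h1
    · change μ (Ioi x) ≤ γ (Ioi a) at h1
      change a ≤ Ξ x
      by_contra! hc
      have := h.tail_lt_tail x1 hc
      rw [← hγ, x2] at this
      exact absurd h1 (not_le.2 this)
  · filter_upwards [hS] with r hr
    have hsub : {x | T r < T x} ⊆ Iio r := by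
      intro x hx
      by_contra! hc
      exact absurd hx (not_lt.2 (antitone_tail μ (not_lt.1 hc)))
    have hmeas : μ {x | T r < T x} = μ (Iio r) := by
      have e1 : {x | T r < T x} = {x | μ (Ioi x) ≤ T r}ᶜ := by ext x; simp [T]
      rw [e1, prob_compl_eq_one_sub (measurableSet_le hTm measurable_const),
        measure_tail_eq μ hr.2.le, measure_congr (Iio_ae_eq_Iic (μ := μ) (a := r)), ← compl_Ioi,
        prob_compl_eq_one_sub measurableSet_Ioi]
    have hae : {x | T r < T x} =ᵐ[μ] Iio r :=
      ae_eq_of_subset_of_measure_ge hsub hmeas.ge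
        (measurableSet_lt measurable_const hTm).nullMeasurableSet (measure_ne_top _ _)
    filter_upwards [hS, hae] with x hx hx'
    rw [← hlt x hx r hr]
    exact (iff_of_eq hx').symm

/-! Integration by parts for profiles. -/

theorem hasDerivAt_rpow (h : IsProfile q lam κ A G) {x : ℝ} (hx : x ∈ Function.support G) :
    HasDerivAt (fun y => G y ^ lam / lam) (-(κ * (x ^ (q - 1) * G x))) x := by
  have hG := h.pos hx
  refine (((h.hasDerivAt hx).rpow_const (p := lam) (Or.inl hG.ne')).div_const lam).congr_deriv ?_
  have e : G x = G x ^ (2 - lam) * G x ^ (lam - 1) := by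
    rw [← Real.rpow_add hG]; norm_num
  have hl := h.lam_pos.ne'
  field_simp
  rw [mul_assoc, ← e]

theorem rpow_sub_one_mul_le (h : IsProfile q lam κ A G) (hq : 0 < q) {x y : ℝ} (hx : 0 < x)
    (hxy : x ≤ y) : y ^ (q - 1) * G y ≤ q / x * (boxCox q y * G y) := by
  have hy := hx.trans_le hxy
  have hG := h.nonneg y
  simp only [boxCox, hq.ne', if_false]
  rw [Real.rpow_sub_one hy.ne']
  have : y ^ q / y ≤ y ^ q / x := by gcongr
  calc y ^ q / y * G y ≤ y ^ q / x * G y := by gcongr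
    _ = _ := by field_simp

theorem integrableOn_rpow_sub_one (h : IsProfile q lam κ A G) (hq : 0 < q) {x : ℝ} (hx : 0 < x) :
    IntegrableOn (fun y => y ^ (q - 1) * G y) (Ioi x) := by
  refine Integrable.mono' (h.integrable_boxCox.integrableOn.const_mul (q / x)) ?_ ?_
  · exact (Measurable.mul (by fun_prop) h.measurable).aestronglyMeasurable
  · filter_upwards [ae_restrict_mem measurableSet_Ioi] with y hy
    have hy0 : 0 < y := hx.trans hy
    rw [Real.norm_of_nonneg (mul_nonneg (by positivity) (h.nonneg y))]
    exact h.rpow_sub_one_mul_le hq hx hy.le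

theorem integral_tail_eq (h : IsProfile q lam κ A G) (hq : 0 < q) {x : ℝ} (hx : 0 < x) :
    ∫ y in Ioi x, κ * (y ^ (q - 1) * G y) = G x ^ lam / lam := by
  have hi := (h.integrableOn_rpow_sub_one hq hx).const_mul κ
  have hl := h.lam_pos
  rcases le_or_gt lam 1 with hl1 | hl1
  · have hS := h.support_eq_Ioi hl1
    have hd : ∀ y ∈ Ioi (0 : ℝ), HasDerivAt (fun y => G y ^ lam / lam)
        (-(κ * (y ^ (q - 1) * G y))) y := fun y hy => h.hasDerivAt_rpow (by rw [hS]; exact hy)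
    have hF : Integrable (fun y => G y ^ lam / lam) := by
      refine Integrable.div_const ?_ lam
      by_cases he : lam = 1
      · simpa [he] using h.integrable
      · exact (h.integrable_rpow he).1
    have hlim := tendsto_zero_of_hasDerivAt_of_integrableOn_Ioi (a := x)
      (fun y hy => hd y (hx.trans hy)) hi.neg hF.integrableOn
    have := integral_Ioi_of_hasDerivAt_of_tendsto' (a := x)
      (fun y hy => hd y (hx.trans_le hy)) hi.neg hlim
    rw [integral_neg] at this
    linarith
  · obtain ⟨L, hL, hS⟩ := h.support_eq_Ioo hl1
    have hz : ∀ y, L ≤ y → G y = 0 := fun y hy => apply_right_end hS hy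
    rcases le_or_gt L x with hLx | hLx
    · rw [hz x hLx, Real.zero_rpow hl.ne', zero_div]
      refine setIntegral_eq_zero_of_forall_eq_zero fun y hy => ?_
      rw [hz y (hLx.trans (le_of_lt hy))]; ring
    · have hcont : ContinuousOn (fun y => G y ^ lam / lam) (Icc x L) :=
        ((h.continuousOn.mono fun y hy => hx.trans_le hy.1).rpow_const
          fun y _ => Or.inr hl.le).div_const lam
      have h1 := intervalIntegral.integral_eq_sub_of_hasDerivAt_of_le hLx.le hcont
        (fun y hy => h.hasDerivAt_rpow (by rw [hS]; exact ⟨hx.trans hy.1, hy.2⟩))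
        (by
          rw [intervalIntegrable_iff_integrableOn_Ioc_of_le hLx.le]
          exact IntegrableOn.mono_set (Integrable.neg hi) Ioc_subset_Ioi_self)
      rw [intervalIntegral.integral_of_le hLx.le, hz L le_rfl, Real.zero_rpow hl.ne', zero_div,
        zero_sub, integral_neg, neg_inj] at h1
      rw [← h1]
      refine setIntegral_eq_of_subset_of_forall_sdiff_eq_zero measurableSet_Ioi
        Ioc_subset_Ioi_self fun y hy => ?_
      have : L ≤ y := by
        by_contra! hc
        exact hy.2 ⟨hy.1, hc.le⟩
      rw [hz y this]; ring

theorem integral_rpow_by_parts (h : IsProfile q lam κ A G) (hq : 0 < q) :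
    ∫ x, G x ^ lam = lam * κ * (q * ∫ x, boxCox q x * G x) := by
  have hl := h.lam_pos
  have hκ := h.kappa_pos
  have hm : Measurable fun y => κ * (y ^ (q - 1) * G y) :=
    (Measurable.mul (by fun_prop) h.measurable).const_mul κ
  have h0 : ∀ y ∈ Ioi (0 : ℝ), 0 ≤ κ * (y ^ (q - 1) * G y) := fun y hy =>
    mul_nonneg hκ.le (mul_nonneg (Real.rpow_nonneg (le_of_lt hy) _) (h.nonneg y))
  have hF : Integrable (fun y => G y ^ lam / lam) := by
    refine Integrable.div_const ?_ lam
    by_cases he : lam = 1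
    · simpa [he] using h.integrable
    · exact (h.integrable_rpow he).1
  have hF0 : ∀ y, 0 ≤ G y ^ lam / lam := fun y =>
    div_nonneg (Real.rpow_nonneg (h.nonneg y) _) hl.le
  have key : ∫⁻ x, ENNReal.ofReal (G x ^ lam / lam)
      = ∫⁻ x, ENNReal.ofReal (κ * q * (boxCox q x * G x)) := by
    calc ∫⁻ x, ENNReal.ofReal (G x ^ lam / lam)
        = ∫⁻ x in Ioi 0, ENNReal.ofReal (G x ^ lam / lam) := by
          rw [setLIntegral_eq_of_support_subset]
          intro x hx
          by_contra hc
          refine hx ?_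
          beta_reduce
          rw [h.eq_zero x (not_lt.1 hc), Real.zero_rpow hl.ne']
          simp
      _ = ∫⁻ x in Ioi 0, ∫⁻ y in Ioi x, ENNReal.ofReal (κ * (y ^ (q - 1) * G y)) := by
          refine setLIntegral_congr_fun measurableSet_Ioi fun x hx => ?_
          rw [← h.integral_tail_eq hq hx, ofReal_integral_eq_lintegral_ofReal
            ((h.integrableOn_rpow_sub_one hq hx).const_mul κ)]
          filter_upwards [ae_restrict_mem measurableSet_Ioi] with y hy
          exact h0 y (lt_trans (mem_Ioi.1 hx) hy)
      _ = ∫⁻ x in Ioi (0 : ℝ), ∫⁻ y, (Ioi x).indicator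
            (fun y => ENNReal.ofReal (κ * (y ^ (q - 1) * G y))) y := by
          simp_rw [lintegral_indicator measurableSet_Ioi]
      _ = ∫⁻ y, ∫⁻ x in Ioi (0 : ℝ), (Ioi x).indicator
            (fun y => ENNReal.ofReal (κ * (y ^ (q - 1) * G y))) y := by
          refine lintegral_lintegral_swap ?_
          have : Measurable (({p : ℝ × ℝ | p.1 < p.2}).indicator
              fun p => ENNReal.ofReal (κ * (p.2 ^ (q - 1) * G p.2))) :=
            ((hm.comp measurable_snd).ennreal_ofReal).indicator
              (measurableSet_lt measurable_fst measurable_snd)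
          exact this.aemeasurable
      _ = ∫⁻ y, ENNReal.ofReal (κ * q * (boxCox q y * G y)) := by
          refine lintegral_congr fun y => ?_
          have e : ∀ x, (Ioi x).indicator
              (fun y => ENNReal.ofReal (κ * (y ^ (q - 1) * G y))) y
              = (Iio y).indicator (fun _ => ENNReal.ofReal (κ * (y ^ (q - 1) * G y))) x := by
            intro x; simp [indicator_apply]
          simp_rw [e]
          rw [lintegral_indicator_const measurableSet_Iio,
            Measure.restrict_apply measurableSet_Iio, inter_comm, Ioi_inter_Iio, Real.volume_Ioo,
            sub_zero]
          rcases le_or_gt y 0 with hy | hy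
          · simp [h.eq_zero y hy]
          · rw [← ENNReal.ofReal_mul (h0 y hy)]
            congr 1
            simp only [boxCox, hq.ne', if_false]
            rw [Real.rpow_sub_one hy.ne']
            field_simp
  rw [← ofReal_integral_eq_lintegral_ofReal hF (ae_of_all _ hF0),
    ← ofReal_integral_eq_lintegral_ofReal (h.integrable_boxCox.const_mul (κ * q)),
    integral_div, integral_const_mul] at key
  · have hp := h.integral_boxCox_pos hq
    rw [ENNReal.ofReal_eq_ofReal_iff (by
      rw [← integral_div]; exact integral_nonneg hF0) (by positivity)] at key
    rw [div_eq_iff hl.ne'] at key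
    rw [key]; ring
  · refine ae_of_all _ fun x => mul_nonneg (by positivity) ?_
    rcases le_or_gt x 0 with hx | hx
    · simp [h.eq_zero x hx]
    · exact mul_nonneg (boxCox_pos hq hx).le (h.nonneg x)

end IsProfile

/-! The mirrored moment-entropy inequality. -/

theorem holderConjugate_toReal {s q : ℝ} {f g : ℝ → ℝ} {μ : Measure ℝ} (hsq : s.HolderConjugate q)
    (hf : AEMeasurable f μ) (hg : AEMeasurable g μ) (hf0 : ∀ᵐ x ∂μ, 0 ≤ f x)
    (hg0 : ∀ᵐ x ∂μ, 0 ≤ g x) :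
    ∫⁻ x, ENNReal.ofReal (f x) * ENNReal.ofReal (g x) ∂μ
      ≤ (∫⁻ x, ENNReal.ofReal (f x ^ s) ∂μ) ^ (1 / s)
        * (∫⁻ x, ENNReal.ofReal (g x ^ q) ∂μ) ^ (1 / q) := by
  refine (ENNReal.lintegral_mul_le_Lp_mul_Lq μ hsq hf.ennreal_ofReal hg.ennreal_ofReal).trans
    (le_of_eq ?_)
  congr 2 <;> refine lintegral_congr_ae ?_
  · filter_upwards [hf0] with x hx
    rw [ENNReal.ofReal_rpow_of_nonneg hx hsq.nonneg]
  · filter_upwards [hg0] with x hx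
    rw [ENNReal.ofReal_rpow_of_nonneg hx hsq.symm.nonneg]

theorem mirrored_exp {Q lam : ℝ} (hQ : lam * (1 - Q) = 1) :
    lam ≠ 0 ∧ lam * Q = lam - 1 := by
  refine ⟨fun h => ?_, by linarith⟩
  rw [h, zero_mul] at hQ
  exact zero_ne_one hQ

theorem lintegral_transport_rpow {q lam κ A Q : ℝ} {G : ℝ → ℝ} {μ : Measure ℝ} {Ξ : ℝ → ℝ}
    (h : IsProfile q lam κ A G) (hQ : lam * (1 - Q) = 1)
    (hl : lam ≠ 1) (hΞ : AEMeasurable Ξ μ) (hmap : μ.map Ξ = densityMeasure G) :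
    ∫⁻ x, ENNReal.ofReal ((G (Ξ x) ^ lam / lam) ^ Q) ∂μ
      = ENNReal.ofReal (lam ^ (-Q) * ∫ x, G x ^ lam) := by
  have hl0 := h.lam_pos
  have hm : Measurable fun z => ENNReal.ofReal ((G z ^ lam / lam) ^ Q) :=
    (((h.measurable.pow_const lam).div_const lam).pow_const Q).ennreal_ofReal
  calc ∫⁻ x, ENNReal.ofReal ((G (Ξ x) ^ lam / lam) ^ Q) ∂μ
      = ∫⁻ z, ENNReal.ofReal ((G z ^ lam / lam) ^ Q) ∂(μ.map Ξ) :=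
        (lintegral_map' hm.aemeasurable hΞ).symm
    _ = ∫⁻ z, ENNReal.ofReal (lam ^ (-Q) * G z ^ lam) := by
        rw [hmap, lintegral_densityMeasure h.measurable]
        refine lintegral_congr fun z => ?_
        rw [← ENNReal.ofReal_mul (h.nonneg z)]
        congr 1
        rcases (h.nonneg z).eq_or_lt with hz | hz
        · rw [← hz, Real.zero_rpow hl0.ne']; ring
        · rw [Real.div_rpow (by positivity) hl0.le, ← Real.rpow_mul hz.le, (mirrored_exp hQ).2,
            Real.rpow_neg hl0.le, Real.rpow_sub_one hz.ne']
          field_simp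
    _ = _ := by
        rw [← integral_const_mul, ofReal_integral_eq_lintegral_ofReal
          ((h.integrable_rpow hl).1.const_mul _)]
        exact ae_of_all _ fun z => mul_nonneg (by positivity)
          (Real.rpow_nonneg (h.nonneg z) _)

theorem lintegral_transport_tail_le {q lam κ A s : ℝ} {G : ℝ → ℝ} {μ : Measure ℝ}
    [IsProbabilityMeasure μ] {v Ξ : ℝ → ℝ} (h : IsProfile q lam κ A G)
    (hsq : s.HolderConjugate q)
    (hv : AEMeasurable v μ) (hv0 : ∀ᵐ x ∂μ, 0 < v x)
    (hvs : ∫⁻ x, ENNReal.ofReal (v x ^ s) ∂μ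
      = ENNReal.ofReal (κ ^ s * (q * ∫ x, boxCox q x * G x)))
    (hΞ : AEMeasurable Ξ μ) (hmap : μ.map Ξ = densityMeasure G)
    (hΞG : ∀ᵐ x ∂μ, Ξ x ∈ Function.support G)
    (hord : ∀ᵐ r ∂μ, ∀ᵐ x ∂μ, (x < r ↔ Ξ x < Ξ r)) :
    ∫⁻ x, ENNReal.ofReal (G (Ξ x))⁻¹ * weightedTail μ v x ∂μ
      ≤ ENNReal.ofReal ((∫ x, G x ^ lam) / lam) := by
  have hq : 0 < q := hsq.symm.pos
  have hs : 0 < s := hsq.pos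
  have hκ := h.kappa_pos
  set m := q * ∫ x, boxCox q x * G x with hm
  have hm0 : 0 < m := (h.deviation_rpow hq.ne').1
  have hwm : Measurable fun z => ENNReal.ofReal (G z)⁻¹ := h.measurable.inv.ennreal_ofReal
  have hinner : ∀ᵐ r ∂μ, ∫⁻ x, (Iio r).indicator (fun x => ENNReal.ofReal (G (Ξ x))⁻¹) x ∂μ
      ≤ ENNReal.ofReal (Ξ r) := by
    filter_upwards [hord] with r hr
    calc ∫⁻ x, (Iio r).indicator (fun x => ENNReal.ofReal (G (Ξ x))⁻¹) x ∂μ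
        = ∫⁻ x, (Iio (Ξ r)).indicator (fun z => ENNReal.ofReal (G z)⁻¹) (Ξ x) ∂μ := by
          refine lintegral_congr_ae ?_
          filter_upwards [hr] with x hx
          simp only [indicator_apply, mem_Iio, hx]
      _ = ∫⁻ z, (Iio (Ξ r)).indicator (fun z => ENNReal.ofReal (G z)⁻¹) z ∂(μ.map Ξ) :=
          (lintegral_map' (hwm.indicator measurableSet_Iio).aemeasurable hΞ).symm
      _ = ∫⁻ z, ENNReal.ofReal (G z)
            * (Iio (Ξ r)).indicator (fun z => ENNReal.ofReal (G z)⁻¹) z := by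
          rw [hmap, lintegral_densityMeasure h.measurable]
      _ ≤ ∫⁻ z, (Ioo 0 (Ξ r)).indicator (fun _ => 1) z := by
          refine lintegral_mono fun z => ?_
          simp only [indicator_apply, mem_Iio, mem_Ioo]
          split_ifs with h1 h2 h2
          · rw [← ENNReal.ofReal_mul (h.nonneg z), ← ENNReal.ofReal_one]
            exact ENNReal.ofReal_le_ofReal mul_inv_le_one
          · have : z ≤ 0 := by
              by_contra! hc
              exact h2 ⟨hc, h1⟩
            simp [h.eq_zero z this]
          · exact absurd h2.2 h1
          · simp
      _ = ENNReal.ofReal (Ξ r) := by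
          rw [lintegral_indicator_const measurableSet_Ioo]; simp
  have hint : ∫⁻ x, ENNReal.ofReal (Ξ x ^ q) ∂μ = ENNReal.ofReal m := by
    calc ∫⁻ x, ENNReal.ofReal (Ξ x ^ q) ∂μ
        = ∫⁻ z, ENNReal.ofReal (z ^ q) ∂(μ.map Ξ) :=
          (lintegral_map' (f := fun z => ENNReal.ofReal (z ^ q)) (by fun_prop) hΞ).symm
      _ = ∫⁻ z, ENNReal.ofReal (q * (boxCox q z * G z)) := by
          rw [hmap, lintegral_densityMeasure h.measurable]
          refine lintegral_congr fun z => ?_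
          rw [← ENNReal.ofReal_mul (h.nonneg z)]
          rcases le_or_gt z 0 with hz | hz
          · simp [h.eq_zero z hz]
          · rw [← h.rpow_mul_eq hq.ne', abs_of_pos hz, mul_comm]
      _ = ENNReal.ofReal m := by
          rw [hm, ← integral_const_mul, ofReal_integral_eq_lintegral_ofReal
            (h.integrable_boxCox.const_mul q)]
          refine ae_of_all _ fun z => ?_
          simp only [Pi.zero_apply]
          rw [← h.rpow_mul_eq hq.ne']
          exact mul_nonneg (by positivity) (h.nonneg z)
  calc ∫⁻ x, ENNReal.ofReal (G (Ξ x))⁻¹ * weightedTail μ v x ∂μ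
      = ∫⁻ x, ∫⁻ r, (Ioi x).indicator
          (fun r => ENNReal.ofReal (G (Ξ x))⁻¹ * ENNReal.ofReal (v r)) r ∂μ ∂μ := by
        refine lintegral_congr fun x => ?_
        rw [lintegral_indicator measurableSet_Ioi,
          lintegral_const_mul' _ _ ENNReal.ofReal_ne_top]
        rfl
    _ = ∫⁻ r, ∫⁻ x, (Ioi x).indicator
          (fun r => ENNReal.ofReal (G (Ξ x))⁻¹ * ENNReal.ofReal (v r)) r ∂μ ∂μ := by
        refine lintegral_lintegral_swap ?_
        have h1 : AEMeasurable (fun p : ℝ × ℝ => ENNReal.ofReal (G (Ξ p.1))⁻¹) (μ.prod μ) :=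
          (hwm.comp_aemeasurable hΞ).comp_fst
        have h2 : AEMeasurable (fun p : ℝ × ℝ => ENNReal.ofReal (v p.2)) (μ.prod μ) :=
          hv.ennreal_ofReal.comp_snd
        exact (h1.mul h2).indicator (measurableSet_lt measurable_fst measurable_snd)
    _ = ∫⁻ r, ENNReal.ofReal (v r)
          * ∫⁻ x, (Iio r).indicator (fun x => ENNReal.ofReal (G (Ξ x))⁻¹) x ∂μ ∂μ := by
        refine lintegral_congr fun r => ?_
        rw [← lintegral_const_mul' _ _ ENNReal.ofReal_ne_top]
        refine lintegral_congr fun x => ?_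
        simp only [indicator_apply, mem_Ioi, mem_Iio]
        split_ifs
        · rw [mul_comm]
        · rw [mul_zero]
    _ ≤ ∫⁻ r, ENNReal.ofReal (v r) * ENNReal.ofReal (Ξ r) ∂μ := by
        refine lintegral_mono_ae ?_
        filter_upwards [hinner] with r hr
        gcongr
    _ ≤ (∫⁻ x, ENNReal.ofReal (v x ^ s) ∂μ) ^ (1 / s)
        * (∫⁻ x, ENNReal.ofReal (Ξ x ^ q) ∂μ) ^ (1 / q) :=
        holderConjugate_toReal hsq hv hΞ (hv0.mono fun x hx => hx.le)
          (hΞG.mono fun x hx => (h.pos_of_mem hx).le)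
    _ = ENNReal.ofReal ((∫ x, G x ^ lam) / lam) := by
        have hsq1 : 1 / s + 1 / q = 1 := by
          simpa only [one_div] using hsq.inv_add_inv_eq_one
        rw [hvs, hint, ENNReal.ofReal_rpow_of_pos (by positivity),
          ENNReal.ofReal_rpow_of_pos hm0, ← ENNReal.ofReal_mul (by positivity),
          h.integral_rpow_by_parts hq, ← hm, Real.mul_rpow (by positivity) hm0.le,
          ← Real.rpow_mul hκ.le, mul_one_div_cancel hs.ne', Real.rpow_one, mul_assoc,
          ← Real.rpow_add hm0, hsq1, Real.rpow_one]
        congr 1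
        have := h.lam_pos.ne'
        field_simp

/-- The normalised form of the mirrored inequality for moments. -/
theorem mirrored_core {q lam κ A s Q : ℝ} {G : ℝ → ℝ} {μ : Measure ℝ}
    [IsProbabilityMeasure μ] [NullSingletonClass μ] {v : ℝ → ℝ} (h : IsProfile q lam κ A G)
    (hsq : s.HolderConjugate q)
    (hQ : lam * (1 - Q) = 1) (hv : AEMeasurable v μ) (hv0 : ∀ᵐ x ∂μ, 0 < v x)
    (hvs : ∫⁻ x, ENNReal.ofReal (v x ^ s) ∂μ
      = ENNReal.ofReal (κ ^ s * (q * ∫ x, boxCox q x * G x))) :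
    (0 < Q → ∫⁻ x, weightedTail μ v x ^ Q ∂μ ≤ ENNReal.ofReal (lam ^ (-Q) * ∫ x, G x ^ lam)) ∧
    (Q < 0 → ENNReal.ofReal (lam ^ (-Q) * ∫ x, G x ^ lam) ≤ ∫⁻ x, weightedTail μ v x ^ Q ∂μ) ∧
    (Q = 0 → Integrable (fun x => Real.log (weightedTail μ v x).toReal) μ →
      ∫ x, Real.log (weightedTail μ v x).toReal ∂μ ≤ ∫ x, G x * Real.log (G x)) := by
  obtain ⟨Ξ, hΞ, hmap, hΞG, hord⟩ := h.exists_transport μ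
  have hJ := lintegral_transport_tail_le h hsq hv hv0 hvs hΞ hmap hΞG hord
  have hlam := h.lam_pos
  have hne := weightedTail_ne_zero hv hv0
  set U := weightedTail μ v with hU
  have hUm : Measurable U := measurable_weightedTail μ v
  set N := ∫ x, G x ^ lam with hN
  have hGm : AEMeasurable (fun x => ENNReal.ofReal (G (Ξ x))⁻¹) μ :=
    (h.measurable.inv.ennreal_ofReal).comp_aemeasurable hΞ
  have hfin : ∀ᵐ x ∂μ, U x ≠ ⊤ := by
    have := ae_lt_top' (hGm.mul hUm.aemeasurable) (hJ.trans_lt ENNReal.ofReal_lt_top).ne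
    filter_upwards [this, hΞG] with x hx hx' hc
    rw [Pi.mul_apply, hc, ENNReal.mul_top (ENNReal.ofReal_pos.2 (inv_pos.2 (h.pos hx'))).ne'] at hx
    exact lt_irrefl _ hx
  -- the reciprocal of the comparison variable
  have hb : ∀ g : ℝ, 0 < g → (lam / g ^ lam) ^ (1 - Q) = lam ^ (1 - Q) * g⁻¹ ∧
      (lam / g ^ lam) ^ (-Q) = (g ^ lam / lam) ^ Q := by
    intro g hg
    constructor
    · rw [Real.div_rpow hlam.le (by positivity), ← Real.rpow_mul hg.le, hQ, Real.rpow_one,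
        div_eq_mul_inv]
    · rw [Real.rpow_neg (by positivity), ← Real.inv_rpow (by positivity), inv_div]
  have hconst : lam ^ (1 - Q) * (N / lam) = lam ^ (-Q) * N := by
    rw [show 1 - Q = -Q + 1 by ring, Real.rpow_add_one hlam.ne']
    field_simp
  have hJ' : ENNReal.ofReal (lam ^ (1 - Q)) * ∫⁻ x, ENNReal.ofReal (G (Ξ x))⁻¹ * U x ∂μ
      ≤ ENNReal.ofReal (lam ^ (-Q) * N) := by
    rw [← hconst, ENNReal.ofReal_mul (by positivity)]
    gcongr
  have hfac : ∀ x, 0 < G (Ξ x) → U x ≠ ⊤ → ENNReal.ofReal (lam ^ (1 - Q))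
      * (ENNReal.ofReal (G (Ξ x))⁻¹ * U x)
      = ENNReal.ofReal ((lam / G (Ξ x) ^ lam) ^ (1 - Q) * (U x).toReal) := by
    intro x hg hx
    rw [(hb _ hg).1, ENNReal.ofReal_mul (by positivity), ENNReal.ofReal_mul (by positivity),
      ENNReal.ofReal_toReal hx, mul_assoc]
  have hUr : ∀ x, U x ≠ 0 → U x ≠ ⊤ → U x ^ Q = ENNReal.ofReal ((U x).toReal ^ Q) := by
    intro x h0 h1
    rw [← ENNReal.ofReal_rpow_of_pos (ENNReal.toReal_pos h0 h1), ENNReal.ofReal_toReal h1]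
  refine ⟨fun hQ0 => ?_, fun hQ0 => ?_, fun hQ0 hlog => ?_⟩
  · have hl1 : lam ≠ 1 := by rintro rfl; linarith
    have hQ1 : Q < 1 := by
      by_contra! hc
      nlinarith
    have hR := lintegral_transport_rpow (μ := μ) h hQ hl1 hΞ hmap
    calc ∫⁻ x, U x ^ Q ∂μ
        ≤ ∫⁻ x, (ENNReal.ofReal (1 - Q) * ENNReal.ofReal ((G (Ξ x) ^ lam / lam) ^ Q)
          + ENNReal.ofReal Q * (ENNReal.ofReal (lam ^ (1 - Q))
            * (ENNReal.ofReal (G (Ξ x))⁻¹ * U x))) ∂μ := by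
          refine lintegral_mono_ae ?_
          filter_upwards [hne, hfin, hΞG] with x h0 h1 h2
          have hg := h.pos h2
          have hu := ENNReal.toReal_pos h0 h1
          rw [hfac x hg h1, hUr x h0 h1, ← ENNReal.ofReal_mul (by linarith),
            ← ENNReal.ofReal_mul hQ0.le, ← ENNReal.ofReal_add
              (mul_nonneg (by linarith) (by positivity)) (mul_nonneg hQ0.le (by positivity)),
            ← (hb _ hg).2]
          refine ENNReal.ofReal_le_ofReal ?_
          have := young_of_lt_one (lam := 1 - Q) (b := lam / G (Ξ x) ^ lam) (by linarith)
            (by linarith) (by positivity) hu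
          simpa only [sub_sub_cancel, sub_sub_cancel_left] using this
      _ = ENNReal.ofReal (1 - Q) * ∫⁻ x, ENNReal.ofReal ((G (Ξ x) ^ lam / lam) ^ Q) ∂μ
          + ENNReal.ofReal Q * (ENNReal.ofReal (lam ^ (1 - Q))
            * ∫⁻ x, ENNReal.ofReal (G (Ξ x))⁻¹ * U x ∂μ) := by
          rw [lintegral_add_left', lintegral_const_mul' _ _ ENNReal.ofReal_ne_top,
            lintegral_const_mul' _ _ ENNReal.ofReal_ne_top,
            lintegral_const_mul' _ _ ENNReal.ofReal_ne_top]
          exact (((((h.measurable.pow_const lam).div_const lam).pow_const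
            Q).ennreal_ofReal).comp_aemeasurable hΞ).const_mul _
      _ ≤ ENNReal.ofReal (1 - Q) * ENNReal.ofReal (lam ^ (-Q) * N)
          + ENNReal.ofReal Q * ENNReal.ofReal (lam ^ (-Q) * N) := by
          rw [hR]
          gcongr
      _ = _ := by
          rw [← add_mul, ← ENNReal.ofReal_add (by linarith) hQ0.le]
          simp
  · have hl1 : lam ≠ 1 := by rintro rfl; linarith
    have hR := lintegral_transport_rpow (μ := μ) h hQ hl1 hΞ hmap
    have key : ENNReal.ofReal (1 - Q) * ENNReal.ofReal (lam ^ (-Q) * N)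
        ≤ ∫⁻ x, U x ^ Q ∂μ + ENNReal.ofReal (-Q) * ENNReal.ofReal (lam ^ (-Q) * N) := by
      calc ENNReal.ofReal (1 - Q) * ENNReal.ofReal (lam ^ (-Q) * N)
          = ∫⁻ x, ENNReal.ofReal (1 - Q) * ENNReal.ofReal ((G (Ξ x) ^ lam / lam) ^ Q) ∂μ := by
            rw [lintegral_const_mul' _ _ ENNReal.ofReal_ne_top, hR]
        _ ≤ ∫⁻ x, (U x ^ Q + ENNReal.ofReal (-Q) * (ENNReal.ofReal (lam ^ (1 - Q))
            * (ENNReal.ofReal (G (Ξ x))⁻¹ * U x))) ∂μ := by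
            refine lintegral_mono_ae ?_
            filter_upwards [hne, hfin, hΞG] with x h0 h1 h2
            have hg := h.pos h2
            have hu := ENNReal.toReal_pos h0 h1
            rw [hfac x hg h1, hUr x h0 h1, ← ENNReal.ofReal_mul (by linarith),
              ← ENNReal.ofReal_mul (by linarith), ← ENNReal.ofReal_add (by positivity)
                (mul_nonneg (by linarith) (by positivity)), ← (hb _ hg).2]
            refine ENNReal.ofReal_le_ofReal ?_
            have := young_of_one_lt (lam := 1 - Q) (b := lam / G (Ξ x) ^ lam) (by linarith)
              (by positivity) hu
            simpa only [sub_sub_cancel, sub_sub_cancel_left] using this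
        _ = ∫⁻ x, U x ^ Q ∂μ + ENNReal.ofReal (-Q) * (ENNReal.ofReal (lam ^ (1 - Q))
            * ∫⁻ x, ENNReal.ofReal (G (Ξ x))⁻¹ * U x ∂μ) := by
            rw [lintegral_add_left (hUm.pow_const Q),
              lintegral_const_mul' _ _ ENNReal.ofReal_ne_top,
              lintegral_const_mul' _ _ ENNReal.ofReal_ne_top]
        _ ≤ _ := by gcongr
    have hsplit : ENNReal.ofReal (1 - Q) * ENNReal.ofReal (lam ^ (-Q) * N)
        = ENNReal.ofReal (lam ^ (-Q) * N)
          + ENNReal.ofReal (-Q) * ENNReal.ofReal (lam ^ (-Q) * N) := by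
      rw [← one_add_mul, ← ENNReal.ofReal_one, ← ENNReal.ofReal_add zero_le_one (by linarith)]
      ring_nf
    rw [hsplit] at key
    exact (ENNReal.add_le_add_iff_right
      (ENNReal.mul_ne_top ENNReal.ofReal_ne_top ENNReal.ofReal_ne_top)).1 key
  · subst hQ0
    have hl1 : lam = 1 := by linarith
    subst hl1
    have hN1 : N = 1 := by rw [hN]; simpa using h.integral
    rw [hN1] at hJ
    have hi0 : 0 ≤ᵐ[μ] fun x => (G (Ξ x))⁻¹ * (U x).toReal := ae_of_all _ fun x =>
      mul_nonneg (inv_nonneg.2 (h.nonneg _)) ENNReal.toReal_nonneg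
    have him : AEStronglyMeasurable (fun x => (G (Ξ x))⁻¹ * (U x).toReal) μ :=
      ((h.measurable.inv.comp_aemeasurable hΞ).mul
        hUm.ennreal_toReal.aemeasurable).aestronglyMeasurable
    have hle : ∫⁻ x, ENNReal.ofReal ((G (Ξ x))⁻¹ * (U x).toReal) ∂μ ≤ 1 := by
      refine le_trans (le_of_eq (lintegral_congr_ae ?_)) (hJ.trans (by simp))
      filter_upwards [hfin] with x hx
      rw [ENNReal.ofReal_mul (inv_nonneg.2 (h.nonneg _)), ENNReal.ofReal_toReal hx]
    have hi : Integrable (fun x => (G (Ξ x))⁻¹ * (U x).toReal) μ := by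
      refine ⟨him, ?_⟩
      rw [hasFiniteIntegral_iff_ofReal hi0]
      exact hle.trans_lt ENNReal.one_lt_top
    have hi1 : ∫ x, (G (Ξ x))⁻¹ * (U x).toReal ∂μ ≤ 1 := by
      rw [integral_eq_lintegral_of_nonneg_ae hi0 him]
      exact ENNReal.toReal_le_of_le_ofReal zero_le_one (by simpa using hle)
    have hlogm : Measurable fun z => Real.log (G z) := Real.measurable_log.comp h.measurable
    have hden : ∫ z, Real.log (G z) ∂densityMeasure G = ∫ x, G x * Real.log (G x) := by
      rw [densityMeasure, integral_withDensity_eq_integral_toReal_smul h.measurable.ennreal_ofReal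
        (ae_of_all _ fun x => ENNReal.ofReal_lt_top)]
      refine integral_congr_ae (ae_of_all _ fun x => ?_)
      simp [ENNReal.toReal_ofReal (h.nonneg x)]
    have hdeni : Integrable (fun z => Real.log (G z)) (densityMeasure G) := by
      rw [densityMeasure, integrable_withDensity_iff_integrable_smul' h.measurable.ennreal_ofReal
        (ae_of_all _ fun x => ENNReal.ofReal_lt_top)]
      refine h.integrable_log.1.congr (ae_of_all _ fun x => ?_)
      simp [ENNReal.toReal_ofReal (h.nonneg x)]
    have hlogi : Integrable (fun x => Real.log (G (Ξ x))) μ := by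
      rw [← hmap] at hdeni
      exact hdeni.comp_aemeasurable hΞ
    have hlogI : ∫ x, Real.log (G (Ξ x)) ∂μ = ∫ x, G x * Real.log (G x) := by
      rw [← hden, ← hmap, integral_map hΞ hlogm.aestronglyMeasurable]
    have hmono : ∫ x, Real.log (U x).toReal ∂μ
        ≤ ∫ x, (Real.log (G (Ξ x)) + ((G (Ξ x))⁻¹ * (U x).toReal - 1)) ∂μ := by
      refine integral_mono_ae hlog (hlogi.add (hi.sub (integrable_const _))) ?_
      filter_upwards [hne, hfin, hΞG] with x h0 h1 h2
      have hg := h.pos h2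
      have hu := ENNReal.toReal_pos h0 h1
      have := Real.log_le_sub_one_of_pos (mul_pos (inv_pos.2 hg) hu)
      rw [Real.log_mul (inv_pos.2 hg).ne' hu.ne', Real.log_inv] at this
      linarith
    have hi2 : Integrable (fun x => (G (Ξ x))⁻¹ * (U x).toReal - 1) μ :=
      hi.sub (integrable_const _)
    rw [integral_add hlogi hi2, hlogI,
      integral_sub hi (integrable_const _)] at hmono
    simp only [integral_const, probReal_univ, smul_eq_mul, mul_one] at hmono
    linarith

theorem MirroredDomain.conjExp_facts {p lam : ℝ} (h : MirroredDomain p lam) :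
    conjExp p < 1 ∧ 0 < 1 - p ∧ (1 - p) * (1 - conjExp p) = 1 ∧
      (1 - lam).HolderConjugate (conjExp (1 - lam)) ∧ ClassicalDomain (1 - lam) (1 - p) := by
  obtain ⟨hp, hl, hs⟩ := h
  have hp' : p - 1 ≠ 0 := sub_ne_zero.2 hp
  have e1 : (1 - p) * (1 - conjExp p) = 1 := by
    rw [conjExp]; field_simp; ring
  have e2 : conjExp (1 - lam) = (lam - 1) / lam := by
    rw [conjExp, show 1 - lam - 1 = -lam by ring, ← neg_sub lam 1, neg_div_neg_eq]
  have e3 : (lam - 1) / lam = 1 - 1 / lam := by rw [sub_div, div_self hl.ne]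
  have e4 : 1 / lam < 0 := one_div_neg.2 hl
  have hQ : conjExp p < 1 := by
    rcases lt_trichotomy (conjExp p) 1 with h1 | h1 | h1
    · exact h1
    · rw [h1] at e1; simp at e1
    · rw [Real.sign_of_neg (by linarith : 1 - conjExp p < 0), Real.sign_of_pos] at hs
      · norm_num at hs
      · rw [e3]; linarith
  have hp0 : 0 < 1 - p := by
    by_contra! hc
    nlinarith
  have hq1 : 0 < (lam - 1) / lam + conjExp p := by
    rw [Real.sign_of_pos (by linarith : 0 < 1 - conjExp p)] at hs
    by_contra! hc
    rcases hc.eq_or_lt with h1 | h1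
    · rw [h1, Real.sign_zero] at hs; norm_num at hs
    · rw [Real.sign_of_neg h1] at hs; norm_num at hs
  refine ⟨hQ, hp0, e1, ?_, by linarith, ?_, ?_⟩
  · exact Real.HolderConjugate.conjExponent (by linarith)
  · rw [e2, e3]; linarith
  · rw [e2, div_lt_iff₀ (by rw [e3]; linarith)]
    nlinarith

theorem IsProfile.fisherInfo_eq {q lam κ A s : ℝ} {G : ℝ → ℝ} (h : IsProfile q lam κ A G)
    (hsq : s.HolderConjugate q) :
    fisherInfo s lam G = κ ^ s * (q * ∫ x, boxCox q x * G x) := by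
  have hq := hsq.symm.pos
  have hκ := h.kappa_pos
  have e : ∀ x ∈ Function.support G, |G x ^ (lam - 2) * deriv G x| ^ s * G x
      = κ ^ s * (q * (boxCox q x * G x)) := by
    intro x hx
    have hG := h.pos hx
    have hx0 := h.pos_of_mem hx
    have h1 : |G x ^ (lam - 2) * deriv G x| = κ * x ^ (q - 1) := by
      rw [(h.hasDerivAt hx).deriv, mul_neg, abs_neg, mul_left_comm, ← Real.rpow_add hG]
      norm_num
      rw [abs_of_pos hκ, abs_of_pos (Real.rpow_pos_of_pos hx0 _)]
    rw [h1, Real.mul_rpow hκ.le (by positivity), ← Real.rpow_mul hx0.le,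
      hsq.symm.sub_one_mul_conj, ← h.rpow_mul_eq hq.ne', abs_of_pos hx0, mul_assoc]
  rw [fisherInfo, setIntegral_congr_fun h.isOpen_support.measurableSet e, integral_const_mul,
    integral_const_mul]
  congr 2
  refine setIntegral_eq_integral_of_forall_compl_eq_zero fun x hx => ?_
  rw [Function.notMem_support.1 hx, mul_zero]

theorem constKappa0_eq {p lam κ A : ℝ} (hdom : MirroredDomain p lam)
    (h : IsProfile (conjExp (1 - lam)) (1 - p) κ A (genGauss (1 - lam) (1 - p))) :
    constKappa0 p lam = (1 - p) ^ (1 - conjExp p) * renyiPower (1 - p) (genGauss (1 - lam) (1 - p))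
      * (κ ^ (1 - lam) * (conjExp (1 - lam) *
        ∫ x, boxCox (conjExp (1 - lam)) x * genGauss (1 - lam) (1 - p) x))
          ^ ((1 - conjExp p) / (1 - lam)) := by
  obtain ⟨hQ1, hp0, hQ, hsq, -⟩ := hdom.conjExp_facts
  have e1 : 1 - conjExp p = (1 - p)⁻¹ := eq_inv_of_mul_eq_one_right hQ
  have e2 : |conjExp p - 1| ^ (conjExp p - 1) = (1 - p) ^ (1 - conjExp p) := by
    rw [abs_sub_comm, abs_of_pos (by linarith : 0 < 1 - conjExp p), ← neg_sub 1 (conjExp p), e1,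
      Real.inv_rpow hp0.le, Real.rpow_neg hp0.le, inv_inv]
  have e3 : 1 / ((1 - lam) * (1 - p)) = (1 - conjExp p) / (1 - lam) := by
    rw [e1]; field_simp
  rw [constKappa0, constKappa1, fisherPhi, h.fisherInfo_eq hsq, e2, e3]
  ring

/-- The mirrored moment-entropy inequality for the upper tail of a weight. -/
theorem constKappa0_le {p lam : ℝ} (hdom : MirroredDomain p lam) {μ : Measure ℝ}
    [IsProbabilityMeasure μ] [NullSingletonClass μ] {v : ℝ → ℝ}
    (hv : AEMeasurable v μ) (hv0 : ∀ᵐ x ∂μ, 0 < v x)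
    (hU : p = 0 → (∀ᵐ x ∂μ, weightedTail μ v x ≠ ⊤) ∧
      Integrable (fun x => Real.log (weightedTail μ v x).toReal) μ)
    (hdet : invEntropy lam μ v ^ (conjExp p - 1) = ⊤ →
      momentDev (conjExp p) μ (weightedTail μ v) ^ (conjExp p - 1) ≠ 0) :
    ENNReal.ofReal (constKappa0 p lam)
      ≤ momentDev (conjExp p) μ (weightedTail μ v) ^ (conjExp p - 1)
        * invEntropy lam μ v ^ (conjExp p - 1) := by
  obtain ⟨hQ1, hp0, hQ, hsq, hcl⟩ := hdom.conjExp_facts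
  obtain ⟨κ, A, h, -⟩ := isProfile_genGauss hcl
  set Q := conjExp p with hQdef
  set G := genGauss (1 - lam) (1 - p)
  set q := conjExp (1 - lam)
  have hs := hsq.pos
  have hq := hsq.symm.pos
  have hl1 : lam ≠ 1 := by linarith [hdom.2.1]
  have hQ0 : Q = 0 ↔ p = 0 := conjExp_eq_zero hdom.1
  set F := κ ^ (1 - lam) * (q * ∫ x, boxCox q x * G x) with hF
  have hκ := h.kappa_pos
  have hF0 : 0 < F := mul_pos (by positivity) (h.deviation_rpow hq.ne').1
  have hinv : ∀ w : ℝ → ℝ, invEntropy lam μ w ^ (Q - 1)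
      = (∫⁻ x, ENNReal.ofReal (w x ^ (1 - lam)) ∂μ) ^ ((1 - Q) / (1 - lam)) := by
    intro w
    rw [invEntropy, if_neg hl1, ← ENNReal.rpow_mul]
    congr 1
    rw [← neg_sub 1 lam, ← neg_sub 1 Q]
    field_simp
  have hexp : 0 < (1 - Q) / (1 - lam) := div_pos (by linarith) hs
  by_cases htop : invEntropy lam μ v ^ (Q - 1) = ⊤
  · rw [htop, ENNReal.mul_top (hdet htop)]
    exact le_top
  set X := ∫⁻ x, ENNReal.ofReal (v x ^ (1 - lam)) ∂μ with hX
  have hXtop : X ≠ ⊤ := fun hc => htop (by rw [hinv, ← hX, hc, ENNReal.top_rpow_of_pos hexp])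
  have hX0 : X ≠ 0 := by
    rw [hX, ne_eq, lintegral_eq_zero_iff' (hv.pow_const _).ennreal_ofReal]
    intro hc
    have : ∀ᵐ x ∂μ, False := by
      filter_upwards [hc, hv0] with x h1 h2
      exact (ENNReal.ofReal_pos.2 (Real.rpow_pos_of_pos h2 (1 - lam))).ne' h1
    exact IsProbabilityMeasure.ne_zero μ (by simpa using this)
  have hx0 : 0 < X.toReal := ENNReal.toReal_pos hX0 hXtop
  set c := (F / X.toReal) ^ (1 / (1 - lam)) with hc
  have hc0 : 0 < c := by positivity
  have hvs : ∫⁻ x, ENNReal.ofReal ((c * v x) ^ (1 - lam)) ∂μ = ENNReal.ofReal F := by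
    have : ∫⁻ x, ENNReal.ofReal ((c * v x) ^ (1 - lam)) ∂μ
        = ENNReal.ofReal (c ^ (1 - lam)) * X := by
      rw [hX, ← lintegral_const_mul' _ _ ENNReal.ofReal_ne_top]
      refine lintegral_congr_ae ?_
      filter_upwards [hv0] with x hx
      rw [Real.mul_rpow hc0.le hx.le, ENNReal.ofReal_mul (by positivity)]
    rw [this, hc, ← Real.rpow_mul (by positivity), one_div_mul_cancel hs.ne', Real.rpow_one,
      ← ENNReal.ofReal_toReal hXtop, ← ENNReal.ofReal_mul (by positivity),
      ENNReal.toReal_ofReal hx0.le, div_mul_cancel₀ _ hx0.ne']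
  have hne := weightedTail_ne_zero hv hv0
  have hvc0 : ∀ᵐ x ∂μ, 0 < c * v x := hv0.mono fun x hx => mul_pos hc0 hx
  obtain ⟨c1, c2, c3⟩ := mirrored_core h hsq hQ (hv.const_mul c) hvc0 hvs
  have hU' : weightedTail μ (fun r => c * v r)
      = fun x => ENNReal.ofReal c * weightedTail μ v x := funext (weightedTail_smul μ v hc0)
  set N := ∫ x, G x ^ (1 - p) with hN
  have hD : ENNReal.ofReal ((1 - p) ^ (1 - Q) * renyiPower (1 - p) G)
      ≤ momentDev Q μ (weightedTail μ fun r => c * v r) ^ (Q - 1) := by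
    by_cases hQz : Q = 0
    · have hpz := hQ0.1 hQz
      have hint :
          Integrable (fun x => Real.log (weightedTail μ (fun r => c * v r) x).toReal) μ := by
        rw [hU']
        exact (integrable_log_smul hc0 hne (hU hpz).1 (hU hpz).2).1
      have := c3 hQz hint
      rw [momentDev, if_pos hQz, hQz, hpz, ENNReal.ofReal_rpow_of_pos (Real.exp_pos _), sub_zero,
        zero_sub, Real.one_rpow, one_mul, IsProfile.renyiPower_one, Real.rpow_neg_one,
        ← Real.exp_neg]
      exact ENNReal.ofReal_le_ofReal (Real.exp_le_exp.2 (by linarith))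
    · have hpz : p ≠ 0 := fun h0 => hQz (hQ0.2 h0)
      have hl : 1 - p ≠ 1 := fun h0 => hpz (by linarith)
      have hNp : 0 < N := h.integral_rpow_pos hl
      have hm0 : 0 < (1 - p) ^ (-Q) * N := by positivity
      have hee : 1 / p = (Q - 1) / Q := by
        rw [div_eq_div_iff hpz hQz]; linarith
      have e1 : ENNReal.ofReal ((1 - p) ^ (1 - Q) * renyiPower (1 - p) G)
          = ENNReal.ofReal ((1 - p) ^ (-Q) * N) ^ ((Q - 1) / Q) := by
        rw [ENNReal.ofReal_rpow_of_pos hm0, Real.mul_rpow (by positivity) hNp.le,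
          ← Real.rpow_mul hp0.le, h.renyiPower_eq hl, sub_sub_cancel, hee]
        congr 3
        field_simp
        ring
      rw [e1, momentDev, if_neg hQz, ← ENNReal.rpow_mul, one_div_mul_eq_div]
      rcases lt_or_gt_of_ne hQz with hQn | hQp
      · exact ENNReal.rpow_le_rpow (c2 hQn) (div_nonneg_of_nonpos (by linarith) hQn.le)
      · have hneg : (Q - 1) / Q = -((1 - Q) / Q) := by rw [← neg_div]; ring_nf
        rw [hneg, ENNReal.rpow_neg, ENNReal.rpow_neg, ENNReal.inv_le_inv]
        exact ENNReal.rpow_le_rpow (c1 hQp) (div_nonneg (by linarith) hQp.le)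
  have hB : invEntropy lam μ (fun r => c * v r) ^ (Q - 1)
      = ENNReal.ofReal (F ^ ((1 - Q) / (1 - lam))) := by
    rw [hinv, hvs, ENNReal.ofReal_rpow_of_pos hF0]
  have hprod : momentDev Q μ (weightedTail μ fun r => c * v r) ^ (Q - 1)
      * invEntropy lam μ (fun r => c * v r) ^ (Q - 1)
      = momentDev Q μ (weightedTail μ v) ^ (Q - 1) * invEntropy lam μ v ^ (Q - 1) := by
    rw [hU', momentDev_smul hc0 hne fun h0 => hU (hQ0.1 h0),
      invEntropy_smul hc0 hv0 fun h0 => absurd h0 hl1, ofReal_mul_rpow hc0,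
      ofReal_mul_rpow (inv_pos.2 hc0), mul_mul_mul_comm, ENNReal.ofReal_rpow_of_pos hc0,
      ENNReal.ofReal_rpow_of_pos (inv_pos.2 hc0), ← ENNReal.ofReal_mul (by positivity),
      ← Real.mul_rpow hc0.le (inv_pos.2 hc0).le, mul_inv_cancel₀ hc0.ne', Real.one_rpow,
      ENNReal.ofReal_one, one_mul]
  rw [← hprod, hB, constKappa0_eq hdom h, ENNReal.ofReal_mul]
  · gcongr
  · exact mul_nonneg (by positivity) h.renyiPower_pos.le

theorem constKappa0_pos {p lam : ℝ} (hdom : MirroredDomain p lam) : 0 < constKappa0 p lam := by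
  obtain ⟨hQ1, -, -, hsq, hcl⟩ := hdom.conjExp_facts
  obtain ⟨κ, A, h, -⟩ := isProfile_genGauss hcl
  have hq := hsq.symm.pos
  have h1 := h.renyiPower_pos
  have h2 := (h.deviation_rpow hq.ne').1
  have h3 := h.kappa_pos
  have h4 : 0 < |conjExp p - 1| := abs_pos.2 (by linarith)
  rw [constKappa0, constKappa1, fisherPhi, h.fisherInfo_eq hsq]
  positivity

theorem constK0_pos {p lam : ℝ} (hdom : ClassicalDomain p lam) : 0 < constK0 p lam := by
  obtain ⟨κ, A, h, -⟩ := isProfile_genGauss hdom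
  exact div_pos h.deviation_pos h.renyiPower_pos

/-! The functionals of a density in terms of the upper tail of a weight. -/

theorem measure_tail_fiber (μ : Measure ℝ) [NullSingletonClass μ] [IsProbabilityMeasure μ]
    (τ : ℝ≥0∞) : μ {x | μ (Ioi x) = τ} = 0 := by
  by_contra he
  set e := μ {x | μ (Ioi x) = τ} with hedef
  have hτ1 : τ ≤ 1 := by
    obtain ⟨x, hx⟩ := nonempty_of_measure_ne_zero he
    rw [← show μ (Ioi x) = τ from hx]
    exact prob_le_one
  have hτ : τ ≠ ⊤ := ne_top_of_le_ne_top ENNReal.one_ne_top hτ1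
  have heτ : e ≤ τ := (measure_mono fun x hx => le_of_eq hx).trans (measure_tail_le μ τ)
  have hτ0 : τ ≠ 0 := fun h => he (le_antisymm (h ▸ heτ) bot_le)
  have key : ∀ t < τ, t ≤ τ - e := by
    intro t ht
    refine ENNReal.le_sub_of_add_le_left (ne_top_of_le_ne_top hτ heτ) ?_
    rw [← measure_tail_eq μ (ht.le.trans hτ1), hedef]
    rw [← measure_union]
    · refine (measure_mono ?_).trans (measure_tail_le μ τ)
      rintro x (hx | hx)
      · exact le_of_eq hx
      · exact le_trans (show μ (Ioi x) ≤ t from hx) ht.le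
    · rw [Set.disjoint_left]
      intro x hx hx'
      exact absurd ((show μ (Ioi x) = τ from hx) ▸ (show μ (Ioi x) ≤ t from hx')) (not_le.2 ht)
    · exact measurableSet_le (measurable_tail μ) measurable_const
  exact absurd (le_of_forall_lt_imp_le_of_dense key) (not_le.2 (ENNReal.sub_lt_self hτ hτ0 he))

section Density

variable {f : ℝ → ℝ}

theorem IsDensity.isProbabilityMeasure (hf : IsDensity f) :
    IsProbabilityMeasure (densityMeasure f) := by
  refine ⟨?_⟩
  rw [densityMeasure, withDensity_apply _ MeasurableSet.univ, Measure.restrict_univ, hf.2.2]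

theorem ae_densityMeasure (hf : Measurable f) (hf0 : ∀ x, 0 ≤ f x) {P : ℝ → Prop} :
    (∀ᵐ x ∂densityMeasure f, P x) ↔ ∀ᵐ x, f x ≠ 0 → P x := by
  rw [densityMeasure, ae_withDensity_iff hf.ennreal_ofReal]
  refine eventually_congr (ae_of_all _ fun x => ?_)
  have : ENNReal.ofReal (f x) ≠ 0 ↔ f x ≠ 0 := by
    rw [ne_eq, ENNReal.ofReal_eq_zero, ne_eq, not_iff_not]
    exact ⟨fun h => le_antisymm h (hf0 x), fun h => h.le⟩
  rw [this]

theorem integrable_densityMeasure (hf : Measurable f) (hf0 : ∀ x, 0 ≤ f x) {φ : ℝ → ℝ} :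
    Integrable φ (densityMeasure f) ↔ Integrable fun x => φ x * f x := by
  rw [densityMeasure, integrable_withDensity_iff hf.ennreal_ofReal
    (ae_of_all _ fun x => ENNReal.ofReal_lt_top)]
  simp only [ENNReal.toReal_ofReal (hf0 _)]

theorem integral_densityMeasure (hf : Measurable f) (hf0 : ∀ x, 0 ≤ f x) (φ : ℝ → ℝ) :
    ∫ x, φ x ∂densityMeasure f = ∫ x, φ x * f x := by
  rw [densityMeasure, integral_withDensity_eq_integral_toReal_smul hf.ennreal_ofReal
    (ae_of_all _ fun x => ENNReal.ofReal_lt_top)]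
  simp only [ENNReal.toReal_ofReal (hf0 _), smul_eq_mul, mul_comm]

variable {γ : ℝ}

/-- The set on which the integral in the differential-escort variable converges. -/
def escortDomain (γ : ℝ) (f : ℝ → ℝ) : Set ℝ :=
  {x | IntervalIntegrable (fun t => f t ^ (1 - γ)) volume 0 x}

theorem ordConnected_escortDomain : (escortDomain γ f).OrdConnected := by
  refine ⟨fun a ha b hb z hz => ?_⟩
  rcases le_total 0 z with h0 | h0
  · exact IntervalIntegrable.mono_set hb (by
      rw [uIcc_of_le h0, uIcc_of_le (h0.trans hz.2)]; exact Icc_subset_Icc_right hz.2)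
  · exact IntervalIntegrable.mono_set ha (by
      rw [uIcc_of_ge h0, uIcc_of_ge (hz.1.trans h0)]; exact Icc_subset_Icc_left hz.1)

theorem escortVar_sub {a b : ℝ} (c : ℝ) (ha : a ∈ escortDomain γ f) (hb : b ∈ escortDomain γ f) :
    escortVar γ c f b - escortVar γ c f a = ∫ t in a..b, f t ^ (1 - γ) := by
  rw [escortVar, escortVar, add_sub_add_left_eq_sub]
  exact intervalIntegral.integral_interval_sub_left hb ha

theorem monotoneOn_escortVar (c : ℝ) (hf0 : ∀ x, 0 ≤ f x) :
    MonotoneOn (escortVar γ c f) (escortDomain γ f) := by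
  intro a ha b hb hab
  have h1 := escortVar_sub c ha hb
  have : 0 ≤ ∫ t in a..b, f t ^ (1 - γ) :=
    intervalIntegral.integral_nonneg hab fun t _ => Real.rpow_nonneg (hf0 t) _
  linarith

theorem aemeasurable_escortVar (c : ℝ) (hf : Measurable f) (hf0 : ∀ x, 0 ≤ f x)
    (h : EscortDefined γ f) : AEMeasurable (escortVar γ c f) (densityMeasure f) := by
  have hm := aemeasurable_restrict_of_monotoneOn (μ := densityMeasure f)
    ordConnected_escortDomain.measurableSet (monotoneOn_escortVar (γ := γ) c hf0)
  rwa [Measure.restrict_eq_self_of_ae_mem] at hm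
  exact (ae_densityMeasure hf hf0).2 h

theorem escortVar_ne_zero (c : ℝ) (hf : IsDensity f) (h : EscortDefined γ f) :
    ∀ᵐ x ∂densityMeasure f, escortVar γ c f x ≠ 0 := by
  have := hf.isProbabilityMeasure
  obtain ⟨hfm, hf0, -⟩ := hf
  set μ := densityMeasure f
  have hD : ∀ᵐ x ∂μ, x ∈ escortDomain γ f := (ae_densityMeasure hfm hf0).2 h
  have hconst : ∀ a ∈ escortDomain γ f, ∀ b ∈ escortDomain γ f, escortVar γ c f a = 0 →
      escortVar γ c f b = 0 → a ≤ b → μ (Ioi a) = μ (Ioi b) := by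
    intro a ha b hb ha0 hb0 hab
    have h1 := escortVar_sub c ha hb
    rw [ha0, hb0, sub_zero, intervalIntegral.integral_of_le hab] at h1
    have hi : IntegrableOn (fun t => f t ^ (1 - γ)) (Ioc a b) :=
      ((intervalIntegrable_iff_integrableOn_Ioc_of_le hab).1
        (IntervalIntegrable.trans (IntervalIntegrable.symm ha) hb))
    have h2 := (setIntegral_eq_zero_iff_of_nonneg_ae
      (ae_of_all _ fun t => Real.rpow_nonneg (hf0 t) _) hi).1 h1.symm
    have h3 : densityMeasure f (Ioc a b) = 0 := by
      rw [densityMeasure, withDensity_apply_eq_zero hfm.ennreal_ofReal]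
      have h4 : ∀ᵐ t, t ∈ Ioc a b → f t = 0 := by
        rw [← ae_restrict_iff' measurableSet_Ioc]
        filter_upwards [h2] with t ht
        exact ((Real.rpow_eq_zero_iff_of_nonneg (hf0 t)).1 ht).1
      refine measure_mono_null ?_ (ae_iff.1 h4)
      rintro t ⟨ht1, ht2⟩ hc
      exact ht1 (by simp [hc ht2])
    rw [← Ioc_union_Ioi_eq_Ioi hab, measure_union (by
      rw [Set.disjoint_left]; intro z hz hz'; exact absurd hz.2 (not_le.2 hz')) measurableSet_Ioi,
      h3, zero_add]
  have hZ : μ {x | x ∈ escortDomain γ f ∧ escortVar γ c f x = 0} = 0 := by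
    rcases Set.eq_empty_or_nonempty {x | x ∈ escortDomain γ f ∧ escortVar γ c f x = 0} with
      he | ⟨z, hz1, hz2⟩
    · rw [he, measure_empty]
    · refine measure_mono_null ?_ (measure_tail_fiber μ (μ (Ioi z)))
      rintro x ⟨hx1, hx2⟩
      rcases le_total x z with hxz | hxz
      · exact hconst x hx1 z hz1 hx2 hz2 hxz
      · exact (hconst z hz1 x hx1 hz2 hx2 hxz).symm
  filter_upwards [hD, measure_eq_zero_iff_ae_notMem.1 hZ] with x h1 h2 h3
  exact h2 ⟨h1, h3⟩

end Density

/-- The reciprocal of the density of the variable whose moments are the cumulative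
upper-moments. -/
def escortWeight (α β c : ℝ) (f : ℝ → ℝ) (x : ℝ) : ℝ :=
  |(α - 2 * β) / β| ^ (β / (α - 2 * β)) * |escortVar (1 / β) c f x| ^ (β / (α - 2 * β))

section Reduction

variable {α β c : ℝ} {f : ℝ → ℝ}

theorem scale_pos (hαβ : α ≠ 2 * β) (hβ : β ≠ 0) :
    0 < |(α - 2 * β) / β| ^ (β / (α - 2 * β)) :=
  Real.rpow_pos_of_pos (abs_pos.2 (div_ne_zero (sub_ne_zero.2 hαβ) hβ)) _

theorem aemeasurable_escortWeight (hf : IsDensity f) (h : EscortDefined (1 / β) f) :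
    AEMeasurable (escortWeight α β c f) (densityMeasure f) := by
  have h1 := aemeasurable_escortVar c hf.1 hf.2.1 h
  have h2 : Measurable fun y : ℝ => |y| ^ (β / (α - 2 * β)) :=
    (continuous_abs.measurable).pow_const _
  exact (h2.comp_aemeasurable h1).const_mul _

theorem escortWeight_pos (hαβ : α ≠ 2 * β) (hβ : β ≠ 0) (hf : IsDensity f)
    (h : EscortDefined (1 / β) f) : ∀ᵐ x ∂densityMeasure f, 0 < escortWeight α β c f x := by
  filter_upwards [escortVar_ne_zero c hf h] with x hx
  exact mul_pos (scale_pos hαβ hβ) (Real.rpow_pos_of_pos (abs_pos.2 hx) _)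

theorem log_escortWeight (hαβ : α ≠ 2 * β) (hβ : β ≠ 0) {x : ℝ}
    (hx : escortVar (1 / β) c f x ≠ 0) :
    Real.log (escortWeight α β c f x) = Real.log (|(α - 2 * β) / β| ^ (β / (α - 2 * β)))
      + β / (α - 2 * β) * Real.log |escortVar (1 / β) c f x| := by
  rw [escortWeight, Real.log_mul (scale_pos hαβ hβ).ne'
    (Real.rpow_pos_of_pos (abs_pos.2 hx) _).ne', Real.log_rpow (abs_pos.2 hx)]

theorem integrable_log_escortWeight (hαβ : α ≠ 2 * β) (hβ : β ≠ 0) (hf : IsDensity f)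
    (h : EscortDefined (1 / β) f)
    (hi : Integrable fun x => Real.log |escortVar (1 / β) c f x| * f x) :
    Integrable (fun x => Real.log (escortWeight α β c f x)) (densityMeasure f) ∧
      ∫ x, Real.log (escortWeight α β c f x) ∂densityMeasure f
        = Real.log (|(α - 2 * β) / β| ^ (β / (α - 2 * β)))
          + β / (α - 2 * β) * ∫ x, Real.log |escortVar (1 / β) c f x| * f x := by
  have := hf.isProbabilityMeasure
  have hi' := (integrable_densityMeasure hf.1 hf.2.1).2 hi
  have he : (fun x => Real.log (escortWeight α β c f x)) =ᵐ[densityMeasure f]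
      fun x => Real.log (|(α - 2 * β) / β| ^ (β / (α - 2 * β)))
      + β / (α - 2 * β) * Real.log |escortVar (1 / β) c f x| := by
    filter_upwards [escortVar_ne_zero c hf h] with x hx using log_escortWeight hαβ hβ hx
  constructor
  · exact ((integrable_const _).add (hi'.const_mul _)).congr he.symm
  · rw [integral_congr_ae he, integral_add (integrable_const _) (hi'.const_mul _),
      integral_const_mul, integral_const, probReal_univ, one_smul,
      integral_densityMeasure hf.1 hf.2.1]

theorem weightedTail_escortWeight (hαβ : α ≠ 2 * β) (hβ : β ≠ 0) (hf : IsDensity f) (x : ℝ) :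
    weightedTail (densityMeasure f) (escortWeight α β c f) x
      = ENNReal.ofReal (|(α - 2 * β) / β| ^ (β / (α - 2 * β))) * upperTail α β c f x := by
  have hk := scale_pos hαβ hβ
  rw [weightedTail, densityMeasure, restrict_withDensity measurableSet_Ioi,
    lintegral_withDensity_eq_lintegral_mul_non_measurable _ hf.1.ennreal_ofReal
      (ae_of_all _ fun x => ENNReal.ofReal_lt_top), upperTail,
    ← lintegral_const_mul' _ _ ENNReal.ofReal_ne_top]
  refine lintegral_congr fun r => ?_
  have hy : 0 ≤ |escortVar (1 / β) c f r| ^ (β / (α - 2 * β)) :=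
    Real.rpow_nonneg (abs_nonneg _) _
  rw [Pi.mul_apply, escortWeight, ENNReal.ofReal_mul hk.le, ENNReal.ofReal_mul hy]
  ring

theorem momentDev_escortWeight (hαβ : α ≠ 2 * β) (hβ : β ≠ 0) (hf : IsDensity f) (q : ℝ) :
    momentDev q (densityMeasure f) (weightedTail (densityMeasure f) (escortWeight α β c f))
      = upperDeviation q α β c f := by
  have hk := scale_pos hαβ hβ
  have hU := funext (weightedTail_escortWeight (c := c) hαβ hβ hf)
  rw [hU, momentDev, upperDeviation]
  split_ifs with hq
  · rw [integral_densityMeasure hf.1 hf.2.1]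
    simp only [logUpper, ENNReal.toReal_mul, ENNReal.toReal_ofReal hk.le]
  · congr 1
    rw [upperMoment, lintegral_densityMeasure hf.1,
      ← lintegral_const_mul' _ _ ENNReal.ofReal_ne_top]
    refine lintegral_congr fun x => ?_
    rw [ofReal_mul_rpow hk, ENNReal.ofReal_rpow_of_pos hk, ← Real.rpow_mul (abs_nonneg _),
      mul_comm (β / (α - 2 * β)) q, ← mul_div_assoc]
    ring

theorem invEntropy_escortWeight (hαβ : α ≠ 2 * β) (hβ : β ≠ 0) (hf : IsDensity f)
    (h : EscortDefined (1 / β) f) {lam : ℝ}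
    (hi : lam = 1 → Integrable fun x => Real.log |escortVar (1 / β) c f x| * f x) :
    cumDeviation (cumOrder α β lam) (1 / β) c f ^ (1 / (2 * β - α))
      = ENNReal.ofReal (|(α - 2 * β) / β| ^ (β / (α - 2 * β)))
        * invEntropy lam (densityMeasure f) (escortWeight α β c f) := by
  have hk := scale_pos hαβ hβ
  set k := |(α - 2 * β) / β| ^ (β / (α - 2 * β)) with hkdef
  have h1 : α - 2 * β ≠ 0 := sub_ne_zero.2 hαβ
  have h2 : 2 * β - α ≠ 0 := sub_ne_zero.2 hαβ.symm
  by_cases hl : lam = 1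
  · have hr : cumOrder α β lam = 0 := by simp [cumOrder, hl]
    rw [cumDeviation, if_pos hr, invEntropy, if_pos hl,
      ENNReal.ofReal_rpow_of_pos (Real.exp_pos _), ← Real.exp_mul,
      (integrable_log_escortWeight hαβ hβ hf h (hi hl)).2, ← hkdef, ← ENNReal.ofReal_mul hk.le,
      neg_add, Real.exp_add, Real.exp_neg, Real.exp_log hk, mul_inv_cancel_left₀ hk.ne']
    congr 2
    rw [← neg_sub α (2 * β)]
    field_simp
  · have hl' : lam - 1 ≠ 0 := sub_ne_zero.2 hl
    have hr : cumOrder α β lam ≠ 0 := div_ne_zero (mul_ne_zero hβ hl') h2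
    have hexp : 1 / (cumOrder α β lam * (1 / β)) * (1 / (2 * β - α)) = 1 / (lam - 1) := by
      rw [cumOrder]
      generalize 2 * β - α = d at h2
      field_simp
    have hX : ∫⁻ x, ENNReal.ofReal (escortWeight α β c f x ^ (1 - lam)) ∂densityMeasure f
        = ENNReal.ofReal (k ^ (1 - lam)) * cumMoment (cumOrder α β lam) (1 / β) c f := by
      rw [lintegral_densityMeasure hf.1, cumMoment,
        ← lintegral_const_mul' _ _ ENNReal.ofReal_ne_top]
      refine lintegral_congr fun x => ?_
      rw [escortWeight, ← hkdef, Real.mul_rpow hk.le (Real.rpow_nonneg (abs_nonneg _) _),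
        ← Real.rpow_mul (abs_nonneg (escortVar (1 / β) c f x)), ← ENNReal.ofReal_mul (hf.2.1 x),
        ← ENNReal.ofReal_mul (Real.rpow_nonneg hk.le _)]
      congr 1
      have : β / (α - 2 * β) * (1 - lam) = cumOrder α β lam := by
        rw [cumOrder, ← neg_sub α (2 * β)]; field_simp; ring
      rw [this]; ring
    rw [cumDeviation, if_neg hr, invEntropy, if_neg hl, hX, ← ENNReal.rpow_mul, hexp,
      ofReal_mul_rpow (Real.rpow_pos_of_pos hk _),
      ENNReal.ofReal_rpow_of_pos (Real.rpow_pos_of_pos hk _), ← Real.rpow_mul hk.le, ← mul_assoc,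
      ← ENNReal.ofReal_mul hk.le]
    have : (1 - lam) * (1 / (lam - 1)) = -1 := by field_simp; ring
    rw [this, Real.rpow_neg_one, mul_inv_cancel₀ hk.ne', ENNReal.ofReal_one, one_mul]

theorem Admissible.tail_finite {p lam : ℝ} (hαβ : α ≠ 2 * β) (hβ : β ≠ 0)
    (h : Admissible p lam α β c f) (hp : p = 0) :
    (∀ᵐ x ∂densityMeasure f,
      weightedTail (densityMeasure f) (escortWeight α β c f) x ≠ ⊤) ∧
    Integrable (fun x => Real.log
      (weightedTail (densityMeasure f) (escortWeight α β c f) x).toReal) (densityMeasure f) := by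
  obtain ⟨hf, -, -, h4⟩ := h
  have hk := scale_pos hαβ hβ
  obtain ⟨h5, h6⟩ := h4 hp
  simp only [weightedTail_escortWeight hαβ hβ hf]
  constructor
  · filter_upwards [(ae_densityMeasure hf.1 hf.2.1).2 h5] with x hx
    exact ENNReal.mul_ne_top ENNReal.ofReal_ne_top hx
  · rw [integrable_densityMeasure hf.1 hf.2.1]
    simpa only [logUpper, ENNReal.toReal_mul, ENNReal.toReal_ofReal hk.le] using h6

theorem abs_ratio_eq (α β : ℝ) : |(2 * β - α) / β| = |(α - 2 * β) / β| := by
  rw [← neg_sub, neg_div, abs_neg]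

/-- The lower bound for the product of the upper deviation and the cumulative deviation. -/
theorem classical_inequality {p lam : ℝ} (hαβ : α ≠ 2 * β) (hβ : β ≠ 0)
    (hdom : ClassicalDomain p lam) (h : Admissible p lam α β c f)
    (hdet : Determinate (upperDeviation (conjExp p) α β c f)
      (cumDeviation (cumOrder α β lam) (1 / β) c f ^ (1 / (2 * β - α)))) :
    ENNReal.ofReal (|(2 * β - α) / β| ^ (β / (α - 2 * β)) * constK0 p lam) ≤
      upperDeviation (conjExp p) α β c f *
        cumDeviation (cumOrder α β lam) (1 / β) c f ^ (1 / (2 * β - α)) := by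
  have hk := scale_pos hαβ hβ
  have hf := h.1
  have := hf.isProbabilityMeasure
  rw [invEntropy_escortWeight hαβ hβ hf h.2.1 h.2.2.1, ← momentDev_escortWeight hαβ hβ hf] at hdet ⊢
  rw [abs_ratio_eq, ENNReal.ofReal_mul hk.le, mul_left_comm]
  gcongr
  refine constK0_le hdom (aemeasurable_escortWeight hf h.2.1) (escortWeight_pos hαβ hβ hf h.2.1)
    (fun hl => (integrable_log_escortWeight hαβ hβ hf h.2.1 (h.2.2.1 hl)).1)
    (h.tail_finite hαβ hβ) fun ht h0 => hdet.2 ht ?_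
  rw [h0, mul_zero]

/-- The lower bound for the mirrored product. -/
theorem mirrored_inequality {p lam : ℝ} (hαβ : α ≠ 2 * β) (hβ : β ≠ 0)
    (hdom : MirroredDomain p lam) (h : Admissible p lam α β c f)
    (hdet : Determinate (upperDeviation (conjExp p) α β c f ^ (conjExp p - 1))
      (cumDeviation (cumOrder α β lam) (1 / β) c f ^ ((conjExp p - 1) / (2 * β - α)))) :
    ENNReal.ofReal (|(2 * β - α) / β| ^ (β * (conjExp p - 1) / (α - 2 * β)) *
        constKappa0 p lam) ≤
      upperDeviation (conjExp p) α β c f ^ (conjExp p - 1) *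
        cumDeviation (cumOrder α β lam) (1 / β) c f ^ ((conjExp p - 1) / (2 * β - α)) := by
  have hk := scale_pos hαβ hβ
  have hf := h.1
  have := hf.isProbabilityMeasure
  have e1 : (conjExp p - 1) / (2 * β - α) = 1 / (2 * β - α) * (conjExp p - 1) := by ring
  have e2 : β * (conjExp p - 1) / (α - 2 * β) = β / (α - 2 * β) * (conjExp p - 1) := by ring
  rw [e1, ENNReal.rpow_mul, invEntropy_escortWeight hαβ hβ hf h.2.1 h.2.2.1,
    ← momentDev_escortWeight hαβ hβ hf, ofReal_mul_rpow hk] at hdet ⊢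
  rw [abs_ratio_eq, e2, Real.rpow_mul (abs_nonneg _), ENNReal.ofReal_mul (by positivity),
    ← ENNReal.ofReal_rpow_of_pos hk, mul_left_comm]
  gcongr
  refine constKappa0_le hdom (aemeasurable_escortWeight hf h.2.1)
    (escortWeight_pos hαβ hβ hf h.2.1) (h.tail_finite hαβ hβ) fun ht h0 => hdet.1 h0 ?_
  rw [ht, ENNReal.mul_top (ofReal_rpow_ne_zero hk _)]

end Reduction

/-! Down transforms of densities on an interval with left end `0`. -/

/-- A density with continuous derivative of constant sign on an interval with left end `0`; the
sign is `-ε`. -/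
structure IsMonotoneDensity (ε : ℝ) (g : ℝ → ℝ) : Prop where
  isDensity : IsDensity g
  isOpen : IsOpen (Function.support g)
  pos_of_mem : ∀ x ∈ Function.support g, 0 < x
  mem_of_le : ∀ x ∈ Function.support g, ∀ y, 0 < y → y ≤ x → y ∈ Function.support g
  differentiableAt : ∀ x ∈ Function.support g, DifferentiableAt ℝ g x
  continuousOn_deriv : ContinuousOn (deriv g) (Function.support g)
  deriv_ne_zero : ∀ x ∈ Function.support g, deriv g x ≠ 0
  abs_deriv : ∀ x ∈ Function.support g, |deriv g x| = -ε * deriv g x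
  abs_eps : |ε| = 1

/-- The derivative, up to sign, of the change of variable of the down transformation. -/
def downJac (α β : ℝ) (g : ℝ → ℝ) (x : ℝ) : ℝ := g x ^ (1 - α) * |deriv g x| ^ β

/-- The down transform of `g` for the change of variable `s`. -/
def downFun (α β : ℝ) (g s : ℝ → ℝ) (y : ℝ) : ℝ :=
  open Classical in
  if y ∈ s '' Function.support g then
    g (Function.invFunOn s (Function.support g) y) ^ α /
      |deriv g (Function.invFunOn s (Function.support g) y)| ^ β
  else 0

namespace IsMonotoneDensity

variable {ε α β : ℝ} {g s : ℝ → ℝ}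

theorem pos (h : IsMonotoneDensity ε g) {x : ℝ} (hx : x ∈ Function.support g) : 0 < g x :=
  lt_of_le_of_ne (h.isDensity.2.1 x) (Ne.symm hx)

theorem ordConnected (h : IsMonotoneDensity ε g) : (Function.support g).OrdConnected :=
  ⟨fun x hx y hy z hz => h.mem_of_le y hy z ((h.pos_of_mem x hx).trans_le hz.1) hz.2⟩

theorem nonempty (h : IsMonotoneDensity ε g) : (Function.support g).Nonempty := by
  by_contra hc
  rw [not_nonempty_iff_eq_empty, Function.support_eq_empty_iff] at hc
  have := h.isDensity.2.2
  simp [hc] at this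

theorem abs_deriv_pos (h : IsMonotoneDensity ε g) {x : ℝ} (hx : x ∈ Function.support g) :
    0 < |deriv g x| := abs_pos.2 (h.deriv_ne_zero x hx)

theorem downJac_pos (h : IsMonotoneDensity ε g) {x : ℝ} (hx : x ∈ Function.support g) :
    0 < downJac α β g x :=
  mul_pos (Real.rpow_pos_of_pos (h.pos hx) _) (Real.rpow_pos_of_pos (h.abs_deriv_pos hx) _)

theorem continuousOn_downJac (h : IsMonotoneDensity ε g) :
    ContinuousOn (downJac α β g) (Function.support g) := by
  refine ContinuousOn.mul ?_ ?_
  · exact ContinuousOn.rpow_const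
      (fun x hx => (h.differentiableAt x hx).continuousAt.continuousWithinAt)
      fun x hx => Or.inl (h.pos hx).ne'
  · exact h.continuousOn_deriv.abs.rpow_const fun x hx => Or.inl (h.abs_deriv_pos hx).ne'

theorem strictAntiOn (h : IsMonotoneDensity ε g)
    (hs : ∀ x ∈ Function.support g, HasDerivAt s (-downJac α β g x) x) :
    StrictAntiOn s (Function.support g) := by
  refine strictAntiOn_of_deriv_neg h.ordConnected.convex
    (fun x hx => (hs x hx).continuousAt.continuousWithinAt) fun x hx => ?_
  rw [h.isOpen.interior_eq] at hx
  rw [(hs x hx).deriv]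
  exact neg_neg_of_pos (h.downJac_pos hx)

theorem downFun_apply (h : IsMonotoneDensity ε g)
    (hs : ∀ x ∈ Function.support g, HasDerivAt s (-downJac α β g x) x) {x : ℝ}
    (hx : x ∈ Function.support g) : downFun α β g s (s x) = g x ^ α / |deriv g x| ^ β := by
  rw [downFun, if_pos (mem_image_of_mem s hx), (h.strictAntiOn hs).injOn.leftInvOn_invFunOn hx]

theorem downFun_of_notMem {y : ℝ} (hy : y ∉ s '' Function.support g) :
    downFun α β g s y = 0 := if_neg hy

theorem isDownTransform (h : IsMonotoneDensity ε g)
    (hs : ∀ x ∈ Function.support g, HasDerivAt s (-downJac α β g x) x) :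
    IsDownTransform α β g (downFun α β g s) :=
  ⟨h.isOpen, h.ordConnected,
    fun x hx => ⟨h.pos hx, h.differentiableAt x hx, h.deriv_ne_zero x hx⟩, s, hs,
    fun _ hx => h.downFun_apply hs hx, fun _ hy => downFun_of_notMem hy⟩

theorem downFun_pos (h : IsMonotoneDensity ε g)
    (hs : ∀ x ∈ Function.support g, HasDerivAt s (-downJac α β g x) x) {x : ℝ}
    (hx : x ∈ Function.support g) : 0 < downFun α β g s (s x) := by
  rw [h.downFun_apply hs hx]
  exact div_pos (Real.rpow_pos_of_pos (h.pos hx) _)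
    (Real.rpow_pos_of_pos (h.abs_deriv_pos hx) _)

theorem support_downFun (h : IsMonotoneDensity ε g)
    (hs : ∀ x ∈ Function.support g, HasDerivAt s (-downJac α β g x) x) :
    Function.support (downFun α β g s) = s '' Function.support g := by
  ext y
  constructor
  · intro hy
    by_contra hc
    exact hy (downFun_of_notMem hc)
  · rintro ⟨x, hx, rfl⟩
    exact (h.downFun_pos hs hx).ne'

theorem downFun_nonneg (h : IsMonotoneDensity ε g)
    (hs : ∀ x ∈ Function.support g, HasDerivAt s (-downJac α β g x) x) (y : ℝ) :
    0 ≤ downFun α β g s y := by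
  by_cases hy : y ∈ s '' Function.support g
  · obtain ⟨x, hx, rfl⟩ := hy
    exact (h.downFun_pos hs hx).le
  · rw [downFun_of_notMem hy]

theorem continuousOn_of_hasDerivAt
    (hs : ∀ x ∈ Function.support g, HasDerivAt s (-downJac α β g x) x) :
    ContinuousOn s (Function.support g) :=
  fun x hx => (hs x hx).continuousAt.continuousWithinAt

theorem measurableSet_image (h : IsMonotoneDensity ε g)
    (hs : ∀ x ∈ Function.support g, HasDerivAt s (-downJac α β g x) x) {B : Set ℝ}
    (hB : MeasurableSet B) : MeasurableSet (s '' (Function.support g ∩ B)) :=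
  (h.isOpen.measurableSet.inter hB).image_of_continuousOn_injOn
    ((continuousOn_of_hasDerivAt hs).mono inter_subset_left)
    ((h.strictAntiOn hs).injOn.mono inter_subset_left)

theorem measurable_downFun (h : IsMonotoneDensity ε g)
    (hs : ∀ x ∈ Function.support g, HasDerivAt s (-downJac α β g x) x) :
    Measurable (downFun α β g s) := by
  have hF : Measurable fun x => g x ^ α / |deriv g x| ^ β :=
    (h.isDensity.1.pow_const α).div
      ((continuous_abs.measurable.comp (measurable_deriv g)).pow_const β)
  have hI : MeasurableSet (s '' Function.support g) := by
    simpa using h.measurableSet_image hs MeasurableSet.univ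
  intro B hB
  have e : downFun α β g s ⁻¹' B
      = s '' (Function.support g ∩ (fun x => g x ^ α / |deriv g x| ^ β) ⁻¹' B)
        ∪ ((s '' Function.support g)ᶜ ∩ {_y | (0 : ℝ) ∈ B}) := by
    ext y
    by_cases hy : y ∈ s '' Function.support g
    · obtain ⟨x, hx, rfl⟩ := hy
      have hinj := (h.strictAntiOn hs).injOn
      simp only [mem_preimage, h.downFun_apply hs hx, mem_union, mem_inter_iff, mem_compl_iff,
        mem_image_of_mem s hx, not_true_eq_false, false_and, or_false]
      constructor
      · exact fun hb => ⟨x, ⟨hx, hb⟩, rfl⟩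
      · rintro ⟨x', ⟨hx', hb⟩, he⟩
        rw [hinj hx' hx he] at hb
        exact hb
    · have : y ∉ s '' (Function.support g ∩ (fun x => g x ^ α / |deriv g x| ^ β) ⁻¹' B) :=
        fun hc => hy (image_mono inter_subset_left hc)
      simp only [mem_preimage, downFun_of_notMem hy, mem_union, this, false_or, mem_inter_iff,
        mem_compl_iff, hy, not_false_eq_true, true_and, mem_ofPred_eq]
  rw [e]
  exact (h.measurableSet_image hs (hF hB)).union (hI.compl.inter (MeasurableSet.const _))

theorem downFun_mul_downJac (h : IsMonotoneDensity ε g)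
    (hs : ∀ x ∈ Function.support g, HasDerivAt s (-downJac α β g x) x) {x : ℝ}
    (hx : x ∈ Function.support g) : downJac α β g x * downFun α β g s (s x) = g x := by
  have hg := h.pos hx
  have hd := Real.rpow_pos_of_pos (h.abs_deriv_pos hx) β
  rw [h.downFun_apply hs hx, downJac, Real.rpow_sub hg, Real.rpow_one]
  have := Real.rpow_pos_of_pos hg α
  field_simp

theorem lintegral_downFun (h : IsMonotoneDensity ε g)
    (hs : ∀ x ∈ Function.support g, HasDerivAt s (-downJac α β g x) x) (Φ : ℝ → ℝ≥0∞) :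
    ∫⁻ y, Φ y ∂densityMeasure (downFun α β g s) = ∫⁻ x, Φ (s x) ∂densityMeasure g := by
  rw [lintegral_densityMeasure (h.measurable_downFun hs), lintegral_densityMeasure h.isDensity.1]
  have e1 : ∫⁻ y, ENNReal.ofReal (downFun α β g s y) * Φ y
      = ∫⁻ y in s '' Function.support g, ENNReal.ofReal (downFun α β g s y) * Φ y := by
    rw [setLIntegral_eq_of_support_subset]
    intro y hy
    by_contra hc
    exact hy (by simp [downFun_of_notMem hc])
  have e2 : ∫⁻ x, ENNReal.ofReal (g x) * Φ (s x)
      = ∫⁻ x in Function.support g, ENNReal.ofReal (g x) * Φ (s x) := by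
    rw [setLIntegral_eq_of_support_subset]
    intro x hx
    by_contra hc
    exact hx (by simp [Function.notMem_support.1 hc])
  rw [e1, e2, lintegral_image_eq_lintegral_abs_deriv_mul h.isOpen.measurableSet
    (fun x hx => (hs x hx).hasDerivWithinAt) (h.strictAntiOn hs).injOn]
  refine setLIntegral_congr_fun h.isOpen.measurableSet fun x hx => ?_
  rw [← mul_assoc, ← ENNReal.ofReal_mul (abs_nonneg _), abs_neg, abs_of_pos (h.downJac_pos hx),
    h.downFun_mul_downJac hs hx]

theorem integrable_downFun (h : IsMonotoneDensity ε g)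
    (hs : ∀ x ∈ Function.support g, HasDerivAt s (-downJac α β g x) x) (φ : ℝ → ℝ) :
    (Integrable φ (densityMeasure (downFun α β g s)) ↔
      Integrable (fun x => φ (s x)) (densityMeasure g)) ∧
    ∫ y, φ y ∂densityMeasure (downFun α β g s) = ∫ x, φ (s x) ∂densityMeasure g := by
  rw [integrable_densityMeasure (h.measurable_downFun hs) (h.downFun_nonneg hs),
    integral_densityMeasure (h.measurable_downFun hs) (h.downFun_nonneg hs),
    integrable_densityMeasure h.isDensity.1 h.isDensity.2.1,
    integral_densityMeasure h.isDensity.1 h.isDensity.2.1]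
  have hz1 : ∀ y, y ∉ s '' Function.support g → φ y * downFun α β g s y = 0 := fun y hy => by
    rw [downFun_of_notMem hy, mul_zero]
  have hz2 : ∀ x, x ∉ Function.support g → φ (s x) * g x = 0 := fun x hx => by
    rw [Function.notMem_support.1 hx, mul_zero]
  have hc : ∀ x ∈ Function.support g,
      |(-downJac α β g x)| • (φ (s x) * downFun α β g s (s x)) = φ (s x) * g x := by
    intro x hx
    rw [abs_neg, abs_of_pos (h.downJac_pos hx), smul_eq_mul, mul_left_comm,
      h.downFun_mul_downJac hs hx]
  have hd : ∀ x ∈ Function.support g,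
      HasDerivWithinAt s (-downJac α β g x) (Function.support g) x :=
    fun x hx => (hs x hx).hasDerivWithinAt
  have hinj := (h.strictAntiOn hs).injOn
  constructor
  · rw [← integrableOn_iff_integrable_of_support_subset (s := s '' Function.support g)
      (fun y hy => by by_contra hc'; exact hy (hz1 y hc')),
      integrableOn_image_iff_integrableOn_abs_deriv_smul h.isOpen.measurableSet hd hinj,
      ← integrableOn_iff_integrable_of_support_subset (s := Function.support g)
      (fun x hx => by by_contra hc'; exact hx (hz2 x hc'))]
    exact integrableOn_congr_fun hc h.isOpen.measurableSet
  · rw [← setIntegral_eq_integral_of_forall_compl_eq_zero hz1,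
      ← setIntegral_eq_integral_of_forall_compl_eq_zero hz2,
      integral_image_eq_integral_abs_deriv_smul h.isOpen.measurableSet hd hinj]
    exact setIntegral_congr_fun h.isOpen.measurableSet hc

theorem isDensity_downFun (h : IsMonotoneDensity ε g)
    (hs : ∀ x ∈ Function.support g, HasDerivAt s (-downJac α β g x) x) :
    IsDensity (downFun α β g s) := by
  refine ⟨h.measurable_downFun hs, h.downFun_nonneg hs, ?_⟩
  have := h.lintegral_downFun hs fun _ => 1
  rw [lintegral_densityMeasure (h.measurable_downFun hs),
    lintegral_densityMeasure h.isDensity.1] at this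
  simpa [h.isDensity.2.2] using this

theorem ae_downFun (h : IsMonotoneDensity ε g)
    (hs : ∀ x ∈ Function.support g, HasDerivAt s (-downJac α β g x) x) {P : ℝ → Prop}
    (hP : ∀ x ∈ Function.support g, P (s x)) : ∀ᵐ y, downFun α β g s y ≠ 0 → P y := by
  refine ae_of_all _ fun y hy => ?_
  have : y ∈ Function.support (downFun α β g s) := hy
  rw [h.support_downFun hs] at this
  obtain ⟨x, hx, rfl⟩ := this
  exact hP x hx

/-- The escort integral between two values of the change of variable. -/
theorem integral_escort_downFun (h : IsMonotoneDensity ε g) (hαβ : α ≠ 2 * β) (hβ : β ≠ 0)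
    (hs : ∀ x ∈ Function.support g, HasDerivAt s (-downJac α β g x) x) {a b : ℝ} (hab : a < b)
    (hI : Ioo a b ⊆ Function.support g) (hsc : ContinuousOn s (Icc a b))
    (hgc : ContinuousOn (fun x => g x ^ ((2 * β - α) / β)) (Icc a b)) :
    IntervalIntegrable (fun t => downFun α β g s t ^ (1 - 1 / β)) volume (s b) (s a) ∧
      ∫ t in s b..s a, downFun α β g s t ^ (1 - 1 / β)
        = ε * (g a ^ ((2 * β - α) / β) - g b ^ ((2 * β - α) / β)) / ((2 * β - α) / β) := by
  set δ := (2 * β - α) / β with hδ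
  have hδ0 : δ ≠ 0 := div_ne_zero (sub_ne_zero.2 hαβ.symm) hβ
  have hanti : StrictAntiOn s (Icc a b) := by
    refine strictAntiOn_of_deriv_neg (convex_Icc a b) hsc fun x hx => ?_
    rw [interior_Icc] at hx
    rw [(hs x (hI hx)).deriv]
    exact neg_neg_of_pos (h.downJac_pos (hI hx))
  have hsab : s b < s a := hanti (left_mem_Icc.2 hab.le) (right_mem_Icc.2 hab.le) hab
  have himg : s '' Ioo a b = Ioo (s b) (s a) := by
    refine Subset.antisymm ?_ (intermediate_value_Ioo' hab.le hsc)
    rintro _ ⟨x, hx, rfl⟩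
    exact ⟨hanti (Ioo_subset_Icc_self hx) (right_mem_Icc.2 hab.le) hx.2,
      hanti (left_mem_Icc.2 hab.le) (Ioo_subset_Icc_self hx) hx.1⟩
  have hd : ∀ x ∈ Ioo a b, HasDerivWithinAt s (-downJac α β g x) (Ioo a b) x :=
    fun x hx => (hs x (hI hx)).hasDerivWithinAt
  have hinj := (hanti.mono Ioo_subset_Icc_self).injOn
  have hP : ∀ x ∈ Ioo a b, HasDerivAt (fun x => -ε * g x ^ δ / δ)
      (g x ^ (δ - 1) * |deriv g x|) x := by
    intro x hx
    have hg := h.pos (hI hx)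
    have h1 := ((((h.differentiableAt x (hI hx)).hasDerivAt.rpow_const (p := δ)
      (Or.inl hg.ne')).const_mul (-ε)).div_const δ)
    refine h1.congr_deriv ?_
    rw [h.abs_deriv x (hI hx)]
    field_simp
  have hPpos : ∀ x ∈ Ioo a b, 0 ≤ g x ^ (δ - 1) * |deriv g x| := fun x hx =>
    mul_nonneg (Real.rpow_nonneg (h.isDensity.2.1 x) _) (abs_nonneg _)
  have hPc : ContinuousOn (fun x => -ε * g x ^ δ / δ) (Icc a b) :=
    (continuousOn_const.mul hgc).div_const δ
  have hPi := intervalIntegral.integrableOn_deriv_of_nonneg hPc hP hPpos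
  have hc : ∀ x ∈ Ioo a b, |(-downJac α β g x)| • downFun α β g s (s x) ^ (1 - 1 / β)
      = g x ^ (δ - 1) * |deriv g x| := by
    intro x hx
    have hg := h.pos (hI hx)
    have hd := h.abs_deriv_pos (hI hx)
    rw [abs_neg, abs_of_pos (h.downJac_pos (hI hx)), smul_eq_mul, h.downFun_apply hs (hI hx),
      downJac, Real.div_rpow (by positivity) (by positivity), ← Real.rpow_mul hg.le,
      ← Real.rpow_mul hd.le]
    rw [mul_div_assoc', mul_right_comm, ← Real.rpow_add hg, mul_div_assoc, ← Real.rpow_sub hd]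
    congr 1
    · congr 1
      rw [hδ]; field_simp; ring
    · rw [show β - β * (1 - 1 / β) = 1 by field_simp; ring, Real.rpow_one]
  have i1 : IntegrableOn (fun t => downFun α β g s t ^ (1 - 1 / β)) (Ioo (s b) (s a)) := by
    rw [← himg, integrableOn_image_iff_integrableOn_abs_deriv_smul measurableSet_Ioo hd hinj,
      integrableOn_congr_fun hc measurableSet_Ioo]
    exact IntegrableOn.mono_set hPi Ioo_subset_Ioc_self
  refine ⟨?_, ?_⟩
  · rwa [intervalIntegrable_iff_integrableOn_Ioo_of_le hsab.le]
  · rw [intervalIntegral.integral_of_le hsab.le, integral_Ioc_eq_integral_Ioo, ← himg,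
      integral_image_eq_integral_abs_deriv_smul measurableSet_Ioo hd hinj,
      setIntegral_congr_fun measurableSet_Ioo hc, ← integral_Ioc_eq_integral_Ioo,
      ← intervalIntegral.integral_of_le hab.le,
      intervalIntegral.integral_eq_sub_of_hasDerivAt_of_le hab.le hPc hP
        ((intervalIntegrable_iff_integrableOn_Ioc_of_le hab.le).2 hPi)]
    ring

theorem escort_between (h : IsMonotoneDensity ε g) (hαβ : α ≠ 2 * β) (hβ : β ≠ 0)
    (hs : ∀ x ∈ Function.support g, HasDerivAt s (-downJac α β g x) x) {a b : ℝ}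
    (ha : a ∈ Function.support g) (hb : b ∈ Function.support g) :
    IntervalIntegrable (fun t => downFun α β g s t ^ (1 - 1 / β)) volume (s b) (s a) ∧
      ∫ t in s b..s a, downFun α β g s t ^ (1 - 1 / β)
        = ε * (g a ^ ((2 * β - α) / β) - g b ^ ((2 * β - α) / β)) / ((2 * β - α) / β) := by
  have key : ∀ a ∈ Function.support g, ∀ b ∈ Function.support g, a < b →
      IntervalIntegrable (fun t => downFun α β g s t ^ (1 - 1 / β)) volume (s b) (s a) ∧
      ∫ t in s b..s a, downFun α β g s t ^ (1 - 1 / β)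
        = ε * (g a ^ ((2 * β - α) / β) - g b ^ ((2 * β - α) / β)) / ((2 * β - α) / β) := by
    intro a ha b hb hab
    have hI : Icc a b ⊆ Function.support g := h.ordConnected.out ha hb
    refine h.integral_escort_downFun hαβ hβ hs hab (Ioo_subset_Icc_self.trans hI)
      ((continuousOn_of_hasDerivAt hs).mono hI) ?_
    exact ContinuousOn.rpow_const
      (fun x hx => (h.differentiableAt x (hI hx)).continuousAt.continuousWithinAt)
      fun x hx => Or.inl (h.pos (hI hx)).ne'
  rcases lt_trichotomy a b with hab | rfl | hab
  · exact key a ha b hb hab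
  · simp
  · obtain ⟨h1, h2⟩ := key b hb a ha hab
    refine ⟨h1.symm, ?_⟩
    rw [intervalIntegral.integral_symm, h2]
    ring

/-- A change of variable together with a translation constant for which the
differential-escort variable is a power of the original density. -/
def IsEscortChange (α β : ℝ) (g s : ℝ → ℝ) (c : ℝ) : Prop :=
  (∀ x ∈ Function.support g, HasDerivAt s (-downJac α β g x) x) ∧
  ∀ x ∈ Function.support g,
    IntervalIntegrable (fun t => downFun α β g s t ^ (1 - 1 / β)) volume 0 (s x) ∧
    |escortVar (1 / β) c (downFun α β g s) (s x)|
      = g x ^ ((2 * β - α) / β) / |(2 * β - α) / β|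

theorem abs_escort_value (h : IsMonotoneDensity ε g) {x δ : ℝ} :
    |ε * g x ^ δ / δ| = g x ^ δ / |δ| := by
  rw [abs_div, abs_mul, h.abs_eps, one_mul, abs_of_nonneg (Real.rpow_nonneg (h.isDensity.2.1 x) _)]

theorem hasDerivAt_primitive (h : IsMonotoneDensity ε g) {x₀ x : ℝ}
    (hx₀ : x₀ ∈ Function.support g) (hx : x ∈ Function.support g) :
    HasDerivAt (fun u => -∫ t in x₀..u, downJac α β g t) (-downJac α β g x) x := by
  have hc := h.continuousOn_downJac (α := α) (β := β)
  refine (intervalIntegral.integral_hasDerivAt_right ?_ ?_ ?_).neg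
  · refine (hc.mono ?_).intervalIntegrable
    exact h.ordConnected.uIcc_subset hx₀ hx
  · exact hc.stronglyMeasurableAtFilter h.isOpen x hx
  · exact hc.continuousAt (h.isOpen.mem_nhds hx)

theorem exists_escortChange (h : IsMonotoneDensity ε g) (hαβ : α ≠ 2 * β) (hβ : β ≠ 0) :
    ∃ s c, IsEscortChange α β g s c ∧ (β = 1 → c = 0) := by
  obtain ⟨x₀, hx₀⟩ := h.nonempty
  set s₀ := fun u => -∫ t in x₀..u, downJac α β g t with hs₀
  have hs : ∀ x ∈ Function.support g, HasDerivAt s₀ (-downJac α β g x) x :=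
    fun x hx => h.hasDerivAt_primitive hx₀ hx
  have hz : s₀ x₀ = 0 := by simp [hs₀]
  set C := ε * g x₀ ^ ((2 * β - α) / β) / ((2 * β - α) / β) with hC
  by_cases hβ1 : β = 1
  · subst hβ1
    have hs' : ∀ x ∈ Function.support g,
        HasDerivAt (fun x => C + s₀ x) (-downJac α 1 g x) x := fun x hx => (hs x hx).const_add C
    refine ⟨fun x => C + s₀ x, 0, ⟨hs', fun x hx => ⟨by simp, ?_⟩⟩, fun _ => rfl⟩
    have h2 := (h.escort_between hαβ hβ hs hx hx₀).2
    simp only [div_self one_ne_zero, sub_self, Real.rpow_zero, intervalIntegral.integral_const,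
      smul_eq_mul, mul_one, hz, sub_zero] at h2
    rw [← h.abs_escort_value]
    congr 1
    simp only [escortVar, div_self one_ne_zero, sub_self, Real.rpow_zero,
      intervalIntegral.integral_const, smul_eq_mul, mul_one, sub_zero, zero_add, h2, hC]
    ring
  · refine ⟨s₀, C, ⟨hs, fun x hx => ?_⟩, fun h1 => absurd h1 hβ1⟩
    obtain ⟨h1, h2⟩ := h.escort_between hαβ hβ hs hx hx₀
    rw [hz] at h1 h2
    refine ⟨h1, ?_⟩
    rw [← h.abs_escort_value]
    congr 1
    rw [escortVar, h2, hC]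
    ring

theorem exists_escortChange_zero (h : IsMonotoneDensity ε g) (hαβ : α ≠ 2 * β) (hβ : β ≠ 0)
    {L : ℝ} (hL : Function.support g = Ioo 0 L)
    (hint : ∀ x ∈ Function.support g, IntegrableOn (downJac α β g) (Ioo x L))
    (hlim : Tendsto (fun x => g x ^ ((2 * β - α) / β)) (𝓝[<] L) (𝓝 0)) :
    ∃ s, IsEscortChange α β g s 0 := by
  have hδ0 : (2 * β - α) / β ≠ 0 := div_ne_zero (sub_ne_zero.2 hαβ.symm) hβ
  have hgL : g L = 0 := by
    rw [← Function.notMem_support, hL]; exact fun hc => lt_irrefl _ hc.2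
  have hii : ∀ x ∈ Function.support g, IntervalIntegrable (downJac α β g) volume x L := by
    intro x hx
    have hxL : x < L := by rw [hL] at hx; exact hx.2
    rw [intervalIntegrable_iff_integrableOn_Ioo_of_le hxL.le]
    exact hint x hx
  set s := fun u => ∫ t in u..L, downJac α β g t with hs_def
  have hc := h.continuousOn_downJac (α := α) (β := β)
  have hs : ∀ x ∈ Function.support g, HasDerivAt s (-downJac α β g x) x := fun x hx =>
    intervalIntegral.integral_hasDerivAt_left (hii x hx)
      (hc.stronglyMeasurableAtFilter h.isOpen x hx) (hc.continuousAt (h.isOpen.mem_nhds hx))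
  have hz : s L = 0 := by simp [hs_def]
  refine ⟨s, hs, fun x hx => ?_⟩
  have hx' := hx
  rw [hL] at hx'
  have hsc : ContinuousOn s (Icc x L) := by
    have := intervalIntegral.continuousOn_primitive_interval_left (μ := volume)
      (f := downJac α β g) (a := x) (b := L) (by
        rw [uIcc_of_le hx'.2.le, integrableOn_Icc_iff_integrableOn_Ioo]; exact hint x hx)
    rwa [uIcc_of_le hx'.2.le] at this
  have hgc : ContinuousOn (fun x => g x ^ ((2 * β - α) / β)) (Icc x L) := by
    intro y hy
    rcases hy.2.eq_or_lt with he | hyL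
    · subst he
      have : Tendsto (fun x => g x ^ ((2 * β - α) / β)) (𝓝[Iio y] y)
          (𝓝 (g y ^ ((2 * β - α) / β))) := by
        rwa [hgL, Real.zero_rpow hδ0]
      have h1 : ContinuousWithinAt (fun x => g x ^ ((2 * β - α) / β)) (Iic y) y := by
        rw [← continuousWithinAt_Iio_iff_Iic]; exact this
      exact h1.mono Icc_subset_Iic_self
    · have hyg : y ∈ Function.support g := by rw [hL]; exact ⟨hx'.1.trans_le hy.1, hyL⟩
      exact ((h.differentiableAt y hyg).continuousAt.rpow_const
        (Or.inl (h.pos hyg).ne')).continuousWithinAt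
  obtain ⟨h1, h2⟩ := h.integral_escort_downFun hαβ hβ hs hx'.2
    (by rw [hL]; exact Ioo_subset_Ioo_left hx'.1.le) hsc hgc
  rw [hz] at h1 h2
  refine ⟨h1, ?_⟩
  rw [← h.abs_escort_value, escortVar, h2, hgL, Real.zero_rpow hδ0]
  simp

end IsMonotoneDensity

namespace IsMonotoneDensity

variable {ε α β c : ℝ} {g s : ℝ → ℝ}

theorem ae_mem (h : IsMonotoneDensity ε g) : ∀ᵐ x ∂densityMeasure g, x ∈ Function.support g :=
  (ae_densityMeasure h.isDensity.1 h.isDensity.2.1).2 (ae_of_all _ fun _ hx => hx)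

theorem escortWeight_downFun (h : IsMonotoneDensity ε g) (hαβ : α ≠ 2 * β) (hβ : β ≠ 0)
    (hsc : IsEscortChange α β g s c) {x : ℝ} (hx : x ∈ Function.support g) :
    escortWeight α β c (downFun α β g s) (s x) = (g x)⁻¹ := by
  have hg := h.pos hx
  have h1 : α - 2 * β ≠ 0 := sub_ne_zero.2 hαβ
  have hδ : 0 < |(α - 2 * β) / β| := abs_pos.2 (div_ne_zero h1 hβ)
  rw [escortWeight, (hsc.2 x hx).2, abs_ratio_eq, ← Real.mul_rpow hδ.le (by positivity),
    mul_div_cancel₀ _ hδ.ne', ← Real.rpow_mul hg.le, ← Real.rpow_neg_one]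
  congr 1
  rw [← neg_sub α (2 * β)]
  field_simp

theorem weightedTail_downFun (h : IsMonotoneDensity ε g) (hαβ : α ≠ 2 * β) (hβ : β ≠ 0)
    (hsc : IsEscortChange α β g s c) {x : ℝ} (hx : x ∈ Function.support g) :
    weightedTail (densityMeasure (downFun α β g s)) (escortWeight α β c (downFun α β g s)) (s x)
      = ENNReal.ofReal x := by
  rw [weightedTail, ← lintegral_indicator measurableSet_Ioi, h.lintegral_downFun hsc.1,
    lintegral_densityMeasure h.isDensity.1]
  have : ∀ r, ENNReal.ofReal (g r) * (Ioi (s x)).indicator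
      (fun r => ENNReal.ofReal (escortWeight α β c (downFun α β g s) r)) (s r)
      = (Ioo 0 x).indicator (fun _ => (1 : ℝ≥0∞)) r := by
    intro r
    by_cases hr : r ∈ Function.support g
    · have hlt : s x < s r ↔ r < x := (h.strictAntiOn hsc.1).lt_iff_gt hx hr
      by_cases hrx : r < x
      · rw [indicator_of_mem (s := Ioi (s x)) (hlt.2 hrx),
          indicator_of_mem (s := Ioo 0 x) ⟨h.pos_of_mem r hr, hrx⟩,
          h.escortWeight_downFun hαβ hβ hsc hr, ← ENNReal.ofReal_mul (h.pos hr).le,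
          mul_inv_cancel₀ (h.pos hr).ne', ENNReal.ofReal_one]
      · rw [indicator_of_notMem (s := Ioi (s x)) (fun hc => hrx (hlt.1 hc)),
          indicator_of_notMem (s := Ioo 0 x) (fun hc => hrx hc.2), mul_zero]
    · rw [indicator_of_notMem (s := Ioo 0 x), Function.notMem_support.1 hr, ENNReal.ofReal_zero,
        zero_mul]
      exact fun hc => hr (h.mem_of_le x hx r hc.1 hc.2.le)
  simp only [this]
  rw [lintegral_indicator measurableSet_Ioo, setLIntegral_one, Real.volume_Ioo, sub_zero]

theorem escortDefined_downFun (h : IsMonotoneDensity ε g) (hsc : IsEscortChange α β g s c) :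
    EscortDefined (1 / β) (downFun α β g s) :=
  h.ae_downFun hsc.1 fun x hx => (hsc.2 x hx).1

theorem admissible_downFun (h : IsMonotoneDensity ε g) (hαβ : α ≠ 2 * β) (hβ : β ≠ 0)
    (hsc : IsEscortChange α β g s c) {p lam : ℝ}
    (hl : lam = 1 → Integrable (fun x => Real.log (g x) * g x))
    (hp : p = 0 → Integrable (fun x => Real.log x * g x)) :
    Admissible p lam α β c (downFun α β g s) := by
  have hf := h.isDensity_downFun hsc.1
  have hk := scale_pos hαβ hβ
  have hU : ∀ x ∈ Function.support g,
      ENNReal.ofReal (|(α - 2 * β) / β| ^ (β / (α - 2 * β))) *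
        upperTail α β c (downFun α β g s) (s x) = ENNReal.ofReal x := fun x hx => by
    rw [← weightedTail_escortWeight hαβ hβ hf, h.weightedTail_downFun hαβ hβ hsc hx]
  refine ⟨hf, h.escortDefined_downFun hsc, fun hl1 => ?_, fun hp0 => ⟨?_, ?_⟩⟩
  · rw [← integrable_densityMeasure hf.1 hf.2.1, (h.integrable_downFun hsc.1 _).1]
    have h1 := (integrable_densityMeasure h.isDensity.1 h.isDensity.2.1).2 (hl hl1)
    have := h.isDensity.isProbabilityMeasure
    refine ((h1.const_mul ((2 * β - α) / β)).sub
      (integrable_const (Real.log |(2 * β - α) / β|))).congr ?_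
    filter_upwards [h.ae_mem] with x hx
    have hδ : 0 < |(2 * β - α) / β| := abs_pos.2 (div_ne_zero (sub_ne_zero.2 hαβ.symm) hβ)
    rw [(hsc.2 x hx).2, Real.log_div (Real.rpow_pos_of_pos (h.pos hx) _).ne' hδ.ne',
      Real.log_rpow (h.pos hx)]
    rfl
  · refine h.ae_downFun hsc.1 fun x hx ht => ?_
    have := hU x hx
    rw [ht, ENNReal.mul_top (ENNReal.ofReal_pos.2 hk).ne'] at this
    exact ENNReal.ofReal_ne_top this.symm
  · rw [← integrable_densityMeasure hf.1 hf.2.1, (h.integrable_downFun hsc.1 _).1]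
    have h1 := (integrable_densityMeasure h.isDensity.1 h.isDensity.2.1).2 (hp hp0)
    refine h1.congr ?_
    filter_upwards [h.ae_mem] with x hx
    have := congrArg ENNReal.toReal (hU x hx)
    rw [ENNReal.toReal_mul, ENNReal.toReal_ofReal hk.le,
      ENNReal.toReal_ofReal (h.pos_of_mem x hx).le] at this
    rw [logUpper, this]

theorem upperDeviation_downFun (h : IsMonotoneDensity ε g) (hαβ : α ≠ 2 * β) (hβ : β ≠ 0)
    (hsc : IsEscortChange α β g s c) (q : ℝ) :
    upperDeviation q α β c (downFun α β g s)
      = momentDev q (densityMeasure g) ENNReal.ofReal := by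
  have hf := h.isDensity_downFun hsc.1
  rw [← momentDev_escortWeight hαβ hβ hf, momentDev, momentDev, (h.integrable_downFun hsc.1 _).2,
    h.lintegral_downFun hsc.1]
  have e : ∀ᵐ x ∂densityMeasure g, weightedTail (densityMeasure (downFun α β g s))
      (escortWeight α β c (downFun α β g s)) (s x) = ENNReal.ofReal x := by
    filter_upwards [h.ae_mem] with x hx using h.weightedTail_downFun hαβ hβ hsc hx
  congr 1
  · congr 2
    exact integral_congr_ae (e.mono fun x hx => by simp only [hx])
  · congr 1
    exact lintegral_congr_ae (e.mono fun x hx => by simp only [hx])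

theorem cumDeviation_downFun (h : IsMonotoneDensity ε g) (hαβ : α ≠ 2 * β) (hβ : β ≠ 0)
    (hsc : IsEscortChange α β g s c) {lam : ℝ}
    (hl : lam = 1 → Integrable (fun x => Real.log (g x) * g x)) :
    cumDeviation (cumOrder α β lam) (1 / β) c (downFun α β g s) ^ (1 / (2 * β - α))
      = ENNReal.ofReal (|(α - 2 * β) / β| ^ (β / (α - 2 * β)))
        * invEntropy lam (densityMeasure g) fun x => (g x)⁻¹ := by
  have hA := h.admissible_downFun (p := 1) hαβ hβ hsc hl (by norm_num)
  rw [invEntropy_escortWeight hαβ hβ hA.1 hA.2.1 hA.2.2.1]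
  congr 1
  rw [invEntropy, invEntropy, (h.integrable_downFun hsc.1 _).2, h.lintegral_downFun hsc.1]
  have e : ∀ᵐ x ∂densityMeasure g,
      escortWeight α β c (downFun α β g s) (s x) = (g x)⁻¹ := by
    filter_upwards [h.ae_mem] with x hx using h.escortWeight_downFun hαβ hβ hsc hx
  congr 1
  · congr 3
    exact integral_congr_ae (e.mono fun x hx => by simp only [hx])
  · congr 1
    exact lintegral_congr_ae (e.mono fun x hx => by simp only [hx])

end IsMonotoneDensity

namespace IsProfile

variable {q lam κ A α β : ℝ} {G : ℝ → ℝ}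

theorem isDensity (h : IsProfile q lam κ A G) : IsDensity G := by
  refine ⟨h.measurable, h.nonneg, ?_⟩
  rw [← ofReal_integral_eq_lintegral_ofReal h.integrable (ae_of_all _ h.nonneg), h.integral,
    ENNReal.ofReal_one]

theorem isMonotoneDensity (h : IsProfile q lam κ A G) : IsMonotoneDensity 1 G where
  isDensity := h.isDensity
  isOpen := h.isOpen_support
  pos_of_mem _ hx := h.pos_of_mem hx
  mem_of_le _ hx _ hy hyx := h.mem_of_le hx hy hyx
  differentiableAt _ hx := (h.hasDerivAt hx).differentiableAt
  continuousOn_deriv := by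
    have hc : ContinuousOn G (Function.support G) := h.continuousOn.mono fun x hx => h.pos_of_mem hx
    refine ContinuousOn.congr (f := fun x => -(κ * x ^ (q - 1) * G x ^ (2 - lam))) ?_
      fun x hx => (h.hasDerivAt hx).deriv
    refine ((continuousOn_const.mul ?_).mul ?_).neg
    · exact continuousOn_id.rpow_const fun x hx => Or.inl (h.pos_of_mem hx).ne'
    · exact hc.rpow_const fun x hx => Or.inl hx
  deriv_ne_zero _ hx := (h.deriv_neg hx).ne
  abs_deriv _ hx := by rw [abs_of_neg (h.deriv_neg hx), neg_one_mul]
  abs_eps := abs_one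

theorem momentDev_eq (h : IsProfile q lam κ A G) :
    momentDev q (densityMeasure G) ENNReal.ofReal = ENNReal.ofReal (deviation q G) := by
  rw [momentDev]
  split_ifs with hq
  · subst hq
    rw [deviation_log, integral_densityMeasure h.measurable h.nonneg]
    congr 3
    ext x
    rcases le_or_gt x 0 with hx | hx
    · simp [h.eq_zero x hx]
    · simp [boxCox, ENNReal.toReal_ofReal hx.le]
  · obtain ⟨h1, h2⟩ := h.deviation_rpow hq
    rw [h2, ← ENNReal.ofReal_rpow_of_pos h1, lintegral_densityMeasure h.measurable,
      ← integral_const_mul, ofReal_integral_eq_lintegral_ofReal]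
    · congr 2
      ext x
      rw [← h.rpow_mul_eq hq]
      rcases le_or_gt x 0 with hx | hx
      · simp [h.eq_zero x hx]
      · rw [ENNReal.ofReal_rpow_of_pos hx, ← ENNReal.ofReal_mul (h.nonneg x), abs_of_pos hx,
          mul_comm]
    · exact h.integrable_boxCox.const_mul q
    · refine ae_of_all _ fun x => ?_
      beta_reduce
      rw [← h.rpow_mul_eq hq]
      exact mul_nonneg (Real.rpow_nonneg (abs_nonneg _) _) (h.nonneg x)

theorem invEntropy_eq (h : IsProfile q lam κ A G) :
    invEntropy lam (densityMeasure G) (fun x => (G x)⁻¹)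
      = ENNReal.ofReal (renyiPower lam G)⁻¹ := by
  rw [invEntropy]
  split_ifs with hl
  · subst hl
    rw [renyiPower_one, integral_densityMeasure h.measurable h.nonneg, ← Real.exp_neg,
      ← integral_neg, neg_neg]
    congr 3
    ext x
    rw [Real.log_inv]; ring
  · have h1 := h.integral_rpow_pos hl
    rw [h.renyiPower_eq hl, lintegral_densityMeasure h.measurable, ← Real.rpow_neg h1.le,
      ← ENNReal.ofReal_rpow_of_pos h1, ← ofReal_integral_rpow h hl]
    congr 1
    · refine lintegral_congr fun x => ?_
      by_cases hx : x ∈ Function.support G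
      · have hG := h.pos hx
        rw [← ENNReal.ofReal_mul hG.le, Real.inv_rpow hG.le, ← Real.rpow_neg hG.le,
          ← Real.rpow_one_add' hG.le]
        · congr 2; ring
        · have := h.lam_pos.ne'
          intro hc; apply this; linarith
      · rw [Function.notMem_support.1 hx, Real.zero_rpow h.lam_pos.ne']; simp
    · rw [← neg_sub 1 lam, one_div, one_div, inv_neg]

theorem integrableOn_downJac (h : IsProfile q lam κ A G) (hψ : 0 < psi α β lam)
    {L x : ℝ} (hL : Function.support G = Ioo 0 L) (hx : x ∈ Function.support G) :
    IntegrableOn (downJac α β G) (Ioo x L) := by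
  have hx' := hx
  rw [hL] at hx'
  have hP : ∀ y ∈ Ioo x L, HasDerivAt (fun y => -(G y ^ psi α β lam / psi α β lam))
      (G y ^ (psi α β lam - 1) * |deriv G y|) y := by
    intro y hy
    have hyG : y ∈ Function.support G := by rw [hL]; exact ⟨hx'.1.trans hy.1, hy.2⟩
    have hd := (h.hasDerivAt hyG).differentiableAt.hasDerivAt
    refine ((hd.rpow_const (p := psi α β lam) (Or.inl hyG)).div_const _).neg.congr_deriv ?_
    rw [abs_of_neg (h.deriv_neg hyG)]
    field_simp
  have hPc : ContinuousOn (fun y => -(G y ^ psi α β lam / psi α β lam)) (Icc x L) :=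
    (((h.continuousOn.mono fun y hy => hx'.1.trans_le hy.1).rpow_const
      fun _ _ => Or.inr hψ.le).div_const _).neg
  have hi : IntegrableOn (fun y => G y ^ (psi α β lam - 1) * |deriv G y|) (Ioo x L) :=
    (intervalIntegral.integrableOn_deriv_of_nonneg hPc hP fun y _ =>
      mul_nonneg (Real.rpow_nonneg (h.nonneg y) _) (abs_nonneg _)).mono_set Ioo_subset_Ioc_self
  have hc : ContinuousOn (fun y : ℝ => κ ^ (β - 1) * y ^ ((q - 1) * (β - 1))) (Icc x L) :=
    continuousOn_const.mul (continuousOn_id.rpow_const fun y hy => Or.inl (hx'.1.trans_le hy.1).ne')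
  obtain ⟨C, hC⟩ := isCompact_Icc.exists_bound_of_continuousOn hc
  have hm : Measurable (downJac α β G) :=
    (h.measurable.pow_const _).mul
      ((continuous_abs.measurable.comp (measurable_deriv G)).pow_const β)
  refine (hi.const_mul C).mono' hm.aestronglyMeasurable ?_
  filter_upwards [ae_restrict_mem measurableSet_Ioo] with y hy
  have hyG : y ∈ Function.support G := by rw [hL]; exact ⟨hx'.1.trans hy.1, hy.2⟩
  have hy0 := h.pos_of_mem hyG
  have hG := h.pos hyG
  have hκ := h.kappa_pos
  have e : downJac α β G y = κ ^ (β - 1) * y ^ ((q - 1) * (β - 1)) *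
      (G y ^ (psi α β lam - 1) * |deriv G y|) := by
    have hd : |deriv G y| = κ * y ^ (q - 1) * G y ^ (2 - lam) := by
      rw [(h.hasDerivAt hyG).deriv, abs_neg, abs_of_pos (by positivity)]
    rw [downJac, ← sub_add_cancel β 1, Real.rpow_add (abs_pos.2 (h.deriv_neg hyG).ne),
      Real.rpow_one, sub_add_cancel, ← mul_assoc, ← mul_assoc]
    congr 1
    rw [hd, Real.mul_rpow (by positivity) (by positivity), Real.mul_rpow hκ.le (by positivity),
      ← Real.rpow_mul hy0.le, ← Real.rpow_mul hG.le, mul_comm, mul_assoc, ← Real.rpow_add hG]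
    congr 2
    rw [psi]; ring
  rw [e, norm_mul, Real.norm_of_nonneg (r := G y ^ (psi α β lam - 1) * |deriv G y|)
    (by positivity)]
  exact mul_le_mul_of_nonneg_right (hC y (Ioo_subset_Icc_self hy)) (by positivity)

theorem exists_escortChange_special (h : IsProfile q lam κ A G) (hαβ : α ≠ 2 * β) (hβ : β ≠ 0) :
    ∃ s c, IsMonotoneDensity.IsEscortChange α β G s c ∧
      (β = 1 ∨ (1 < lam ∧ 0 < (2 * β - α) / β ∧ 0 < psi α β lam) → c = 0) := by
  by_cases hc : 1 < lam ∧ 0 < (2 * β - α) / β ∧ 0 < psi α β lam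
  · obtain ⟨hl, hδ, hψ⟩ := hc
    obtain ⟨L, hL0, hL⟩ := h.support_eq_Ioo hl
    obtain ⟨s, hs⟩ := h.isMonotoneDensity.exists_escortChange_zero hαβ hβ hL
      (fun x hx => h.integrableOn_downJac hψ hL hx) (by
        have h1 := (h.continuousOn L hL0).rpow_const (p := (2 * β - α) / β) (Or.inr hδ.le)
        rw [ContinuousWithinAt, apply_right_end hL le_rfl, Real.zero_rpow hδ.ne'] at h1
        exact h1.mono_left (by
          rw [nhdsWithin_eq_nhds.2 (Ioi_mem_nhds hL0)]; exact nhdsWithin_le_nhds))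
    exact ⟨s, 0, hs, fun _ => rfl⟩
  · obtain ⟨s, c, hs, h1⟩ := h.isMonotoneDensity.exists_escortChange hαβ hβ
    exact ⟨s, c, hs, fun h2 => h1 (h2.resolve_right hc)⟩

end IsProfile

theorem classical_equality {α β p lam : ℝ} (hαβ : α ≠ 2 * β) (hβ : β ≠ 0)
    (hdom : ClassicalDomain p lam) :
    ∃ (f : ℝ → ℝ) (c : ℝ), IsDownTransform α β (genGauss p lam) f ∧
      Admissible p lam α β c f ∧
      upperDeviation (conjExp p) α β c f *
          cumDeviation (cumOrder α β lam) (1 / β) c f ^ (1 / (2 * β - α)) =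
        ENNReal.ofReal (|(2 * β - α) / β| ^ (β / (α - 2 * β)) * constK0 p lam) ∧
      (β = 1 ∨ (1 < lam ∧ 0 < (2 * β - α) / β ∧ 0 < psi α β lam) → c = 0) := by
  obtain ⟨κ, A, h, -⟩ := isProfile_genGauss hdom
  obtain ⟨s, c, hs, hc⟩ := h.exists_escortChange_special hαβ hβ
  have hM := h.isMonotoneDensity
  have hl : lam = 1 → Integrable (fun x => Real.log (genGauss p lam x) * genGauss p lam x) := by
    intro h1
    subst h1
    exact h.integrable_log.1.congr (ae_of_all _ fun x => mul_comm _ _)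
  refine ⟨downFun α β (genGauss p lam) s, c, hM.isDownTransform hs.1,
    hM.admissible_downFun hαβ hβ hs hl fun hp => ?_, ?_, hc⟩
  · have := h.integrable_boxCox
    rw [(conjExp_eq_zero hdom.1).2 hp] at this
    simpa [boxCox] using this
  · have hk := scale_pos hαβ hβ
    rw [hM.upperDeviation_downFun hαβ hβ hs, hM.cumDeviation_downFun hαβ hβ hs hl,
      h.momentDev_eq, h.invEntropy_eq, abs_ratio_eq, mul_left_comm,
      ← ENNReal.ofReal_mul h.deviation_pos.le, ← ENNReal.ofReal_mul hk.le, constK0,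
      div_eq_mul_inv (deviation _ _)]

/-- The inverse function theorem for an injective function with nonvanishing continuous
derivative on an open set. -/
theorem hasDerivAt_invFunOn {S S' : ℝ → ℝ} {I : Set ℝ} (hI : IsOpen I) (hinj : InjOn S I)
    (hd : ∀ x ∈ I, HasDerivAt S (S' x) x) (hc : ContinuousOn S' I) (hne : ∀ x ∈ I, S' x ≠ 0) :
    IsOpen (S '' I) ∧
      ∀ x ∈ I, HasDerivAt (Function.invFunOn S I) (S' x)⁻¹ (S x) := by
  have hmap : ∀ x ∈ I, map S (𝓝 x) = 𝓝 (S x) := fun x hx =>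
    (hasStrictDerivAt_of_hasDerivAt_of_continuousAt
      (by filter_upwards [hI.mem_nhds hx] with y hy using hd y hy)
      (hc.continuousAt (hI.mem_nhds hx))).map_nhds_eq (hne x hx)
  have hopen : IsOpen (S '' I) := by
    rw [isOpen_iff_mem_nhds]
    rintro _ ⟨x, hx, rfl⟩
    rw [← hmap x hx]
    exact image_mem_map (hI.mem_nhds hx)
  refine ⟨hopen, fun x hx => ?_⟩
  have hX : Function.invFunOn S I (S x) = x := hinj.leftInvOn_invFunOn hx
  refine HasDerivAt.of_local_left_inverse (f := S) ?_ (by rw [hX]; exact hd x hx) (hne x hx) ?_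
  · rw [ContinuousAt, hX, ← hmap x hx, tendsto_map'_iff]
    refine Tendsto.congr' ?_ tendsto_id
    filter_upwards [hI.mem_nhds hx] with y hy
    exact (hinj.leftInvOn_invFunOn hy).symm
  · filter_upwards [hopen.mem_nhds (mem_image_of_mem S hx)] with y hy
    exact Function.invFunOn_eq hy

namespace IsProfile

variable {q Λ κ A : ℝ} {G : ℝ → ℝ}

theorem image_support (h : IsProfile q Λ κ A G) (hq : 0 < q) :
    ∃ T, 0 < T ∧ G '' Function.support G = Ioo 0 T ∧ (Λ ≠ 1 → T = A ^ (1 / (Λ - 1))) := by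
  have hκ := h.kappa_pos
  have hsurj : ∀ B : ℝ, 0 < B → 0 < (q * B) ^ q⁻¹ ∧ boxCox q ((q * B) ^ q⁻¹) = B := by
    intro B hB
    have h1 : 0 < q * B := by positivity
    refine ⟨by positivity, ?_⟩
    rw [boxCox, if_neg hq.ne', ← Real.rpow_mul h1.le, inv_mul_cancel₀ hq.ne', Real.rpow_one,
      mul_div_cancel_left₀ _ hq.ne']
  by_cases hl : Λ = 1
  · subst hl
    refine ⟨Real.exp A, Real.exp_pos A, Subset.antisymm ?_ ?_, fun h1 => absurd rfl h1⟩
    · rintro _ ⟨x, hx, rfl⟩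
      have hx0 := h.pos_of_mem hx
      refine ⟨h.pos hx, ?_⟩
      rw [h.eq x hx0, if_pos rfl, Real.exp_lt_exp]
      have := mul_pos hκ (boxCox_pos hq hx0)
      linarith
    · rintro w ⟨hw, hwT⟩
      have hB : 0 < (A - Real.log w) / κ := by
        have := (Real.log_lt_iff_lt_exp hw).2 hwT
        exact div_pos (by linarith) hκ
      obtain ⟨hx, hxB⟩ := hsurj _ hB
      have e : G ((q * ((A - Real.log w) / κ)) ^ q⁻¹) = w := by
        rw [h.eq _ hx, if_pos rfl, hxB, mul_div_cancel₀ _ hκ.ne', sub_sub_cancel, Real.exp_log hw]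
      exact ⟨_, by rw [Function.mem_support, e]; exact hw.ne', e⟩
  · have hA := h.A_pos hq hl
    have hl' : Λ - 1 ≠ 0 := sub_ne_zero.2 hl
    have hT : 0 < A ^ (1 / (Λ - 1)) := Real.rpow_pos_of_pos hA _
    have hlt : ∀ w, 0 < w → (w < A ^ (1 / (Λ - 1)) ↔ 0 < (A - w ^ (Λ - 1)) / (Λ - 1)) := by
      intro w hw
      have hAT : A = (A ^ (1 / (Λ - 1))) ^ (Λ - 1) := by
        rw [← Real.rpow_mul hA.le, one_div_mul_cancel hl', Real.rpow_one]
      rcases lt_or_gt_of_ne hl' with hn | hp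
      · have hz : ∀ z : ℝ, 0 < z / (Λ - 1) ↔ z < 0 := fun z => by
          rw [← neg_div_neg_eq, div_pos_iff_of_pos_right (neg_pos.2 hn), neg_pos]
        rw [hz, sub_neg]
        nth_rw 2 [hAT]
        exact (Real.rpow_lt_rpow_iff_of_neg hT hw hn).symm
      · rw [div_pos_iff_of_pos_right hp, sub_pos]
        nth_rw 2 [hAT]
        exact (Real.rpow_lt_rpow_iff hw.le hT.le hp).symm
    refine ⟨A ^ (1 / (Λ - 1)), hT, Subset.antisymm ?_ ?_, fun _ => rfl⟩
    · rintro _ ⟨x, hx, rfl⟩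
      have hx0 := h.pos_of_mem hx
      refine ⟨h.pos hx, (hlt _ (h.pos hx)).2 ?_⟩
      rw [h.rpow_eq hl hx, sub_sub_cancel, mul_assoc, mul_div_cancel_left₀ _ hl']
      exact mul_pos hκ (boxCox_pos hq hx0)
    · rintro w ⟨hw, hwT⟩
      have hB : 0 < (A - w ^ (Λ - 1)) / (Λ - 1) / κ := div_pos ((hlt w hw).1 hwT) hκ
      obtain ⟨hx, hxB⟩ := hsurj _ hB
      have e : G ((q * ((A - w ^ (Λ - 1)) / (Λ - 1) / κ)) ^ q⁻¹) = w := by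
        rw [h.eq _ hx, if_neg hl, hxB, mul_assoc, mul_div_cancel₀ _ hκ.ne',
          mul_div_cancel₀ _ hl', sub_sub_cancel, max_eq_left (Real.rpow_nonneg hw.le _),
          ← Real.rpow_mul hw.le, mul_one_div_cancel hl', Real.rpow_one]
      exact ⟨_, by rw [Function.mem_support, e]; exact hw.ne', e⟩

/-- The change of variable of the down transformation leading from a profile to the minimizer of
the mirrored inequality. -/
def dualVar (Λ : ℝ) (G : ℝ → ℝ) (x : ℝ) : ℝ := G x ^ Λ / Λ

/-- The minimizer of the mirrored inequality, before the final down transformation. -/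
def dualDensity (Λ : ℝ) (G : ℝ → ℝ) : ℝ → ℝ := downFun (2 - Λ) 1 G (dualVar Λ G)

theorem downJac_dual (h : IsProfile q Λ κ A G) {x : ℝ} (hx : x ∈ Function.support G) :
    downJac (2 - Λ) 1 G x = κ * (x ^ (q - 1) * G x) := by
  have hG := h.pos hx
  have hx0 := h.pos_of_mem hx
  have hκ := h.kappa_pos
  have e : G x = G x ^ (1 - (2 - Λ)) * G x ^ (2 - Λ) := by
    rw [← Real.rpow_add hG]; norm_num
  rw [downJac, Real.rpow_one, (h.hasDerivAt hx).deriv, abs_neg, abs_of_pos (by positivity)]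
  nth_rw 3 [e]
  ring

theorem hasDerivAt_dualVar (h : IsProfile q Λ κ A G) {x : ℝ} (hx : x ∈ Function.support G) :
    HasDerivAt (dualVar Λ G) (-downJac (2 - Λ) 1 G x) x := by
  rw [h.downJac_dual hx]
  exact h.hasDerivAt_rpow hx

theorem dualDensity_apply (h : IsProfile q Λ κ A G) {x : ℝ} (hx : x ∈ Function.support G) :
    dualDensity Λ G (dualVar Λ G x) = κ⁻¹ * x ^ (1 - q) := by
  have hG := h.pos hx
  have hx0 := h.pos_of_mem hx
  have hκ := h.kappa_pos
  have hG' := Real.rpow_pos_of_pos hG (2 - Λ)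
  rw [dualDensity, h.isMonotoneDensity.downFun_apply (fun _ => h.hasDerivAt_dualVar) hx,
    Real.rpow_one, (h.hasDerivAt hx).deriv, abs_neg, abs_of_pos (by positivity), ← neg_sub q 1,
    Real.rpow_neg hx0.le]
  field_simp

theorem support_dualDensity (h : IsProfile q Λ κ A G) :
    Function.support (dualDensity Λ G) = dualVar Λ G '' Function.support G :=
  h.isMonotoneDensity.support_downFun fun _ => h.hasDerivAt_dualVar

theorem image_dualVar (h : IsProfile q Λ κ A G) (hq : 0 < q) :
    ∃ b, 0 < b ∧ dualVar Λ G '' Function.support G = Ioo 0 b := by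
  obtain ⟨T, hT, hG, -⟩ := h.image_support hq
  have hΛ := h.lam_pos
  refine ⟨T ^ Λ / Λ, by positivity, ?_⟩
  have : dualVar Λ G '' Function.support G = (fun w => w ^ Λ / Λ) '' (G '' Function.support G) := by
    rw [image_image]; rfl
  rw [this, hG]
  ext z
  constructor
  · rintro ⟨w, ⟨hw, hwT⟩, rfl⟩
    exact ⟨by positivity, div_lt_div_of_pos_right (Real.rpow_lt_rpow hw.le hwT hΛ) hΛ⟩
  · rintro ⟨hz, hzT⟩
    have h1 : 0 < Λ * z := by positivity
    refine ⟨(Λ * z) ^ Λ⁻¹, ⟨by positivity, ?_⟩, ?_⟩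
    · rw [Real.rpow_inv_lt_iff_of_pos h1.le hT.le hΛ]
      rwa [lt_div_iff₀' hΛ] at hzT
    · beta_reduce
      rw [Real.rpow_inv_rpow h1.le hΛ.ne', mul_div_cancel_left₀ _ hΛ.ne']

theorem strictAntiOn_dualVar (h : IsProfile q Λ κ A G) :
    StrictAntiOn (dualVar Λ G) (Function.support G) :=
  h.isMonotoneDensity.strictAntiOn fun _ => h.hasDerivAt_dualVar

/-- The inverse of the dual change of variable. -/
def dualInv (Λ : ℝ) (G : ℝ → ℝ) : ℝ → ℝ := Function.invFunOn (dualVar Λ G) (Function.support G)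

theorem dualInv_dualVar (h : IsProfile q Λ κ A G) {x : ℝ} (hx : x ∈ Function.support G) :
    dualInv Λ G (dualVar Λ G x) = x := h.strictAntiOn_dualVar.injOn.leftInvOn_invFunOn hx

theorem hasDerivAt_dualInv (h : IsProfile q Λ κ A G) :
    IsOpen (dualVar Λ G '' Function.support G) ∧ ∀ x ∈ Function.support G,
      HasDerivAt (dualInv Λ G) (-downJac (2 - Λ) 1 G x)⁻¹ (dualVar Λ G x) :=
  hasDerivAt_invFunOn h.isOpen_support h.strictAntiOn_dualVar.injOn
    (fun _ => h.hasDerivAt_dualVar) h.isMonotoneDensity.continuousOn_downJac.neg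
    fun _ hx => neg_ne_zero.2 (h.isMonotoneDensity.downJac_pos hx).ne'

theorem hasDerivAt_dualDensity (h : IsProfile q Λ κ A G) {x : ℝ} (hx : x ∈ Function.support G) :
    HasDerivAt (dualDensity Λ G) ((q - 1) * κ⁻¹ ^ 2 * x ^ (1 - 2 * q) * (G x)⁻¹)
      (dualVar Λ G x) := by
  have hx0 := h.pos_of_mem hx
  have hG := h.pos hx
  have hκ := h.kappa_pos
  obtain ⟨ho, hd⟩ := h.hasDerivAt_dualInv
  have h1 : HasDerivAt (fun u => κ⁻¹ * dualInv Λ G u ^ (1 - q))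
      (κ⁻¹ * ((-downJac (2 - Λ) 1 G x)⁻¹ * (1 - q) * x ^ (1 - q - 1))) (dualVar Λ G x) := by
    have := ((hd x hx).rpow_const (p := 1 - q)
      (Or.inl (by rw [h.dualInv_dualVar hx]; exact hx0.ne'))).const_mul κ⁻¹
    rwa [h.dualInv_dualVar hx] at this
  refine (h1.congr_of_eventuallyEq ?_).congr_deriv ?_
  · filter_upwards [ho.mem_nhds (mem_image_of_mem _ hx)] with u hu
    obtain ⟨y, hy, rfl⟩ := hu
    rw [h.dualDensity_apply hy, h.dualInv_dualVar hy]
  · have e : x ^ (1 - 2 * q) = x ^ (1 - q - 1) * (x ^ (q - 1))⁻¹ := by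
      rw [← Real.rpow_neg hx0.le, ← Real.rpow_add hx0]; congr 1; ring
    have hxq := Real.rpow_pos_of_pos hx0 (q - 1)
    rw [h.downJac_dual hx, e]
    field_simp
    ring

theorem deriv_dualDensity_pos (h : IsProfile q Λ κ A G) (hq : 1 < q) {x : ℝ}
    (hx : x ∈ Function.support G) : 0 < deriv (dualDensity Λ G) (dualVar Λ G x) := by
  have hx0 := h.pos_of_mem hx
  have hG := h.pos hx
  have hκ := h.kappa_pos
  have : 0 < q - 1 := by linarith
  rw [(h.hasDerivAt_dualDensity hx).deriv]
  positivity

theorem isMonotoneDensity_dualDensity (h : IsProfile q Λ κ A G) (hq : 1 < q) :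
    IsMonotoneDensity (-1) (dualDensity Λ G) := by
  have hI := h.support_dualDensity
  obtain ⟨b, hb, hIb⟩ := h.image_dualVar (by linarith)
  have hIb' : Function.support (dualDensity Λ G) = Ioo 0 b := hI.trans hIb
  have hpos : ∀ u ∈ Function.support (dualDensity Λ G), 0 < deriv (dualDensity Λ G) u := by
    rw [hI]
    rintro _ ⟨x, hx, rfl⟩
    exact h.deriv_dualDensity_pos hq hx
  refine ⟨h.isMonotoneDensity.isDensity_downFun fun _ => h.hasDerivAt_dualVar, ?_, ?_, ?_, ?_, ?_,
    fun u hu => (hpos u hu).ne', fun u hu => ?_, by norm_num⟩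
  · rw [hIb']; exact isOpen_Ioo
  · rw [hIb']; exact fun x hx => hx.1
  · rw [hIb']; exact fun x hx y hy hyx => ⟨hy, hyx.trans_lt hx.2⟩
  · exact fun u hu => differentiableAt_of_deriv_ne_zero (hpos u hu).ne'
  · rw [hI]
    have hX : ContinuousOn (dualInv Λ G) (dualVar Λ G '' Function.support G) := by
      rintro _ ⟨x, hx, rfl⟩
      exact (h.hasDerivAt_dualInv.2 x hx).continuousAt.continuousWithinAt
    have hXm : MapsTo (dualInv Λ G) (dualVar Λ G '' Function.support G) (Function.support G) := by
      rintro _ ⟨x, hx, rfl⟩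
      rwa [h.dualInv_dualVar hx]
    have hF : ContinuousOn (fun x => (q - 1) * κ⁻¹ ^ 2 * x ^ (1 - 2 * q) * (G x)⁻¹)
        (Function.support G) := by
      refine (continuousOn_const.mul ?_).mul ?_
      · exact continuousOn_id.rpow_const fun x hx => Or.inl (h.pos_of_mem hx).ne'
      · exact (h.continuousOn.mono fun x hx => h.pos_of_mem hx).inv₀ fun x hx => hx
    refine (hF.comp hX hXm).congr ?_
    rintro _ ⟨x, hx, rfl⟩
    rw [(h.hasDerivAt_dualDensity hx).deriv, Function.comp, h.dualInv_dualVar hx]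
  · rw [abs_of_pos (hpos u hu)]; ring

end IsProfile

namespace IsProfile

variable {q Λ κ A : ℝ} {G : ℝ → ℝ}

theorem momentDev_dualDensity (h : IsProfile q Λ κ A G) {Q : ℝ} (hQ : Λ * (1 - Q) = 1) :
    momentDev Q (densityMeasure (dualDensity Λ G)) ENNReal.ofReal ^ (Q - 1)
      = ENNReal.ofReal (Λ ^ (1 - Q) * renyiPower Λ G) := by
  have hΛ := h.lam_pos
  have hM := h.isMonotoneDensity
  have hs : ∀ x ∈ Function.support G, HasDerivAt (dualVar Λ G) (-downJac (2 - Λ) 1 G x) x :=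
    fun _ => h.hasDerivAt_dualVar
  rw [momentDev, dualDensity]
  split_ifs with hQ0
  · subst hQ0
    have hΛ1 : Λ = 1 := by linarith
    subst hΛ1
    rw [(hM.integrable_downFun hs _).2, integral_densityMeasure h.measurable h.nonneg,
      ENNReal.ofReal_rpow_of_pos (Real.exp_pos _), zero_sub, Real.rpow_neg_one, ← Real.exp_neg,
      Real.one_rpow, one_mul, renyiPower_one]
    congr 4
    ext x
    rw [dualVar, Real.rpow_one, div_one, ENNReal.toReal_ofReal (h.nonneg x), mul_comm]
  · have hl : Λ ≠ 1 := by
      rintro rfl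
      exact hQ0 (by linarith)
    have hN := h.integral_rpow_pos hl
    have e : ∫⁻ x, ENNReal.ofReal (dualVar Λ G x) ^ Q ∂densityMeasure G
        = ENNReal.ofReal (Λ ^ (-Q) * ∫ x, G x ^ Λ) := by
      rw [ENNReal.ofReal_mul (by positivity), ← ofReal_integral_rpow h hl,
        ← lintegral_const_mul' _ _ ENNReal.ofReal_ne_top, lintegral_densityMeasure h.measurable]
      refine lintegral_congr fun x => ?_
      by_cases hx : x ∈ Function.support G
      · have hG := h.pos hx
        rw [dualVar, ENNReal.ofReal_rpow_of_pos (by positivity), ← ENNReal.ofReal_mul hG.le,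
          ← ENNReal.ofReal_mul (by positivity), Real.div_rpow (by positivity) hΛ.le,
          ← Real.rpow_mul hG.le, Real.rpow_neg hΛ.le, mul_div_assoc', ← Real.rpow_one_add' hG.le]
        · rw [show 1 + Λ * Q = Λ by linarith, div_eq_inv_mul]
        · rw [show 1 + Λ * Q = Λ by linarith]; exact hΛ.ne'
      · rw [Function.notMem_support.1 hx, Real.zero_rpow hΛ.ne']; simp
    rw [hM.lintegral_downFun hs, e, ← ENNReal.rpow_mul, ENNReal.ofReal_rpow_of_pos (by positivity),
      Real.mul_rpow (by positivity) hN.le, ← Real.rpow_mul hΛ.le, h.renyiPower_eq hl]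
    have h1 : 1 - Λ ≠ 0 := sub_ne_zero.2 (Ne.symm hl)
    congr 3
    · field_simp; ring
    · rw [one_div_mul_eq_div, div_eq_div_iff hQ0 h1]; linarith

theorem invEntropy_dualDensity (h : IsProfile q Λ κ A G) {s Q : ℝ} (hsq : s.HolderConjugate q) :
    invEntropy (1 - s) (densityMeasure (dualDensity Λ G)) (fun u => (dualDensity Λ G u)⁻¹) ^ (Q - 1)
      = ENNReal.ofReal ((κ ^ s * (q * ∫ x, boxCox q x * G x)) ^ ((1 - Q) / s)) := by
  have hs := hsq.pos
  have hq := hsq.symm.pos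
  have hκ := h.kappa_pos
  have hF : 0 < κ ^ s * (q * ∫ x, boxCox q x * G x) :=
    mul_pos (by positivity) (h.deviation_rpow hq.ne').1
  have e : ∫⁻ u, ENNReal.ofReal ((dualDensity Λ G u)⁻¹ ^ s) ∂densityMeasure (dualDensity Λ G)
      = ENNReal.ofReal (κ ^ s * (q * ∫ x, boxCox q x * G x)) := by
    rw [dualDensity, h.isMonotoneDensity.lintegral_downFun fun _ => h.hasDerivAt_dualVar,
      ← integral_const_mul, ← integral_const_mul, ofReal_integral_eq_lintegral_ofReal
        ((h.integrable_boxCox.const_mul q).const_mul (κ ^ s)),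
      lintegral_densityMeasure h.measurable]
    · refine lintegral_congr fun x => ?_
      by_cases hx : x ∈ Function.support G
      · have hG := h.pos hx
        have hx0 := h.pos_of_mem hx
        have := h.dualDensity_apply hx
        rw [dualDensity] at this
        rw [this, ← ENNReal.ofReal_mul hG.le, ← neg_sub q 1, Real.rpow_neg hx0.le, ← mul_inv,
          inv_inv, Real.mul_rpow hκ.le (by positivity), ← Real.rpow_mul hx0.le,
          hsq.symm.sub_one_mul_conj, ← h.rpow_mul_eq hq.ne', abs_of_pos hx0]
        congr 1
        ring
      · rw [Function.notMem_support.1 hx]; simp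
    · refine ae_of_all _ fun x => mul_nonneg (by positivity) ?_
      rw [← h.rpow_mul_eq hq.ne']
      exact mul_nonneg (Real.rpow_nonneg (abs_nonneg _) _) (h.nonneg x)
  rw [invEntropy, if_neg (by linarith), sub_sub_cancel, e, ← ENNReal.rpow_mul,
    ENNReal.ofReal_rpow_of_pos hF]
  congr 2
  rw [sub_sub_cancel_left]
  field_simp
  ring

theorem integrable_log_dualDensity (h : IsProfile q 1 κ A G) :
    Integrable fun u => Real.log u * dualDensity 1 G u := by
  have hs : ∀ x ∈ Function.support G, HasDerivAt (dualVar 1 G) (-downJac (2 - 1) 1 G x) x :=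
    fun _ => h.hasDerivAt_dualVar
  rw [dualDensity, ← integrable_densityMeasure (h.isMonotoneDensity.measurable_downFun hs)
    (h.isMonotoneDensity.downFun_nonneg hs), (h.isMonotoneDensity.integrable_downFun hs _).1,
    integrable_densityMeasure h.measurable h.nonneg]
  refine h.integrable_log.1.congr (ae_of_all _ fun x => ?_)
  simp only [dualVar, Real.rpow_one, div_one]
  ring

variable {α β : ℝ}

theorem integrableOn_downJac_dualDensity (h : IsProfile q Λ κ A G) (hq : 1 < q)
    (hE : -1 < (q - 1) + (1 - q) * (1 - α) + (1 - 2 * q) * β) {b u : ℝ}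
    (hb : dualVar Λ G '' Function.support G = Ioo 0 b)
    (hu : u ∈ dualVar Λ G '' Function.support G) :
    IntegrableOn (downJac α β (dualDensity Λ G)) (Ioo u b) := by
  obtain ⟨x₀, hx₀, rfl⟩ := hu
  have hanti := h.strictAntiOn_dualVar
  have hx₀0 := h.pos_of_mem hx₀
  have hsub : Ioo 0 x₀ ⊆ Function.support G := fun x hx => h.mem_of_le hx₀ hx.1 hx.2.le
  have himg : Ioo (dualVar Λ G x₀) b = dualVar Λ G '' Ioo 0 x₀ := by
    refine Subset.antisymm ?_ ?_
    · rintro z ⟨hz, hzb⟩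
      have hz0 : z ∈ dualVar Λ G '' Function.support G := by
        rw [hb]
        exact ⟨lt_trans (hb.subset (mem_image_of_mem _ hx₀)).1 hz, hzb⟩
      obtain ⟨x, hx, rfl⟩ := hz0
      exact ⟨x, ⟨h.pos_of_mem hx, (hanti.lt_iff_gt hx₀ hx).1 hz⟩, rfl⟩
    · rintro _ ⟨x, hx, rfl⟩
      exact ⟨hanti (hsub hx) hx₀ hx.2, (hb.subset (mem_image_of_mem _ (hsub hx))).2⟩
  rw [himg, integrableOn_image_iff_integrableOn_abs_deriv_smul measurableSet_Ioo
    (fun x hx => (h.hasDerivAt_dualVar (hsub hx)).hasDerivWithinAt) (hanti.injOn.mono hsub)]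
  set E := (q - 1) + (1 - q) * (1 - α) + (1 - 2 * q) * β with hEdef
  set C := κ * κ⁻¹ ^ (1 - α) * ((q - 1) * κ⁻¹ ^ 2) ^ β with hC
  have hκ := h.kappa_pos
  have hq1 : 0 < q - 1 := by linarith
  obtain ⟨T, hT, hGT, -⟩ := h.image_support (by linarith)
  have hGmem : ∀ x ∈ Ioo 0 x₀, G x ∈ Icc (G x₀) T := fun x hx =>
    ⟨h.antitoneOn hx.1 hx₀0 hx.2.le, (hGT.subset (mem_image_of_mem _ (hsub hx))).2.le⟩
  have hG₀ := h.pos hx₀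
  obtain ⟨D, hD⟩ := isCompact_Icc.exists_bound_of_continuousOn
    (f := fun w : ℝ => C * w ^ (1 - β)) (s := Icc (G x₀) T)
    (continuousOn_const.mul (continuousOn_id.rpow_const
      fun w hw => Or.inl (hG₀.trans_le hw.1).ne'))
  have hi : IntegrableOn (fun x : ℝ => x ^ E) (Ioo 0 x₀) :=
    (intervalIntegral.integrableOn_Ioo_rpow_iff hx₀0).2 hE
  have e : ∀ x ∈ Ioo 0 x₀, |(-downJac (2 - Λ) 1 G x)| •
      downJac α β (dualDensity Λ G) (dualVar Λ G x) = x ^ E * (C * G x ^ (1 - β)) := by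
    intro x hx
    have hxG := hsub hx
    have hG := h.pos hxG
    have hx0 := hx.1
    rw [abs_neg, abs_of_pos (h.isMonotoneDensity.downJac_pos hxG), smul_eq_mul, h.downJac_dual hxG,
      downJac, h.dualDensity_apply hxG, abs_of_pos (h.deriv_dualDensity_pos hq hxG),
      (h.hasDerivAt_dualDensity hxG).deriv, Real.mul_rpow (by positivity) (by positivity),
      Real.mul_rpow (by positivity) (by positivity), Real.mul_rpow (by positivity) (by positivity),
      ← Real.rpow_mul hx0.le, ← Real.rpow_mul hx0.le, hEdef, Real.rpow_add hx0, Real.rpow_add hx0,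
      Real.rpow_sub hG, Real.rpow_one, Real.inv_rpow hG.le, hC]
    ring
  rw [integrableOn_congr_fun e measurableSet_Ioo]
  have hm : Measurable fun x => x ^ E * (C * G x ^ (1 - β)) :=
    (by fun_prop : Measurable fun x : ℝ => x ^ E).mul ((h.measurable.pow_const _).const_mul C)
  refine (hi.const_mul D).mono' hm.aestronglyMeasurable ?_
  filter_upwards [ae_restrict_mem measurableSet_Ioo] with x hx
  rw [norm_mul, mul_comm, Real.norm_of_nonneg (Real.rpow_nonneg hx.1.le _)]
  exact mul_le_mul_of_nonneg_right (hD _ (hGmem x hx)) (Real.rpow_nonneg hx.1.le _)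

theorem tendsto_dualDensity (h : IsProfile q Λ κ A G) (hq : 1 < q) {δ : ℝ} (hδ : δ < 0) {b : ℝ}
    (hb : dualVar Λ G '' Function.support G = Ioo 0 b) :
    Tendsto (fun u => dualDensity Λ G u ^ δ) (𝓝[<] b) (𝓝 0) := by
  have hκ := h.kappa_pos
  obtain ⟨x₀, hx₀⟩ := h.nonempty_support
  have hmem : ∀ᶠ u in 𝓝[<] b, u ∈ dualVar Λ G '' Function.support G := by
    have h1 := hb.subset (mem_image_of_mem _ hx₀)
    rw [hb]
    exact Ioo_mem_nhdsLT (h1.1.trans h1.2)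
  have hX : Tendsto (dualInv Λ G) (𝓝[<] b) (𝓝 0) := by
    rw [tendsto_order]
    constructor
    · intro a ha
      filter_upwards [hmem] with u hu
      obtain ⟨x, hx, rfl⟩ := hu
      rw [h.dualInv_dualVar hx]
      exact ha.trans (h.pos_of_mem hx)
    · intro a ha
      have hx₁ : min a x₀ ∈ Function.support G :=
        h.mem_of_le hx₀ (lt_min ha (h.pos_of_mem hx₀)) (min_le_right _ _)
      filter_upwards [Ioo_mem_nhdsLT (hb.subset (mem_image_of_mem _ hx₁)).2, hmem] with u h1 hu
      obtain ⟨x, hx, rfl⟩ := hu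
      rw [h.dualInv_dualVar hx]
      exact ((h.strictAntiOn_dualVar.lt_iff_gt hx₁ hx).1 h1.1).trans_le (min_le_left _ _)
  have hr : 0 < (1 - q) * δ := mul_pos_of_neg_of_neg (by linarith) hδ
  have h1 : Tendsto (fun u => κ⁻¹ ^ δ * dualInv Λ G u ^ ((1 - q) * δ)) (𝓝[<] b) (𝓝 0) := by
    have := (hX.rpow_const (p := (1 - q) * δ) (Or.inr hr.le)).const_mul (κ⁻¹ ^ δ)
    rwa [Real.zero_rpow hr.ne', mul_zero] at this
  refine h1.congr' ?_
  filter_upwards [hmem] with u hu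
  obtain ⟨x, hx, rfl⟩ := hu
  have hx0 := h.pos_of_mem hx
  rw [h.dualInv_dualVar hx, h.dualDensity_apply hx, Real.mul_rpow (by positivity) (by positivity),
    ← Real.rpow_mul hx0.le]

theorem exists_escortChange_dualDensity (h : IsProfile q Λ κ A G) (hq : 1 < q)
    (hαβ : α ≠ 2 * β) (hβ : β ≠ 0) :
    ∃ s c, IsMonotoneDensity.IsEscortChange α β (dualDensity Λ G) s c ∧
      (β = 1 ∨ ((2 * β - α) / β < 0 ∧
        -1 < (q - 1) + (1 - q) * (1 - α) + (1 - 2 * q) * β) → c = 0) := by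
  have hM := h.isMonotoneDensity_dualDensity hq
  by_cases hc : (2 * β - α) / β < 0 ∧ -1 < (q - 1) + (1 - q) * (1 - α) + (1 - 2 * q) * β
  · obtain ⟨hδ, hE⟩ := hc
    obtain ⟨b, hb0, hb⟩ := h.image_dualVar (by linarith)
    obtain ⟨s, hs⟩ := hM.exists_escortChange_zero hαβ hβ (h.support_dualDensity.trans hb)
      (fun u hu => h.integrableOn_downJac_dualDensity hq hE hb (by
        rwa [h.support_dualDensity] at hu)) (h.tendsto_dualDensity hq hδ hb)
    exact ⟨s, 0, hs, fun _ => rfl⟩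
  · obtain ⟨s, c, hs, h1⟩ := hM.exists_escortChange hαβ hβ
    exact ⟨s, c, hs, fun h2 => h1 (h2.resolve_right hc)⟩

end IsProfile

theorem mirrored_equality {α β p lam : ℝ} (hαβ : α ≠ 2 * β) (hβ : β ≠ 0)
    (hdom : MirroredDomain p lam) :
    ∃ (h f : ℝ → ℝ) (c : ℝ),
      IsDownTransform (1 + p) 1 (genGauss (1 - lam) (1 - p)) h ∧
      IsDownTransform α β h f ∧
      Admissible p lam α β c f ∧
      upperDeviation (conjExp p) α β c f ^ (conjExp p - 1) *
          cumDeviation (cumOrder α β lam) (1 / β) c f ^ ((conjExp p - 1) / (2 * β - α)) =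
        ENNReal.ofReal (|(2 * β - α) / β| ^ (β * (conjExp p - 1) / (α - 2 * β)) *
          constKappa0 p lam) ∧
      (β = 1 ∨ ((2 * β - α) / β < 0 ∧ psi α β lam < 0) → c = 0) := by
  obtain ⟨hQ1, hp0, hQ, hsq, hcl⟩ := hdom.conjExp_facts
  obtain ⟨κ, A, h, -⟩ := isProfile_genGauss hcl
  have hl0 := hdom.2.1
  have hl1 : lam ≠ 1 := by linarith
  have hq := hsq.symm.lt
  have hpΛ : 1 + p = 2 - (1 - p) := by ring
  obtain ⟨s, c, hs, hc⟩ := h.exists_escortChange_dualDensity hq hαβ hβ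
  have hM := h.isMonotoneDensity_dualDensity hq
  have hl : lam = 1 → Integrable (fun u =>
      Real.log (IsProfile.dualDensity (1 - p) (genGauss (1 - lam) (1 - p)) u)
        * IsProfile.dualDensity (1 - p) (genGauss (1 - lam) (1 - p)) u) :=
    fun h1 => absurd h1 hl1
  refine ⟨IsProfile.dualDensity (1 - p) (genGauss (1 - lam) (1 - p)), _, c, ?_,
    hM.isDownTransform hs.1, hM.admissible_downFun hαβ hβ hs hl fun hp => ?_, ?_,
    fun h1 => hc (h1.imp_right fun h2 => ⟨h2.1, ?_⟩)⟩
  · rw [hpΛ]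
    exact h.isMonotoneDensity.isDownTransform fun _ => h.hasDerivAt_dualVar
  · subst hp
    rw [sub_zero] at h ⊢
    exact h.integrable_log_dualDensity
  · have hk := scale_pos hαβ hβ
    have e1 : (conjExp p - 1) / (2 * β - α) = 1 / (2 * β - α) * (conjExp p - 1) := by ring
    have e2 : β * (conjExp p - 1) / (α - 2 * β) = β / (α - 2 * β) * (conjExp p - 1) := by ring
    have hF : 0 < κ ^ (1 - lam) * (conjExp (1 - lam) *
        ∫ x, boxCox (conjExp (1 - lam)) x * genGauss (1 - lam) (1 - p) x) :=
      mul_pos (Real.rpow_pos_of_pos h.kappa_pos _) (h.deviation_rpow hsq.symm.pos.ne').1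
    have hR := h.renyiPower_pos
    have hE := h.invEntropy_dualDensity (Q := conjExp p) hsq
    rw [sub_sub_cancel] at hE
    rw [e1, ENNReal.rpow_mul, hM.upperDeviation_downFun hαβ hβ hs,
      hM.cumDeviation_downFun hαβ hβ hs hl, ofReal_mul_rpow hk, hE, h.momentDev_dualDensity hQ,
      abs_ratio_eq, e2, Real.rpow_mul (abs_nonneg _), ENNReal.ofReal_rpow_of_pos hk, mul_left_comm,
      ← ENNReal.ofReal_mul (by positivity), ← ENNReal.ofReal_mul (by positivity)]
    congr 2
    rw [constKappa0_eq hdom h]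
  · have h2' : psi α β lam < 0 := h2.2
    have hln := hl0.ne
    have hq' : conjExp (1 - lam) = 1 - 1 / lam := by
      rw [conjExp, sub_sub_cancel_left]; field_simp; ring
    have h3 : 0 < psi α β lam / lam := div_pos_of_neg_of_neg h2' hl0
    have h4 : (conjExp (1 - lam) - 1) + (1 - conjExp (1 - lam)) * (1 - α)
        + (1 - 2 * conjExp (1 - lam)) * β = psi α β lam / lam - 1 := by
      rw [hq', psi]; field_simp; ring
    rw [h4]; linarith

/-! The explicit form of the minimizer. -/

section Trigonometric

variable {α β lam w₀ : ℝ}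

theorem isOpen_branch : IsOpen (branch α β lam) := by
  rw [branch]; split_ifs; exacts [isOpen_Ioo, isOpen_Ioi]

theorem ordConnected_branch : (branch α β lam).OrdConnected := by
  rw [branch]; split_ifs; exacts [ordConnected_Ioo, ordConnected_Ioi]

theorem pos_of_mem_branch {z : ℝ} (hz : z ∈ branch α β lam) : 0 < z ∧ z ≠ 1 := by
  rw [branch] at hz
  split_ifs at hz
  · exact ⟨hz.1, hz.2.ne⟩
  · exact ⟨one_pos.trans hz, (ne_of_lt hz).symm⟩

/-- The integrand of the generalized arcsine on the branch. -/
theorem arcsin_integrand_pos {Q r z : ℝ} (hQ : Q ≠ 0) (hz : z ∈ branch α β lam) :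
    0 < |1 - z ^ Q| ∧ 0 < |1 - z ^ Q| ^ r := by
  obtain ⟨h0, h1⟩ := pos_of_mem_branch hz
  have : 0 < |1 - z ^ Q| := by
    refine abs_pos.2 (sub_ne_zero.2 fun hc => h1 ?_)
    rw [← Real.one_rpow Q] at hc
    exact (Real.rpow_left_inj h0.le zero_le_one hQ).1 hc.symm
  exact ⟨this, Real.rpow_pos_of_pos this r⟩

theorem continuousOn_arcsin_integrand {Q r : ℝ} (hQ : Q ≠ 0) :
    ContinuousOn (fun t : ℝ => |1 - t ^ Q| ^ r) (branch α β lam) := by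
  refine ContinuousOn.rpow_const (ContinuousOn.abs (continuousOn_const.sub
    (continuousOn_id.rpow_const fun z hz => Or.inl (pos_of_mem_branch hz).1.ne')))
    fun z hz => Or.inl (arcsin_integrand_pos (r := r) hQ hz).1.ne'

theorem intervalIntegrable_arcsin {r z : ℝ} (hψ : psi α β lam ≠ 0) (hlam : lam ≠ 1)
    (hw : BasePoint α β lam w₀) (hz : z ∈ branch α β lam) :
    IntervalIntegrable (fun t : ℝ => |1 - t ^ ((lam - 1) / psi α β lam)| ^ r) volume w₀ z := by
  have hQ : (lam - 1) / psi α β lam ≠ 0 := div_ne_zero (sub_ne_zero.2 hlam) hψ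
  rcases hw with hw | ⟨hl, hψ0, rfl⟩
  · exact ((continuousOn_arcsin_integrand hQ).mono
      (ordConnected_branch.uIcc_subset hw hz)).intervalIntegrable
  · rw [branch, if_pos hψ0] at hz
    have hQ0 : 0 < (lam - 1) / psi α β lam := div_pos (by linarith) hψ0
    refine ContinuousOn.intervalIntegrable ?_
    rw [uIcc_of_le hz.1.le]
    refine ContinuousOn.rpow_const (ContinuousOn.abs (continuousOn_const.sub
      (continuousOn_id.rpow_const fun _ _ => Or.inr hQ0.le))) fun t ht => Or.inl ?_
    have := Real.rpow_lt_one ht.1 (ht.2.trans_lt hz.2) hQ0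
    exact (abs_pos.2 (sub_pos.2 this).ne').ne'

theorem hasDerivAt_genArcsin {P z : ℝ} (hψ : psi α β lam ≠ 0) (hlam : lam ≠ 1)
    (hw : BasePoint α β lam w₀) (hz : z ∈ branch α β lam) :
    HasDerivAt (genArcsin P ((lam - 1) / psi α β lam) w₀)
      (|1 - z ^ ((lam - 1) / psi α β lam)| ^ (-1 / P)) z := by
  have hQ : (lam - 1) / psi α β lam ≠ 0 := div_ne_zero (sub_ne_zero.2 hlam) hψ
  have hc := continuousOn_arcsin_integrand (α := α) (β := β) (lam := lam) (r := -1 / P) hQ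
  exact intervalIntegral.integral_hasDerivAt_right (intervalIntegrable_arcsin hψ hlam hw hz)
    (hc.stronglyMeasurableAtFilter isOpen_branch z hz)
    (hc.continuousAt (isOpen_branch.mem_nhds hz))

theorem injOn_genArcsin {P : ℝ} (hψ : psi α β lam ≠ 0) (hlam : lam ≠ 1)
    (hw : BasePoint α β lam w₀) :
    InjOn (genArcsin P ((lam - 1) / psi α β lam) w₀) (branch α β lam) := by
  have hQ : (lam - 1) / psi α β lam ≠ 0 := div_ne_zero (sub_ne_zero.2 hlam) hψ
  refine (strictMonoOn_of_deriv_pos ordConnected_branch.convex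
    (fun z hz => (hasDerivAt_genArcsin hψ hlam hw hz).continuousAt.continuousWithinAt)
    fun z hz => ?_).injOn
  rw [isOpen_branch.interior_eq] at hz
  rw [(hasDerivAt_genArcsin hψ hlam hw hz).deriv]
  exact (arcsin_integrand_pos hQ hz).2

theorem genSin_genArcsin {P z : ℝ} (hψ : psi α β lam ≠ 0) (hlam : lam ≠ 1)
    (hw : BasePoint α β lam w₀) (hz : z ∈ branch α β lam) :
    genSin P ((lam - 1) / psi α β lam) w₀ (branch α β lam)
      (genArcsin P ((lam - 1) / psi α β lam) w₀ z) = z :=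
  (injOn_genArcsin hψ hlam hw).leftInvOn_invFunOn hz

theorem genCos_genArcsin {P z : ℝ} (hψ : psi α β lam ≠ 0) (hlam : lam ≠ 1)
    (hw : BasePoint α β lam w₀) (hz : z ∈ branch α β lam) :
    genCos P ((lam - 1) / psi α β lam) w₀ (branch α β lam)
      (genArcsin P ((lam - 1) / psi α β lam) w₀ z)
      = (|1 - z ^ ((lam - 1) / psi α β lam)| ^ (-1 / P))⁻¹ := by
  have hQ : (lam - 1) / psi α β lam ≠ 0 := div_ne_zero (sub_ne_zero.2 hlam) hψ
  exact ((hasDerivAt_invFunOn isOpen_branch (injOn_genArcsin hψ hlam hw)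
    (fun _ hz => hasDerivAt_genArcsin hψ hlam hw hz) (continuousOn_arcsin_integrand hQ)
    fun _ hz => (arcsin_integrand_pos hQ hz).2.ne').2 z hz).deriv

end Trigonometric

theorem constC_mul {p lam : ℝ} (hdom : ClassicalDomain p lam) (hp : p ≠ 0) (hlam : lam ≠ 1)
    (r : ℝ) :
    constC p lam ^ r * gaussNorm p lam ^ ((1 - lam) * r / p)
      = |lam - 1| ^ (r / p) * (conjExp p * gaussNorm p lam ^ (lam - 1)) ^ (-r) := by
  have ha := gaussNorm_pos hdom
  have hq := hdom.conjExp_pos hp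
  have hp1 : p - 1 ≠ 0 := sub_ne_zero.2 hdom.1
  have hl : 0 < |lam - 1| := abs_pos.2 (sub_ne_zero.2 hlam)
  have e : gaussNorm p lam ^ ((1 - lam) * r / p)
      = gaussNorm p lam ^ ((lam - 1) / conjExp p * r) * gaussNorm p lam ^ ((lam - 1) * -r) := by
    rw [← Real.rpow_add ha]
    congr 1
    rw [conjExp]
    field_simp
    ring
  rw [constC, abs_sub_comm 1 lam, Real.div_rpow (by positivity) (by positivity),
    Real.mul_rpow hq.le (by positivity), Real.mul_rpow hq.le (by positivity),
    ← Real.rpow_mul hl.le, ← Real.rpow_mul ha.le, ← Real.rpow_mul ha.le, Real.rpow_neg hq.le,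
    e, one_div_mul_eq_div]
  field_simp

theorem constScale_eq {α β p lam : ℝ} (hdom : ClassicalDomain p lam) (hp : p ≠ 0)
    (hlam : lam ≠ 1) :
    constScale p lam α β = |lam - 1| ^ ((1 - β) / p) *
      (conjExp p * gaussNorm p lam ^ (lam - 1)) ^ (β - 1) *
        gaussNorm p lam ^ psi α β lam / psi α β lam := by
  have h := constC_mul hdom hp hlam (1 - β)
  rw [neg_sub] at h
  rw [constScale, Real.rpow_add (gaussNorm_pos hdom), ← mul_assoc, ← h]
  congr 4
  ring

theorem constAmp_eq {α β p lam : ℝ} (hdom : ClassicalDomain p lam) (hp : p ≠ 0)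
    (hlam : lam ≠ 1) :
    constAmp p lam α β = |lam - 1| ^ (β / p) *
      (conjExp p * gaussNorm p lam ^ (lam - 1)) ^ (-β) *
        gaussNorm p lam ^ (α + (lam - 2) * β) := by
  rw [constAmp, Real.rpow_add (gaussNorm_pos hdom), ← constC_mul hdom hp hlam]
  ring

theorem explicit_minimizer {α β p lam : ℝ} (hdom : ClassicalDomain p lam) (hp : p ≠ 0)
    (hlam : lam ≠ 1) (hβ1 : β ≠ 1) (hψ : psi α β lam ≠ 0) {f : ℝ → ℝ}
    (hf : IsDownTransform α β (genGauss p lam) f) {w₀ : ℝ} (hw : BasePoint α β lam w₀) :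
    ∃ t₀ : ℝ, ∀ t : ℝ,
      (t - t₀ ∈ explicitSupp p lam α β w₀ → f t = explicitMin p lam α β w₀ (t - t₀)) ∧
      (t - t₀ ∉ explicitSupp p lam α β w₀ → f t = 0) := by
  obtain ⟨κ, A, h, hκA⟩ := isProfile_genGauss hdom
  obtain ⟨hA, hκeq⟩ := hκA hp hlam
  obtain ⟨-, -, -, s, hs, hfs, hf0⟩ := hf
  have ha := gaussNorm_pos hdom
  have hq := hdom.conjExp_pos hp
  have hκ := h.kappa_pos
  have hl : 0 < |lam - 1| := abs_pos.2 (sub_ne_zero.2 hlam)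
  have hl' : lam - 1 ≠ 0 := sub_ne_zero.2 hlam
  have hβ' : β - 1 ≠ 0 := sub_ne_zero.2 hβ1
  have hqp : conjExp p / p = conjExp p - 1 := by
    have : p - 1 ≠ 0 := sub_ne_zero.2 hdom.1
    rw [conjExp]; field_simp; ring
  have hK := constScale_eq (α := α) (β := β) hdom hp hlam
  have hAmp := constAmp_eq (α := α) (β := β) hdom hp hlam
  rw [← hκeq] at hK hAmp
  obtain ⟨T, -, hGT, hT⟩ := h.image_support hq
  have hTa : T = gaussNorm p lam := by
    rw [hT hlam, hA, ← Real.rpow_mul ha.le, mul_one_div_cancel hl', Real.rpow_one]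
  rw [hTa] at hGT
  set a := gaussNorm p lam
  set G := genGauss p lam
  set q := conjExp p
  set Ψ := psi α β lam with hΨ
  set J := branch α β lam with hJ
  set P := p / (1 - β) with hP
  set Q := (lam - 1) / Ψ with hQ
  set K := constScale p lam α β
  have hK0 : K ≠ 0 := by
    rw [hK]
    exact div_ne_zero (by positivity) hψ
  set z : ℝ → ℝ := fun x => (G x / a) ^ Ψ with hz
  have himg : z '' Function.support G = J := by
    have e : z '' Function.support G = (fun w => (w / a) ^ Ψ) '' (G '' Function.support G) := by
      rw [image_image]
    rw [e, hGT, hJ, branch]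
    have hinv : ∀ y : ℝ, 0 < y → (a * y ^ Ψ⁻¹ / a) ^ Ψ = y := fun y hy => by
      rw [mul_div_cancel_left₀ _ ha.ne', Real.rpow_inv_rpow hy.le hψ]
    split_ifs with h0
    · ext y
      constructor
      · rintro ⟨w, ⟨hw0, hwa⟩, rfl⟩
        exact ⟨by positivity, Real.rpow_lt_one (by positivity) ((div_lt_one ha).2 hwa) h0⟩
      · rintro ⟨hy0, hy1⟩
        refine ⟨a * y ^ Ψ⁻¹, ⟨by positivity, ?_⟩, hinv y hy0⟩
        exact mul_lt_of_lt_one_right ha (Real.rpow_lt_one hy0.le hy1 (inv_pos.2 h0))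
    · have h0' : Ψ < 0 := lt_of_le_of_ne (not_lt.1 h0) hψ
      ext y
      constructor
      · rintro ⟨w, ⟨hw0, hwa⟩, rfl⟩
        exact Real.one_lt_rpow_of_pos_of_lt_one_of_neg (by positivity) ((div_lt_one ha).2 hwa) h0'
      · intro hy1
        have hy0 : 0 < y := one_pos.trans hy1
        refine ⟨a * y ^ Ψ⁻¹, ⟨by positivity, ?_⟩, hinv y hy0⟩
        exact mul_lt_of_lt_one_right ha (Real.rpow_lt_one_of_one_lt_of_neg hy1 (inv_lt_zero.2 h0'))
  have hzJ : ∀ x ∈ Function.support G, z x ∈ J := fun x hx => himg.subset (mem_image_of_mem z hx)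
  have habs : ∀ x ∈ Function.support G, ∀ r, |1 - z x ^ Q| ^ r = |lam - 1| ^ r * x ^ (q * r) := by
    intro x hx r
    have hx0 := h.pos_of_mem hx
    have hG := h.pos hx
    have e1 : z x ^ Q = 1 - (lam - 1) * x ^ q := by
      rw [hz, ← Real.rpow_mul (by positivity), hQ, mul_div_cancel₀ _ hψ,
        Real.div_rpow hG.le ha.le, h.rpow_eq hlam hx, hA, hκeq, boxCox, if_neg hq.ne']
      have := Real.rpow_pos_of_pos ha (lam - 1)
      field_simp
    rw [e1, sub_sub_cancel, abs_mul, abs_of_pos (Real.rpow_pos_of_pos hx0 q),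
      Real.mul_rpow hl.le (by positivity), ← Real.rpow_mul hx0.le]
  have hP' : -1 / P = (β - 1) / p := by
    have : 1 - β ≠ 0 := by rw [← neg_sub]; exact neg_ne_zero.2 hβ'
    rw [hP]; field_simp; ring
  have hW : ∀ x ∈ Function.support G, |1 - z x ^ Q| ^ (-1 / P)
      = |lam - 1| ^ ((β - 1) / p) * x ^ ((q - 1) * (β - 1)) := by
    intro x hx
    rw [habs x hx, hP', ← hqp]
    congr 2
    ring
  have hd : ∀ x ∈ Function.support G, |deriv G x| = κ * x ^ (q - 1) * G x ^ (2 - lam) := by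
    intro x hx
    have hx0 := h.pos_of_mem hx
    have hG := h.pos hx
    rw [(h.hasDerivAt hx).deriv, abs_neg, abs_of_pos (by positivity)]
  have hder : ∀ x ∈ Function.support G,
      HasDerivAt (fun x => s x - K * genArcsin P Q w₀ (z x)) 0 x := by
    intro x hx
    have hx0 := h.pos_of_mem hx
    have hG := h.pos hx
    have hz' : HasDerivAt z
        (-(κ * x ^ (q - 1) * G x ^ (2 - lam)) / a * Ψ * (G x / a) ^ (Ψ - 1)) x :=
      ((h.hasDerivAt hx).div_const a).rpow_const (Or.inl (by positivity))
    refine ((hs x hx).sub (((hasDerivAt_genArcsin hψ hlam hw (hzJ x hx)).comp x hz').const_mul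
      K)).congr_deriv ?_
    rw [hW x hx, hd x hx, hK, Real.mul_rpow (by positivity) (by positivity),
      Real.mul_rpow hκ.le (by positivity), ← Real.rpow_mul hx0.le, ← Real.rpow_mul hG.le,
      Real.div_rpow hG.le ha.le, Real.rpow_sub_one ha.ne', Real.rpow_sub_one hκ.ne']
    have e1 : G x ^ (1 - α) * G x ^ ((2 - lam) * β) = G x ^ (Ψ - 1) * G x ^ (2 - lam) := by
      rw [← Real.rpow_add hG, ← Real.rpow_add hG]
      congr 1
      rw [hΨ, psi]; ring
    have e2 : x ^ ((q - 1) * β) = x ^ ((q - 1) * (β - 1)) * x ^ (q - 1) := by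
      rw [← Real.rpow_add hx0]; congr 1; ring
    have e3 : |lam - 1| ^ ((1 - β) / p) * |lam - 1| ^ ((β - 1) / p) = 1 := by
      rw [← Real.rpow_add hl, ← add_div]; simp
    have haΨ := Real.rpow_pos_of_pos ha Ψ
    calc -(G x ^ (1 - α) * (κ ^ β * x ^ ((q - 1) * β) * G x ^ ((2 - lam) * β))) -
          |lam - 1| ^ ((1 - β) / p) * (κ ^ β / κ) * a ^ Ψ / Ψ *
            (|lam - 1| ^ ((β - 1) / p) * x ^ ((q - 1) * (β - 1)) *
              (-(κ * x ^ (q - 1) * G x ^ (2 - lam)) / a * Ψ * (G x ^ (Ψ - 1) / (a ^ Ψ / a))))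
        = κ ^ β * ((|lam - 1| ^ ((1 - β) / p) * |lam - 1| ^ ((β - 1) / p)) *
            (x ^ ((q - 1) * (β - 1)) * x ^ (q - 1)) * (G x ^ (Ψ - 1) * G x ^ (2 - lam))
            - x ^ ((q - 1) * β) * (G x ^ (1 - α) * G x ^ ((2 - lam) * β))) := by
          field_simp
          ring
      _ = 0 := by rw [e1, e2, e3]; ring
  obtain ⟨x₀, hx₀⟩ := h.nonempty_support
  have hconst : ∀ x ∈ Function.support G,
      s x - K * genArcsin P Q w₀ (z x) = s x₀ - K * genArcsin P Q w₀ (z x₀) := fun x hx =>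
    h.isOpen_support.is_const_of_deriv_eq_zero h.ordConnected_support.isPreconnected
      (fun y hy => (hder y hy).differentiableAt.differentiableWithinAt)
      (fun y hy => (hder y hy).deriv) hx hx₀
  set t₀ := s x₀ - K * genArcsin P Q w₀ (z x₀)
  have hquot : ∀ x ∈ Function.support G, (s x - t₀) / K = genArcsin P Q w₀ (z x) := by
    intro x hx
    rw [← hconst x hx, sub_sub_cancel, mul_div_cancel_left₀ _ hK0]
  have hmem : ∀ t, t - t₀ ∈ explicitSupp p lam α β w₀ ↔ t ∈ s '' Function.support G := by
    intro t
    have : t - t₀ ∈ explicitSupp p lam α β w₀ ↔ (t - t₀) / K ∈ genArcsin P Q w₀ '' J := Iff.rfl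
    rw [this, ← himg, image_image]
    constructor
    · rintro ⟨x, hx, he⟩
      beta_reduce at he
      rw [← hquot x hx, div_left_inj' hK0, sub_left_inj] at he
      exact ⟨x, hx, he⟩
    · rintro ⟨x, hx, rfl⟩
      exact ⟨x, hx, (hquot x hx).symm⟩
  refine ⟨t₀, fun t => ⟨fun ht => ?_, fun ht => hf0 t fun hc => ht ((hmem t).2 hc)⟩⟩
  obtain ⟨x, hx, rfl⟩ := (hmem t).1 ht
  have hx0 := h.pos_of_mem hx
  have hG := h.pos hx
  rw [hfs x hx, explicitMin, hquot x hx, genSin_genArcsin hψ hlam hw (hzJ x hx),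
    genCos_genArcsin hψ hlam hw (hzJ x hx), hW x hx, hAmp, hd x hx,
    Real.mul_rpow (by positivity) (by positivity), Real.mul_rpow hκ.le (by positivity),
    ← Real.rpow_mul hx0.le, ← Real.rpow_mul hG.le, ← Real.rpow_neg_one,
    ← Real.rpow_mul (by positivity), Real.mul_rpow (by positivity) (by positivity),
    ← Real.rpow_mul hl.le, ← Real.rpow_mul hx0.le, Real.mul_rpow (by positivity) (by positivity),
    ← Real.rpow_mul hl.le, ← Real.rpow_mul hx0.le,
    mul_div_cancel₀ _ hψ, Real.div_rpow hG.le ha.le]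
  have e1 : (β - 1) / p * -1 * (β / (β - 1)) = -(β / p) := by field_simp
  have e2 : (q - 1) * (β - 1) * -1 * (β / (β - 1)) = -((q - 1) * β) := by field_simp
  have e3 : G x ^ (α + (lam - 2) * β) = G x ^ α / G x ^ ((2 - lam) * β) := by
    rw [← Real.rpow_sub hG]; congr 1; ring
  have haa := Real.rpow_pos_of_pos ha (α + (lam - 2) * β)
  rw [e1, e2, e3, Real.rpow_neg hl.le, Real.rpow_neg hx0.le, Real.rpow_neg hκ.le]
  field_simp

end CumUpper

end

theorem mainTheorem4 (α β p lam : ℝ) (hαβ : α ≠ 2 * β) (hβ : β ≠ 0) :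
    (CumUpper.ClassicalDomain p lam →
      (∀ (f : ℝ → ℝ) (c : ℝ), CumUpper.Admissible p lam α β c f →
        CumUpper.Determinate
          (CumUpper.upperDeviation (CumUpper.conjExp p) α β c f)
          (CumUpper.cumDeviation (CumUpper.cumOrder α β lam) (1 / β) c f ^ (1 / (2 * β - α))) →
        ENNReal.ofReal (|(2 * β - α) / β| ^ (β / (α - 2 * β)) * CumUpper.constK0 p lam) ≤
          CumUpper.upperDeviation (CumUpper.conjExp p) α β c f *
            CumUpper.cumDeviation (CumUpper.cumOrder α β lam) (1 / β) c f ^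
              (1 / (2 * β - α))) ∧
      0 < CumUpper.constK0 p lam ∧
      (∃ (f : ℝ → ℝ) (c : ℝ),
        CumUpper.IsDownTransform α β (CumUpper.genGauss p lam) f ∧
        CumUpper.Admissible p lam α β c f ∧
        CumUpper.upperDeviation (CumUpper.conjExp p) α β c f *
            CumUpper.cumDeviation (CumUpper.cumOrder α β lam) (1 / β) c f ^ (1 / (2 * β - α)) =
          ENNReal.ofReal (|(2 * β - α) / β| ^ (β / (α - 2 * β)) * CumUpper.constK0 p lam) ∧
        (β = 1 ∨ (1 < lam ∧ 0 < (2 * β - α) / β ∧ 0 < CumUpper.psi α β lam) → c = 0)) ∧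
      (p ≠ 0 → lam ≠ 1 → β ≠ 1 → CumUpper.psi α β lam ≠ 0 →
        ∀ f : ℝ → ℝ, CumUpper.IsDownTransform α β (CumUpper.genGauss p lam) f →
          ∀ w₀ : ℝ, CumUpper.BasePoint α β lam w₀ →
            ∃ t₀ : ℝ, ∀ t : ℝ,
              (t - t₀ ∈ CumUpper.explicitSupp p lam α β w₀ →
                f t = CumUpper.explicitMin p lam α β w₀ (t - t₀)) ∧
              (t - t₀ ∉ CumUpper.explicitSupp p lam α β w₀ → f t = 0))) ∧
    (CumUpper.MirroredDomain p lam →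
      (∀ (f : ℝ → ℝ) (c : ℝ), CumUpper.Admissible p lam α β c f →
        CumUpper.Determinate
          (CumUpper.upperDeviation (CumUpper.conjExp p) α β c f ^ (CumUpper.conjExp p - 1))
          (CumUpper.cumDeviation (CumUpper.cumOrder α β lam) (1 / β) c f ^
            ((CumUpper.conjExp p - 1) / (2 * β - α))) →
        ENNReal.ofReal (|(2 * β - α) / β| ^ (β * (CumUpper.conjExp p - 1) / (α - 2 * β)) *
            CumUpper.constKappa0 p lam) ≤
          CumUpper.upperDeviation (CumUpper.conjExp p) α β c f ^ (CumUpper.conjExp p - 1) *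
            CumUpper.cumDeviation (CumUpper.cumOrder α β lam) (1 / β) c f ^
              ((CumUpper.conjExp p - 1) / (2 * β - α))) ∧
      0 < CumUpper.constKappa0 p lam ∧
      (∃ (h f : ℝ → ℝ) (c : ℝ),
        CumUpper.IsDownTransform (1 + p) 1 (CumUpper.genGauss (1 - lam) (1 - p)) h ∧
        CumUpper.IsDownTransform α β h f ∧
        CumUpper.Admissible p lam α β c f ∧
        CumUpper.upperDeviation (CumUpper.conjExp p) α β c f ^ (CumUpper.conjExp p - 1) *
            CumUpper.cumDeviation (CumUpper.cumOrder α β lam) (1 / β) c f ^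
              ((CumUpper.conjExp p - 1) / (2 * β - α)) =
          ENNReal.ofReal (|(2 * β - α) / β| ^ (β * (CumUpper.conjExp p - 1) / (α - 2 * β)) *
            CumUpper.constKappa0 p lam) ∧
        (β = 1 ∨ ((2 * β - α) / β < 0 ∧ CumUpper.psi α β lam < 0) → c = 0))) :=
  ⟨fun hdom => ⟨fun _ _ hf hdet => CumUpper.classical_inequality hαβ hβ hdom hf hdet,
      CumUpper.constK0_pos hdom, CumUpper.classical_equality hαβ hβ hdom,
      fun hp hl hβ1 hψ _ hf _ hw =>
        CumUpper.explicit_minimizer hdom hp hl hβ1 hψ hf hw⟩,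
    fun hdom => ⟨fun _ _ hf hdet => CumUpper.mirrored_inequality hαβ hβ hdom hf hdet,
      CumUpper.constKappa0_pos hdom, CumUpper.mirrored_equality hαβ hβ hdom⟩⟩
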